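/- Let $p$ be a prime. Let $X_0$ be the set of isomorphism classes of finite abelian $p$-groups (equivalently, finite $\mathbb Z_p$-modules) and $X_1$ the set of isomorphism classes of finitely generated $\mathbb Z_p$-modules of $\mathbb Q_p$-rank $1$. A (signed) measure on one of these discrete sets is identified with the real function giving the mass of each point. For $G\in X_0$, $H\in X_1$ let $\mathbb P(G\xrightarrow{d^*}H)$ be the probability that the extension $0\to\mathbb Z_p\to E\to G\to 0$ corresponding to a uniformly random element of the finite group $\mathrm{Ext}^1_{\mathbb Z_p}(G,\mathbb Z_p)$ has $E\cong H$, and let $\mathbb P(H\xrightarrow{d}G)$ be the probability that $H/\mathbb Z_p h\cong G$, where $h\in H$ is chosen according to the Haar probability measure on $H$. Put $$(d^*\nu)(H)=\sum_{G\in X_0}\nu(G)\,\mathbb P(G\xrightarrow{d^*}H),\qquad (d\nu)(G)=\sum_{H\in X_1}\nu(H)\,\mathbb P(H\xrightarrow{d}G),\qquad \Delta_0=d\,d^* .$$ Let $c_0=\prod_{i\ge1}(1-p^{-i})$ and $\mu_0(G)=c_0/\#\mathrm{Aut}(G)$. Let $L^2(X_0,\mu_0)^*$ be the real Hilbert space of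 measures $\nu$ on $X_0$ with $\sum_G\nu(G)^2/\mu_0(G)<\infty$, with inner product $\langle\nu_1,\nu_2\rangle=\sum_G\nu_1(G)\nu_2(G)/\mu_0(G)$. For $G\in X_0$ let $1_G\in L^2(X_0,\mu_0)^*$ be the positive measure supported on $\{G\}$ of norm $1$, and for $f\in L^2(X_0,\mu_0)^*$ let $|\#G|^{-1}f$ be the measure $G\mapsto f(G)/\#G$. Let $\#\mathrm{Sur}(F,G)$ be the number of surjective homomorphisms $F\to G$. Then the following hold. 1. For every $\nu\in L^2(X_0,\mu_0)^*$ the series defining $d^*\nu$ and $d(d^*\nu)$ converge absolutely at each point, $\Delta_0\nu\in L^2(X_0,\mu_0)^*$, and $\Delta_0$ is a bounded linear operator on $L^2(X_0,\mu_0)^*$. 2. There is a unique continuous linear operator $\mathfrak F:L^2(X_0,\mu_0)^*\to L^2(X_0,\mu_0)^*$ such that for every $F\in X_0$ $$\mathfrak F\left(\frac{\#\mathrm{Sur}(F,\,\cdot\,)}{\#\mathrm{Aut}(\,\cdot\,)}\right)=\sqrt{c_0}\;\frac{\#\mathrm{Sur}(\,\cdot\,,F)}{\#\mathrm{Aut}(\,\cdot\,)},$$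 the measures on both sides lying in $L^2(X_0,\mu_0)^*$; and $\mathfrak F$ is norm-preserving (a linear isometry onto its image; surjectivity is not asserted). 3. For every $f\in L^2(X_0,\mu_0)^*$, $$\Delta_0\,\mathfrak F(f)=\mathfrak F\big(|\#G|^{-1}f\big).$$ 4. For every $G\in X_0$, $\mathfrak F(1_G)\ne0$ and $\Delta_0\,\mathfrak F(1_G)=\frac1{\#G}\,\mathfrak F(1_G)$; that is, $\mathfrak F(1_G)$ is an eigenfunction of $\Delta_0$ with eigenvalue $1/\#G$. -/

import Mathlib

open CategoryTheory MeasureTheory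

noncomputable section

/-! ### The state spaces `X₀` and `X₁` -/

/-- A finite `ℤ_p`-module, i.e. a finite abelian `p`-group. (A finite abelian `p`-group carries
exactly one `ℤ_p`-module structure, and homomorphisms of such groups are `ℤ_p`-linear.) -/
structure FinitePModule (p : ℕ) [Fact p.Prime] where
  carrier : Type
  [addCommGroup : AddCommGroup carrier]
  [module : Module ℤ_[p] carrier]
  [finite : Finite carrier]

attribute [instance] FinitePModule.addCommGroup FinitePModule.module FinitePModule.finite

/-- A finitely generated `ℤ_p`-module of `ℚ_p`-rank `1`. -/
structure RankOnePModule (p : ℕ) [Fact p.Prime] where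
  carrier : Type
  [addCommGroup : AddCommGroup carrier]
  [module : Module ℤ_[p] carrier]
  [finite : Module.Finite ℤ_[p] carrier]
  finrank_eq_one : Module.finrank ℤ_[p] carrier = 1

attribute [instance] RankOnePModule.addCommGroup RankOnePModule.module RankOnePModule.finite

instance FinitePModule.isoSetoid (p : ℕ) [Fact p.Prime] : Setoid (FinitePModule p) where
  r A B := Nonempty (A.carrier ≃ₗ[ℤ_[p]] B.carrier)
  iseqv := ⟨fun _ => ⟨LinearEquiv.refl _ _⟩, fun ⟨e⟩ => ⟨e.symm⟩, fun ⟨e⟩ ⟨f⟩ => ⟨e.trans f⟩⟩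

instance RankOnePModule.isoSetoid (p : ℕ) [Fact p.Prime] : Setoid (RankOnePModule p) where
  r A B := Nonempty (A.carrier ≃ₗ[ℤ_[p]] B.carrier)
  iseqv := ⟨fun _ => ⟨LinearEquiv.refl _ _⟩, fun ⟨e⟩ => ⟨e.symm⟩, fun ⟨e⟩ ⟨f⟩ => ⟨e.trans f⟩⟩

/-- `X₀`: isomorphism classes of finite abelian `p`-groups. -/
abbrev X₀ (p : ℕ) [Fact p.Prime] : Type 1 := Quotient (FinitePModule.isoSetoid p)

/-- `X₁`: isomorphism classes of finitely generated `ℤ_p`-modules of rank `1`. -/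
abbrev X₁ (p : ℕ) [Fact p.Prime] : Type 1 := Quotient (RankOnePModule.isoSetoid p)

/-- The underlying group of a chosen representative of the isomorphism class `G`. -/
abbrev X₀.grp {p : ℕ} [Fact p.Prime] (G : X₀ p) : Type := (Quotient.out G).carrier

/-- The underlying module of a chosen representative of the isomorphism class `H`. -/
abbrev X₁.mod {p : ℕ} [Fact p.Prime] (H : X₁ p) : Type := (Quotient.out H).carrier

/-- `#G`. -/
def cardGrp {p : ℕ} [Fact p.Prime] (G : X₀ p) : ℕ := Nat.card G.grp

/-- `#Aut(G)`. -/
def cardAut {p : ℕ} [Fact p.Prime] (G : X₀ p) : ℕ := Nat.card (G.grp ≃ₗ[ℤ_[p]] G.grp)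

/-- `#Sur(F, G)`, the number of surjective homomorphisms from `F` to `G`. -/
def cardSur {p : ℕ} [Fact p.Prime] (F G : X₀ p) : ℕ :=
  Nat.card {f : F.grp →ₗ[ℤ_[p]] G.grp // Function.Surjective f}

/-! ### The random operators `d*` and `d`, and the operator `Δ₀ = d d*` -/

/-- The class `e ∈ Ext¹(G, ℤ_p)` is represented by a short exact sequence
`0 → ℤ_p → H → G → 0` with middle term `H`. -/
def IsExtensionClassWithMiddle {p : ℕ} [Fact p.Prime] (G : X₀ p) (H : X₁ p)
    (e : Abelian.Ext (ModuleCat.of ℤ_[p] G.grp) (ModuleCat.of ℤ_[p] ℤ_[p]) 1) : Prop :=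
  ∃ (i : ModuleCat.of ℤ_[p] ℤ_[p] ⟶ ModuleCat.of ℤ_[p] H.mod)
    (q : ModuleCat.of ℤ_[p] H.mod ⟶ ModuleCat.of ℤ_[p] G.grp) (w : i ≫ q = 0)
    (h : (ShortComplex.mk i q w).ShortExact), h.extClass = e

/-- The transition probability `ℙ(G → H)` of `d*`: the probability that the extension of `G` by
`ℤ_p` given by a uniformly random element of the finite group `Ext¹(G, ℤ_p)` has middle term
isomorphic to `H`. -/
def probDStar {p : ℕ} [Fact p.Prime] (G : X₀ p) (H : X₁ p) : ℝ :=
  (Nat.card {e : Abelian.Ext (ModuleCat.of ℤ_[p] G.grp) (ModuleCat.of ℤ_[p] ℤ_[p]) 1 //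
      IsExtensionClassWithMiddle G H e} : ℝ) /
    (Nat.card (Abelian.Ext (ModuleCat.of ℤ_[p] G.grp) (ModuleCat.of ℤ_[p] ℤ_[p]) 1) : ℝ)

/-- A finitely generated `ℤ_p`-module carries its canonical (`p`-adic) topology. -/
instance X₁.topologicalSpace {p : ℕ} [Fact p.Prime] (H : X₁ p) : TopologicalSpace H.mod :=
  moduleTopology ℤ_[p] H.mod

instance X₁.isModuleTopology {p : ℕ} [Fact p.Prime] (H : X₁ p) :
    IsModuleTopology ℤ_[p] H.mod := ⟨rfl⟩

instance X₁.isTopologicalAddGroup {p : ℕ} [Fact p.Prime] (H : X₁ p) :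
    IsTopologicalAddGroup H.mod := IsModuleTopology.topologicalAddGroup ℤ_[p] H.mod

instance X₁.compactSpace {p : ℕ} [Fact p.Prime] (H : X₁ p) : CompactSpace H.mod := by
  obtain ⟨n, f, hf⟩ := Module.Finite.exists_fin' ℤ_[p] H.mod
  exact hf.compactSpace (IsModuleTopology.continuous_of_linearMap f)

instance X₁.measurableSpace {p : ℕ} [Fact p.Prime] (H : X₁ p) : MeasurableSpace H.mod :=
  borel H.mod

instance X₁.borelSpace {p : ℕ} [Fact p.Prime] (H : X₁ p) : BorelSpace H.mod := ⟨rfl⟩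

/-- The Haar probability measure on the compact group `H`. -/
def X₁.haar {p : ℕ} [Fact p.Prime] (H : X₁ p) : Measure H.mod := Measure.addHaarMeasure ⊤

/-- The transition probability `ℙ(H → G)` of `d`: the probability that the quotient of `H` by a
Haar-random element `h` of `H` (that is, `H / ℤ_p h`) is isomorphic to `G`. -/
def probD {p : ℕ} [Fact p.Prime] (H : X₁ p) (G : X₀ p) : ℝ :=
  H.haar.real {h | Nonempty ((H.mod ⧸ Submodule.span ℤ_[p] {h}) ≃ₗ[ℤ_[p]] G.grp)}

/-- The operator `d*`, from (signed) measures on `X₀` to measures on `X₁`. A measure on a discrete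
set is identified with the function giving the mass of each point. -/
def dStar {p : ℕ} [Fact p.Prime] (ν : X₀ p → ℝ) : X₁ p → ℝ :=
  fun H => ∑' G, ν G * probDStar G H

/-- The operator `d`, from (signed) measures on `X₁` to measures on `X₀`. -/
def dOp {p : ℕ} [Fact p.Prime] (ν : X₁ p → ℝ) : X₀ p → ℝ :=
  fun G => ∑' H, ν H * probD H G

/-! ### The Cohen–Lenstra measure and the Hilbert space `L²(X₀, μ₀)*` -/

/-- The normalization constant `c₀ = ∏_{i ≥ 1} (1 - p⁻ⁱ)`. -/
def cohenLenstraConst (p : ℕ) : ℝ := ∏' i : ℕ, (1 - ((p : ℝ)⁻¹) ^ (i + 1))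

/-- The Cohen–Lenstra measure `μ₀(G) = c₀ / #Aut(G)`. -/
def mu₀ {p : ℕ} [Fact p.Prime] (G : X₀ p) : ℝ := cohenLenstraConst p / cardAut G

theorem cohenLenstraConst_pos (p : ℕ) [hp : Fact p.Prime] : 0 < cohenLenstraConst p := by
  have h1 : (1 : ℝ) < p := by exact_mod_cast hp.out.one_lt
  have h0 : (0 : ℝ) < (p : ℝ)⁻¹ := by positivity
  have hlt : (p : ℝ)⁻¹ < 1 := inv_lt_one_of_one_lt₀ h1
  have hs : Summable fun i : ℕ => ((p : ℝ)⁻¹) ^ (i + 1) :=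
    (summable_nat_add_iff 1).2 (summable_geometric_of_lt_one h0.le hlt)
  have hpow : ∀ i : ℕ, ((p : ℝ)⁻¹) ^ (i + 1) < 1 := fun i =>
    pow_lt_one₀ h0.le hlt (Nat.succ_ne_zero i)
  have hs' : Summable fun i : ℕ => ‖-((p : ℝ)⁻¹) ^ (i + 1)‖ := by
    simpa using hs.norm
  have hne : cohenLenstraConst p ≠ 0 := by
    have := tprod_one_add_ne_zero_of_summable (f := fun i : ℕ => -((p : ℝ)⁻¹) ^ (i + 1))
      (fun i => by have := hpow i; linarith) hs'
    simpa [cohenLenstraConst, sub_eq_add_neg] using this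
  have hm : Multipliable fun i : ℕ => (1 - ((p : ℝ)⁻¹) ^ (i + 1)) := by
    have := multipliable_one_add_of_summable hs'
    simpa [sub_eq_add_neg] using this
  have hge : 0 ≤ cohenLenstraConst p :=
    ge_of_tendsto' hm.hasProd fun s => Finset.prod_nonneg fun i _ => by
      have := hpow i; linarith
  exact lt_of_le_of_ne hge hne.symm

theorem cardGrp_pos {p : ℕ} [Fact p.Prime] (G : X₀ p) : 0 < cardGrp G := Nat.card_pos

instance X₀.finite_linearMap {p : ℕ} [Fact p.Prime] (F G : X₀ p) :
    Finite (F.grp →ₗ[ℤ_[p]] G.grp) := DFunLike.finite _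

instance X₀.finite_linearEquiv {p : ℕ} [Fact p.Prime] (F G : X₀ p) :
    Finite (F.grp ≃ₗ[ℤ_[p]] G.grp) := DFunLike.finite _

theorem cardAut_pos {p : ℕ} [Fact p.Prime] (G : X₀ p) : 0 < cardAut G :=
  have : Nonempty (G.grp ≃ₗ[ℤ_[p]] G.grp) := ⟨LinearEquiv.refl _ _⟩
  Nat.card_pos

theorem mu₀_pos {p : ℕ} [Fact p.Prime] (G : X₀ p) : 0 < mu₀ G :=
  div_pos (cohenLenstraConst_pos p) (by exact_mod_cast cardAut_pos G)

/-- The linear space of (signed) measures `ν` on `X₀` with `∑_G ν(G)² / μ₀(G) < ∞`. -/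
def squareSummable (p : ℕ) [Fact p.Prime] : Submodule ℝ (X₀ p → ℝ) where
  carrier := {ν | Summable fun G => ν G ^ 2 / mu₀ G}
  zero_mem' := by
    change Summable fun G : X₀ p => (0 : ℝ) ^ 2 / mu₀ G
    simp
  add_mem' := by
    intro a b ha hb
    refine Summable.of_nonneg_of_le (fun G => div_nonneg (sq_nonneg _) (mu₀_pos G).le)
      (fun G => ?_) ((ha.mul_left 2).add (hb.mul_left 2))
    have := mu₀_pos G
    rw [← mul_div_assoc, ← mul_div_assoc, ← add_div]
    refine div_le_div_of_nonneg_right ?_ this.le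
    simp only [Pi.add_apply]
    nlinarith [sq_nonneg (a G - b G)]
  smul_mem' := by
    intro c a ha
    refine (ha.mul_left (c ^ 2)).congr fun G => ?_
    simp only [Pi.smul_apply, smul_eq_mul]
    ring

/-- The Hilbert space `L²(X₀, μ₀)*` of square-summable measures. It is a type of its own, so that it
carries the topology of its norm and not that of pointwise convergence. -/
def L2Star (p : ℕ) [Fact p.Prime] : Type 1 := squareSummable p

instance L2Star.addCommGroup (p : ℕ) [Fact p.Prime] : AddCommGroup (L2Star p) :=
  inferInstanceAs (AddCommGroup (squareSummable p))

instance L2Star.module (p : ℕ) [Fact p.Prime] : Module ℝ (L2Star p) :=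
  inferInstanceAs (Module ℝ (squareSummable p))

/-- An element of `L²(X₀, μ₀)*`, as the function `G ↦ ν(G)`. -/
instance L2Star.coeFun (p : ℕ) [Fact p.Prime] : CoeFun (L2Star p) fun _ => X₀ p → ℝ :=
  ⟨fun ν => ν.1⟩

theorem L2Star.summable_mul {p : ℕ} [Fact p.Prime] (a b : L2Star p) :
    Summable fun G => a.1 G * b.1 G / mu₀ G := by
  refine Summable.of_norm_bounded (a.2.add b.2) fun G => ?_
  have := mu₀_pos G
  rw [Real.norm_eq_abs, abs_div, abs_of_pos this, ← add_div]
  refine div_le_div_of_nonneg_right ?_ this.le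
  rw [abs_le]
  constructor <;> nlinarith [sq_nonneg (a.1 G - b.1 G), sq_nonneg (a.1 G + b.1 G),
    sq_nonneg (a.1 G), sq_nonneg (b.1 G)]

/-- The inner product `⟨ν₁, ν₂⟩ = ∑_G ν₁(G) ν₂(G) / μ₀(G)`. -/
abbrev L2Star.innerCore (p : ℕ) [Fact p.Prime] : InnerProductSpace.Core ℝ (L2Star p) where
  inner a b := ∑' G, a.1 G * b.1 G / mu₀ G
  conj_inner_symm a b := by
    simp only [conj_trivial]
    exact tsum_congr fun G => by ring
  re_inner_nonneg a := by
    simp only [RCLike.re_to_real]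
    exact tsum_nonneg fun G => div_nonneg (mul_self_nonneg _) (mu₀_pos G).le
  add_left a b c := by
    rw [← (L2Star.summable_mul a c).tsum_add (L2Star.summable_mul b c)]
    refine tsum_congr fun G => ?_
    change (a.1 G + b.1 G) * c.1 G / mu₀ G = _
    ring
  smul_left a b r := by
    simp only [conj_trivial]
    rw [← tsum_mul_left]
    refine tsum_congr fun G => ?_
    change r * a.1 G * b.1 G / mu₀ G = _
    ring
  definite a h := by
    have hn : ∀ G, 0 ≤ a.1 G * a.1 G / mu₀ G := fun G =>
      div_nonneg (mul_self_nonneg _) (mu₀_pos G).le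
    have hz := (L2Star.summable_mul a a).hasSum
    rw [show ∑' G, a.1 G * a.1 G / mu₀ G = 0 from h, hasSum_zero_iff_of_nonneg hn] at hz
    refine Subtype.ext (funext fun G => ?_)
    change a.1 G = 0
    have := congrFun hz G
    simpa [(mu₀_pos G).ne'] using this

instance L2Star.normedAddCommGroup (p : ℕ) [Fact p.Prime] : NormedAddCommGroup (L2Star p) :=
  (L2Star.innerCore p).toNormedAddCommGroup

instance L2Star.innerProductSpace (p : ℕ) [Fact p.Prime] : InnerProductSpace ℝ (L2Star p) :=
  InnerProductSpace.ofCore (L2Star.innerCore p).toCore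

theorem L2Star.mem_of_finite_support {p : ℕ} [Fact p.Prime] {ν : X₀ p → ℝ}
    (h : (Function.support ν).Finite) : ν ∈ squareSummable p := by
  refine summable_of_hasFiniteSupport (h.subset fun G hG => ?_)
  simp only [Function.mem_support] at hG ⊢
  intro h0
  simp [h0] at hG

/-! ### The measures that occur in the statement -/

/-- `#Sur(F, ·) / #Aut(·)`, as a measure on `X₀`. -/
def surFromFun {p : ℕ} [Fact p.Prime] (F : X₀ p) : X₀ p → ℝ :=
  fun G => (cardSur F G : ℝ) / cardAut G

/-- `#Sur(·, F) / #Aut(·)`, as a measure on `X₀`. -/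
def surToFun {p : ℕ} [Fact p.Prime] (F : X₀ p) : X₀ p → ℝ :=
  fun G => (cardSur G F : ℝ) / cardAut G

theorem surFromFun_finite_support {p : ℕ} [Fact p.Prime] (F : X₀ p) :
    (Function.support (surFromFun F)).Finite := by
  have : Finite (Submodule ℤ_[p] F.grp) := Finite.of_injective _ SetLike.coe_injective
  have hq : ∀ N : Submodule ℤ_[p] F.grp, Finite (F.grp ⧸ N) := fun N =>
    Finite.of_surjective _ N.mkQ_surjective
  refine (Set.finite_range fun N : Submodule ℤ_[p] F.grp =>
    (Quotient.mk (FinitePModule.isoSetoid p) ⟨F.grp ⧸ N⟩ : X₀ p)).subset fun G hG => ?_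
  have hne : cardSur F G ≠ 0 := by
    intro h0
    exact hG (by simp [surFromFun, h0])
  obtain ⟨f, hf⟩ := (Nat.card_ne_zero.1 hne).1
  refine ⟨LinearMap.ker f, ?_⟩
  have he : Nonempty ((F.grp ⧸ LinearMap.ker f) ≃ₗ[ℤ_[p]] X₀.grp G) :=
    ⟨f.quotKerEquivOfSurjective hf⟩
  exact Quotient.mk_eq_iff_out.2 he

/-- The finitely supported measure `#Sur(F, ·) / #Aut(·)`, as an element of `L²(X₀, μ₀)*`. -/
def surFrom {p : ℕ} [Fact p.Prime] (F : X₀ p) : L2Star p :=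
  ⟨surFromFun F, L2Star.mem_of_finite_support (surFromFun_finite_support F)⟩

open Classical in
/-- `1_G`: the positive measure supported on `G` of norm `1` in `L²(X₀, μ₀)*`. -/
def unitAt {p : ℕ} [Fact p.Prime] (G : X₀ p) : L2Star p :=
  ⟨Pi.single G (Real.sqrt (mu₀ G)), L2Star.mem_of_finite_support
    ((Set.finite_singleton G).subset Pi.support_single_subset)⟩

/-- The diagonal operator `f ↦ |G|⁻¹ f`, whose value at `G` is `|G|⁻¹ f(G)`. -/
def mulInvCard {p : ℕ} [Fact p.Prime] (f : L2Star p) : L2Star p :=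
  ⟨fun G => (cardGrp G : ℝ)⁻¹ * f.1 G, by
    refine Summable.of_nonneg_of_le (fun G => div_nonneg (sq_nonneg _) (mu₀_pos G).le)
      (fun G => ?_) f.2
    have h1 : (1 : ℝ) ≤ cardGrp G := by exact_mod_cast cardGrp_pos G
    have h2 : (cardGrp G : ℝ)⁻¹ ≤ 1 := inv_le_one_of_one_le₀ h1
    have h3 : (0 : ℝ) ≤ (cardGrp G : ℝ)⁻¹ := by positivity
    refine div_le_div_of_nonneg_right ?_ (mu₀_pos G).le
    rw [mul_pow]
    exact mul_le_of_le_one_left (sq_nonneg _) (pow_le_one₀ h3 h2)⟩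

end

/-!
The operator `𝔉` exists and is isometric because the measures `A_F = #Sur(F, ·) / #Aut(·)` and
`B_F = √c₀ #Sur(·, F) / #Aut(·)` have the same Gram matrix, and it intertwines `|G|⁻¹` with `Δ₀`
because both operators act by the same formula on the two families: `|G|⁻¹ A_F` is the average of
`A_{F/x}` over `x ∈ F` (`mulInvCard_surFrom`) and `Δ₀ B_F` is the average of `B_{F/x}` over `x ∈ F`
(`laplacian_surTo`). The `A_F` are unitriangular with respect to the point masses, so they span a
dense subspace (`dense_span_surFrom`); this gives uniqueness and reduces all identities to the `A_F`.

*Gram matrices.* Both inner products are `c₀⁻¹` times the number of subdirect products of `F` and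
`F'`. For the `A_F` this is Goursat's lemma: a pair of surjections from `F` and `F'` onto `G` is a
subdirect product written as a fibre product over `G` (`tsum_autWeight_mul_cardSur_from`). For the
`B_F`, a pair of surjections from `G` onto `F` and `F'` is a surjection from `G` onto a subdirect
product, and every surjection moment `∑_G #Sur(G, R) / #Aut(G)` equals `c₀⁻¹`
(`tsum_autWeight_mul_cardSur`).

*The two kernels.* The sequence `0 → ℤ_p → ℚ_p → ℚ_p / ℤ_p → 0` identifies `Ext¹(G, ℤ_p)` with the
characters `χ : G → ℚ_p / ℤ_p`, and the extension given by `χ` has middle term `ℤ_p × ker χ`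
(`probDStar_eq`). On the other side, up to a unit a Haar-random element of `ℤ_p × T` is `(p^k, t)`
with `t ∈ T` uniform (`cardGrp_mul_haar_quotientEvent`). Counting in two ways the characters `χ` of
`G` together with a compatible surjection `ℤ_p × T → G` shows that the kernels of `d*` and `d` are
reverse to each other for the weights `1 / #Aut(G)` on `X₀` and an explicit weight on `X₁`
(`detailed_balance`). Consequently `1 / #Aut` is stationary for `Δ₀`, and Jensen's inequality makes
`d*` and `d` contractions (`summable_and_tsum_sq_div_le`).

*Mass and moments.* Detailed balance, summed against powers of `#G`, gives a functional equation for
`∑_G #G⁻ˢ / #Aut(G)` whose iteration yields the total mass `c₀⁻¹` (`tsum_autWeight`). Counting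
surjections from a random extension (`sum_numSur_prod_ker`) and from a random quotient
(`tsum_haar_mul_cardSur`) shows that `Δ₀` sends `#Sur(·, F)` to the average of `#Sur(·, F/x)`;
integrating this against the stationary weights determines all moments by induction on `#F`.
-/

noncomputable section

variable {p : ℕ} [Fact p.Prime]

/-! ### Finite `ℤ_p`-modules -/

instance Submodule.finite_quotient {R M : Type*} [Ring R] [AddCommGroup M] [Module R M] [Finite M]
    (N : Submodule R M) : Finite (M ⧸ N) :=
  Finite.of_surjective _ N.mkQ_surjective

/-- A nonzero natural number is a unit times a power of `p` in `ℤ_p`, so the order of a finite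
module can be replaced by a power of `p` as an annihilator. -/
theorem exists_pow_smul_eq_zero (M : Type*) [AddCommGroup M] [Module ℤ_[p] M] [Finite M] :
    ∃ n : ℕ, ∀ x : M, (p : ℤ_[p]) ^ n • x = 0 := by
  have hn : (Nat.card M : ℤ_[p]) ≠ 0 := by exact_mod_cast Nat.card_pos.ne'
  refine ⟨(Nat.card M : ℤ_[p]).valuation, fun x => ?_⟩
  have h1 : (Nat.card M : ℤ_[p]) • x = 0 := by
    rw [Nat.cast_smul_eq_nsmul, card_nsmul_eq_zero']
  rw [PadicInt.unitCoeff_spec hn, mul_smul] at h1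
  exact (PadicInt.unitCoeff hn).isUnit.smul_eq_zero.1 h1

theorem exists_card_eq_pow (M : Type*) [AddCommGroup M] [Module ℤ_[p] M] [Finite M] :
    ∃ n : ℕ, Nat.card M = p ^ n := by
  have h : IsPGroup p (Multiplicative M) := fun g => by
    obtain ⟨n, hn⟩ := exists_pow_smul_eq_zero (p := p) M
    refine ⟨n, ?_⟩
    have := hn g.toAdd
    rw [← Nat.cast_pow, Nat.cast_smul_eq_nsmul] at this
    exact this
  exact (IsPGroup.iff_card (G := Multiplicative M)).1 h

theorem pow_smul_eq_zero_of_card {M : Type*} [AddCommGroup M] [Module ℤ_[p] M] {k : ℕ}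
    (h : Nat.card M = p ^ k) (x : M) : (p : ℤ_[p]) ^ k • x = 0 := by
  rw [← Nat.cast_pow, Nat.cast_smul_eq_nsmul, ← h]
  exact card_nsmul_eq_zero'

theorem Submodule.card_eq_card_quotient_mul_card' {R M : Type*} [Ring R] [AddCommGroup M]
    [Module R M] (N : Submodule R M) : Nat.card M = Nat.card (M ⧸ N) * Nat.card N :=
  AddSubgroup.card_eq_card_quotient_mul_card_addSubgroup N.toAddSubgroup

theorem LinearMap.card_eq_card_range_mul_card_ker {R M N : Type*} [Ring R] [AddCommGroup M]
    [Module R M] [AddCommGroup N] [Module R N] (f : M →ₗ[R] N) :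
    Nat.card M = Nat.card (LinearMap.range f) * Nat.card (LinearMap.ker f) := by
  rw [Submodule.card_eq_card_quotient_mul_card' (LinearMap.ker f),
    Nat.card_congr f.quotKerEquivRange.toEquiv]

theorem LinearMap.exists_comp_eq_of_ker_le {R M N P : Type*} [Ring R] [AddCommGroup M]
    [Module R M] [AddCommGroup N] [Module R N] [AddCommGroup P] [Module R P] {q : M →ₗ[R] N}
    (hq : Function.Surjective q) {f : M →ₗ[R] P} (h : LinearMap.ker q ≤ LinearMap.ker f) :
    ∃ g : N →ₗ[R] P, ∀ x, g (q x) = f x := by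
  refine ⟨(LinearMap.ker q).liftQ f h ∘ₗ (q.quotKerEquivOfSurjective hq).symm.toLinearMap,
    fun x => ?_⟩
  have : (q.quotKerEquivOfSurjective hq).symm (q x) = Submodule.Quotient.mk x := by
    rw [LinearEquiv.symm_apply_eq]
    rfl
  change (LinearMap.ker q).liftQ f h ((q.quotKerEquivOfSurjective hq).symm (q x)) = _
  rw [this, Submodule.liftQ_apply]

theorem card_padicInt_quotient_pow (k : ℕ) :
    Nat.card (ℤ_[p] ⧸ Ideal.span {(p : ℤ_[p]) ^ k}) = p ^ k := by
  have hs : Function.Surjective (PadicInt.toZModPow k : ℤ_[p] →+* ZMod (p ^ k)) :=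
    ZMod.ringHom_surjective _
  rw [← PadicInt.ker_toZModPow,
    Nat.card_congr (RingHom.quotientKerEquivOfSurjective hs).toEquiv, Nat.card_zmod]

theorem finite_padicInt_quotient {a : ℤ_[p]} (ha : a ≠ 0) : Finite (ℤ_[p] ⧸ Ideal.span {a}) := by
  obtain ⟨n, hn⟩ := PadicInt.ideal_eq_span_pow_p (s := Ideal.span {a}) (by simpa using ha)
  rw [hn]
  refine (Nat.card_pos_iff.1 ?_).2
  rw [card_padicInt_quotient_pow]
  exact pow_pos (Fact.out : p.Prime).pos _

/-- Over a principal ideal domain, divisible modules satisfy Baer's criterion. -/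
theorem Module.Baer.of_smul_surjective {R Q : Type*} [CommRing R] [IsDomain R]
    [IsPrincipalIdealRing R] [AddCommGroup Q] [Module R Q]
    (h : ∀ a : R, a ≠ 0 → Function.Surjective fun y : Q => a • y) : Module.Baer R Q := by
  intro I g
  obtain ⟨a, rfl⟩ := IsPrincipalIdealRing.principal I
  by_cases ha : a = 0
  · subst ha
    refine ⟨0, fun x hx => ?_⟩
    have : (⟨x, hx⟩ : Submodule.span R {(0 : R)}) = 0 := Subtype.ext (by simpa using hx)
    rw [this, map_zero, LinearMap.zero_apply]
  · obtain ⟨y, hy⟩ := h a ha (g ⟨a, Submodule.mem_span_singleton_self a⟩)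
    refine ⟨LinearMap.toSpanSingleton R Q y, fun x hx => ?_⟩
    obtain ⟨r, rfl⟩ := Submodule.mem_span_singleton.1 hx
    have : (⟨r • a, hx⟩ : Submodule.span R {a})
        = r • ⟨a, Submodule.mem_span_singleton_self a⟩ := rfl
    rw [this, map_smul g, ← hy, LinearMap.toSpanSingleton_apply, smul_eq_mul, mul_smul]

/-! ### The Prüfer module `ℚ_p / ℤ_p` and duality -/

/-- The copy of `ℤ_p` inside `ℚ_p`. -/
abbrev padicLattice (p : ℕ) [Fact p.Prime] : Submodule ℤ_[p] ℚ_[p] :=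
  LinearMap.range (Algebra.linearMap ℤ_[p] ℚ_[p])

/-- The Prüfer module `ℚ_p / ℤ_p`, the dualizing module for finite `ℤ_p`-modules. -/
abbrev Prufer (p : ℕ) [Fact p.Prime] : Type := ℚ_[p] ⧸ padicLattice p

theorem smul_padic_surjective (a : ℤ_[p]) (ha : a ≠ 0) :
    Function.Surjective fun y : ℚ_[p] => a • y := fun y => by
  have ha' : (algebraMap ℤ_[p] ℚ_[p] a) ≠ 0 := by simpa using ha
  exact ⟨(algebraMap ℤ_[p] ℚ_[p] a)⁻¹ * y, by
    change a • ((algebraMap ℤ_[p] ℚ_[p] a)⁻¹ * y) = y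
    rw [Algebra.smul_def, mul_inv_cancel_left₀ ha']⟩

theorem baer_padic : Module.Baer ℤ_[p] ℚ_[p] :=
  Module.Baer.of_smul_surjective smul_padic_surjective

theorem baer_prufer : Module.Baer ℤ_[p] (Prufer p) :=
  Module.Baer.of_smul_surjective fun a ha y => by
    obtain ⟨y, rfl⟩ := (padicLattice p).mkQ_surjective y
    obtain ⟨x, rfl⟩ := smul_padic_surjective a ha y
    exact ⟨(padicLattice p).mkQ x, (map_smul _ _ _).symm⟩

theorem mkQ_prufer_eq_zero {y : ℚ_[p]} :
    (padicLattice p).mkQ y = 0 ↔ ∃ z : ℤ_[p], (z : ℚ_[p]) = y := by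
  rw [Submodule.mkQ_apply, Submodule.Quotient.mk_eq_zero]
  rfl

/-- The element `p⁻ᵏ` of `ℚ_p / ℤ_p`. -/
def pruferGen (p : ℕ) [Fact p.Prime] (k : ℕ) : Prufer p :=
  (padicLattice p).mkQ (((p : ℚ_[p]) ^ k)⁻¹)

theorem smul_pruferGen_eq_zero {k : ℕ} {z : ℤ_[p]} :
    z • pruferGen p k = 0 ↔ (p : ℤ_[p]) ^ k ∣ z := by
  have hp : ((p : ℚ_[p]) ^ k) ≠ 0 := pow_ne_zero _ (by exact_mod_cast (Fact.out : p.Prime).ne_zero)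
  rw [pruferGen, ← map_smul, mkQ_prufer_eq_zero]
  constructor
  · rintro ⟨c, hc⟩
    refine ⟨c, ?_⟩
    have : (z : ℚ_[p]) = p ^ k * c := by
      rw [hc, Algebra.smul_def, PadicInt.algebraMap_apply]
      field_simp
    exact Subtype.ext (by push_cast; exact this)
  · rintro ⟨c, rfl⟩
    refine ⟨c, ?_⟩
    rw [Algebra.smul_def, PadicInt.algebraMap_apply]
    push_cast
    field_simp

/-- The `p^k`-torsion of `ℚ_p / ℤ_p` is generated by `p⁻ᵏ`. -/
theorem exists_smul_pruferGen {k : ℕ} {w : Prufer p} (h : (p : ℤ_[p]) ^ k • w = 0) :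
    ∃ z : ℤ_[p], z • pruferGen p k = w := by
  have hp : ((p : ℚ_[p]) ^ k) ≠ 0 := pow_ne_zero _ (by exact_mod_cast (Fact.out : p.Prime).ne_zero)
  obtain ⟨y, rfl⟩ := (padicLattice p).mkQ_surjective w
  rw [← map_smul, mkQ_prufer_eq_zero] at h
  obtain ⟨z, hz⟩ := h
  refine ⟨z, ?_⟩
  rw [pruferGen, ← map_smul]
  congr 1
  rw [Algebra.smul_def, PadicInt.algebraMap_apply, hz, Algebra.smul_def,
    PadicInt.algebraMap_apply]
  push_cast
  field_simp

theorem card_span_pruferGen (k : ℕ) :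
    Nat.card (Submodule.span ℤ_[p] {pruferGen p k}) = p ^ k := by
  have hk : LinearMap.ker (LinearMap.toSpanSingleton ℤ_[p] _ (pruferGen p k))
      = Ideal.span {(p : ℤ_[p]) ^ k} := by
    ext z
    rw [LinearMap.mem_ker, LinearMap.toSpanSingleton_apply, smul_pruferGen_eq_zero,
      Ideal.mem_span_singleton]
  rw [LinearMap.span_singleton_eq_range,
    ← Nat.card_congr (LinearMap.quotKerEquivRange _).toEquiv, hk, card_padicInt_quotient_pow]

instance LinearMap.finite_of_fg {R M N : Type*} [Ring R] [AddCommGroup M] [Module R M]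
    [Module.Finite R M] [AddCommGroup N] [Module R N] [Finite N] : Finite (M →ₗ[R] N) := by
  obtain ⟨n, f, hf⟩ := Module.Finite.exists_fin' R M
  refine Finite.of_injective
    (fun (φ : M →ₗ[R] N) (i : Fin n) => φ (f (Pi.single i 1))) fun φ ψ h => ?_
  have h2 : φ ∘ₗ f = ψ ∘ₗ f := by
    ext i
    exact congrFun h i
  exact (LinearMap.cancel_right hf).1 h2

/-- Homomorphisms into the injective module `ℚ_p / ℤ_p` extend, so `#Hom(·, ℚ_p / ℤ_p)` is
multiplicative along a submodule. -/
theorem card_hom_prufer_mul {M : Type*} [AddCommGroup M] [Module ℤ_[p] M] (N : Submodule ℤ_[p] M) :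
    Nat.card (M →ₗ[ℤ_[p]] Prufer p) =
      Nat.card (N →ₗ[ℤ_[p]] Prufer p) * Nat.card ((M ⧸ N) →ₗ[ℤ_[p]] Prufer p) := by
  let r : (M →ₗ[ℤ_[p]] Prufer p) →ₗ[ℤ_[p]] (N →ₗ[ℤ_[p]] Prufer p) :=
    LinearMap.lcomp ℤ_[p] (Prufer p) N.subtype
  have hr : LinearMap.range r = ⊤ := LinearMap.range_eq_top.2 fun g => by
    obtain ⟨h, hh⟩ := baer_prufer.extension_property N.subtype N.injective_subtype g
    exact ⟨h, hh⟩
  rw [LinearMap.card_eq_card_range_mul_card_ker r, hr,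
    Nat.card_congr (Submodule.topEquiv (R := ℤ_[p])).toEquiv]
  congr 1
  refine (Nat.card_congr (Equiv.ofBijective
    (fun φ : (M ⧸ N) →ₗ[ℤ_[p]] Prufer p => (⟨φ ∘ₗ N.mkQ, ?_⟩ : LinearMap.ker r)) ⟨?_, ?_⟩)).symm
  · rw [LinearMap.mem_ker]
    ext x
    change φ (N.mkQ x) = 0
    rw [(Submodule.Quotient.mk_eq_zero N).2 x.2 |> fun h => (h : N.mkQ x = 0), map_zero]
  · intro φ ψ h
    exact (LinearMap.cancel_right N.mkQ_surjective).1 (congrArg Subtype.val h)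
  · rintro ⟨ψ, hψ⟩
    refine ⟨N.liftQ ψ fun x hx => ?_, Subtype.ext (N.liftQ_mkQ ψ _)⟩
    exact LinearMap.congr_fun (LinearMap.mem_ker.1 hψ) ⟨x, hx⟩

theorem card_hom_prufer_cyclic {M : Type*} [AddCommGroup M] [Module ℤ_[p] M] [Finite M] (g : M) :
    Nat.card (Submodule.span ℤ_[p] {g} →ₗ[ℤ_[p]] Prufer p) =
      Nat.card (Submodule.span ℤ_[p] {g}) := by
  obtain ⟨k, hk⟩ := exists_card_eq_pow (p := p) (Submodule.span ℤ_[p] {g})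
  let f : ℤ_[p] →ₗ[ℤ_[p]] M := LinearMap.toSpanSingleton ℤ_[p] M g
  have hker : LinearMap.ker f = Ideal.span {(p : ℤ_[p]) ^ k} := by
    have hne : LinearMap.ker f ≠ ⊥ := by
      obtain ⟨n, hn⟩ := exists_pow_smul_eq_zero (p := p) M
      intro hb
      have : (p : ℤ_[p]) ^ n ∈ LinearMap.ker f := hn g
      rw [hb, Submodule.mem_bot] at this
      exact pow_ne_zero _ PadicInt.prime_p.ne_zero this
    obtain ⟨n, hn⟩ := PadicInt.ideal_eq_span_pow_p hne
    have hc : Nat.card (ℤ_[p] ⧸ LinearMap.ker f) = p ^ k := by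
      rw [Nat.card_congr f.quotKerEquivRange.toEquiv, ← hk, LinearMap.span_singleton_eq_range]
    rw [hn, card_padicInt_quotient_pow] at hc
    rw [hn, Nat.pow_right_injective (Fact.out : p.Prime).two_le hc]
  rw [hk, ← card_span_pruferGen]
  have hmem : ∀ φ : Submodule.span ℤ_[p] {g} →ₗ[ℤ_[p]] Prufer p,
      φ ⟨g, Submodule.mem_span_singleton_self g⟩ ∈ Submodule.span ℤ_[p] {pruferGen p k} :=
    fun φ => by
      obtain ⟨z, hz⟩ := exists_smul_pruferGen (k := k)
        (w := φ ⟨g, Submodule.mem_span_singleton_self g⟩) (by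
          rw [← map_smul, pow_smul_eq_zero_of_card hk, map_zero])
      rw [← hz]
      exact Submodule.smul_mem _ _ (Submodule.mem_span_singleton_self _)
  refine Nat.card_congr (Equiv.ofBijective (fun φ => ⟨_, hmem φ⟩) ⟨?_, ?_⟩)
  · intro φ ψ h
    have h' : φ ⟨g, Submodule.mem_span_singleton_self g⟩
        = ψ ⟨g, Submodule.mem_span_singleton_self g⟩ := congrArg Subtype.val h
    refine LinearMap.ext fun x => ?_
    obtain ⟨x, hx⟩ := x
    obtain ⟨z, rfl⟩ := Submodule.mem_span_singleton.1 hx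
    have : (⟨z • g, hx⟩ : Submodule.span ℤ_[p] {g})
        = z • ⟨g, Submodule.mem_span_singleton_self g⟩ := rfl
    rw [this, map_smul, map_smul, h']
  · rintro ⟨w, hw⟩
    obtain ⟨z, rfl⟩ := Submodule.mem_span_singleton.1 hw
    let h0 : ℤ_[p] →ₗ[ℤ_[p]] Prufer p := LinearMap.toSpanSingleton ℤ_[p] _ (z • pruferGen p k)
    have hle : LinearMap.ker f ≤ LinearMap.ker h0 := by
      rw [hker, Ideal.span, Submodule.span_le, Set.singleton_subset_iff, SetLike.mem_coe,
        LinearMap.mem_ker, LinearMap.toSpanSingleton_apply, smul_comm,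
        smul_pruferGen_eq_zero.2 dvd_rfl, smul_zero]
    let e : Submodule.span ℤ_[p] {g} ≃ₗ[ℤ_[p]] LinearMap.range f :=
      LinearEquiv.ofEq _ _ (LinearMap.span_singleton_eq_range ..)
    refine ⟨(LinearMap.ker f).liftQ h0 hle ∘ₗ f.quotKerEquivRange.symm.toLinearMap ∘ₗ
      e.toLinearMap, Subtype.ext ?_⟩
    have h1 : e ⟨g, Submodule.mem_span_singleton_self g⟩
        = f.quotKerEquivRange (Submodule.Quotient.mk 1) := Subtype.ext (by
      rw [LinearMap.quotKerEquivRange_apply_mk]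
      simp [e, f])
    change (LinearMap.ker f).liftQ h0 hle (f.quotKerEquivRange.symm
      (e ⟨g, Submodule.mem_span_singleton_self g⟩)) = _
    rw [h1, LinearEquiv.symm_apply_apply, Submodule.liftQ_apply]
    simp [h0]

/-- A finite `ℤ_p`-module has as many characters as elements. -/
theorem card_hom_prufer (M : Type*) [AddCommGroup M] [Module ℤ_[p] M] [Finite M] :
    Nat.card (M →ₗ[ℤ_[p]] Prufer p) = Nat.card M := by
  induction hn : Nat.card M using Nat.strong_induction_on generalizing M with
  | _ n ih =>
    subst hn
    rcases subsingleton_or_nontrivial M with hM | hM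
    · rw [Nat.card_unique, Nat.card_unique]
    · obtain ⟨g, hg⟩ := exists_ne (0 : M)
      have : Finite (M ⧸ Submodule.span ℤ_[p] {g}) :=
        Finite.of_surjective _ (Submodule.mkQ_surjective _)
      have hmul := Submodule.card_eq_card_quotient_mul_card' (Submodule.span ℤ_[p] {g})
      have h1 : 1 < Nat.card (Submodule.span ℤ_[p] {g}) := by
        rw [Finite.one_lt_card_iff_nontrivial]
        refine ⟨⟨⟨g, Submodule.mem_span_singleton_self g⟩, 0, fun h => hg ?_⟩⟩
        exact congrArg Subtype.val h
      have h2 : 0 < Nat.card (M ⧸ Submodule.span ℤ_[p] {g}) := Nat.card_pos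
      rw [card_hom_prufer_mul (Submodule.span ℤ_[p] {g}), card_hom_prufer_cyclic,
        ih _ (by rw [hmul]; nlinarith) _ rfl, hmul, mul_comm]

instance finite_hom_prufer (M : Type*) [AddCommGroup M] [Module ℤ_[p] M] [Finite M] :
    Finite (M →ₗ[ℤ_[p]] Prufer p) := by
  refine (Nat.card_pos_iff.1 ?_).2
  rw [card_hom_prufer]
  exact Nat.card_pos

/-! ### Isomorphism classes -/

/-- The isomorphism class of a finite `ℤ_p`-module. -/
def toX₀ (p : ℕ) [Fact p.Prime] (M : Type) [AddCommGroup M] [Module ℤ_[p] M] [Finite M] : X₀ p :=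
  Quotient.mk (FinitePModule.isoSetoid p) ⟨M⟩

section
variable {M N T G F : Type} [AddCommGroup M] [Module ℤ_[p] M] [AddCommGroup N] [Module ℤ_[p] N]
  [AddCommGroup T] [Module ℤ_[p] T] [AddCommGroup G] [Module ℤ_[p] G]
  [AddCommGroup F] [Module ℤ_[p] F]

theorem toX₀_eq_iff [Finite M] {G : X₀ p} : toX₀ p M = G ↔ Nonempty (M ≃ₗ[ℤ_[p]] G.grp) :=
  Quotient.mk_eq_iff_out

theorem toX₀_grp (G : X₀ p) : toX₀ p G.grp = G := Quotient.out_eq G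

/-- The chosen representative of the class of `M` is isomorphic to `M`. -/
def toX₀Equiv (p : ℕ) [Fact p.Prime] (M : Type) [AddCommGroup M] [Module ℤ_[p] M] [Finite M] :
    M ≃ₗ[ℤ_[p]] (toX₀ p M).grp :=
  (toX₀_eq_iff.1 rfl).some

/-- The number of surjective homomorphisms between two modules. -/
def numSur (p : ℕ) [Fact p.Prime] (M N : Type) [AddCommGroup M] [Module ℤ_[p] M]
    [AddCommGroup N] [Module ℤ_[p] N] : ℕ :=
  Nat.card {f : M →ₗ[ℤ_[p]] N // Function.Surjective f}

theorem numSur_congr {M' N' : Type} [AddCommGroup M'] [Module ℤ_[p] M'] [AddCommGroup N']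
    [Module ℤ_[p] N'] (e : M ≃ₗ[ℤ_[p]] M') (e' : N ≃ₗ[ℤ_[p]] N') :
    numSur p M N = numSur p M' N' := by
  refine Nat.card_congr ((e.arrowCongr e').toEquiv.subtypeEquiv fun f => ?_)
  change _ ↔ Function.Surjective (e' ∘ f ∘ e.symm)
  rw [Function.Surjective.of_comp_iff' e'.bijective,
    Function.Surjective.of_comp_iff _ e.symm.surjective]

theorem cardSur_toX₀_left [Finite M] (F : X₀ p) : cardSur (toX₀ p M) F = numSur p M F.grp :=
  (numSur_congr (toX₀Equiv p M) (LinearEquiv.refl _ _)).symm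

theorem cardSur_toX₀_right [Finite M] (F : X₀ p) : cardSur F (toX₀ p M) = numSur p F.grp M :=
  (numSur_congr (LinearEquiv.refl _ _) (toX₀Equiv p M)).symm

theorem cardGrp_toX₀ [Finite M] : cardGrp (toX₀ p M) = Nat.card M :=
  (Nat.card_congr (toX₀Equiv p M).toEquiv).symm

open Classical in
/-- Isomorphisms onto `G`, if there are any, form a torsor under `Aut G`. -/
theorem card_linearEquiv [Finite M] (G : X₀ p) :
    Nat.card (M ≃ₗ[ℤ_[p]] G.grp) = if toX₀ p M = G then cardAut G else 0 := by
  split_ifs with h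
  · obtain ⟨e⟩ := toX₀_eq_iff.1 h
    refine Nat.card_congr ⟨fun f => e.symm.trans f, fun f => e.trans f, fun f => ?_, fun f => ?_⟩
      <;> ext x <;> simp
  · have : IsEmpty (M ≃ₗ[ℤ_[p]] G.grp) := ⟨fun e => h (toX₀_eq_iff.2 ⟨e⟩)⟩
    exact Nat.card_of_isEmpty

/-- A module of order `n` is a quotient of `(ℤ_p / n)ⁿ`. -/
theorem finite_setOf_cardGrp_eq (n : ℕ) : {G : X₀ p | cardGrp G = n}.Finite := by
  rcases Nat.eq_zero_or_pos n with rfl | hn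
  · convert! Set.finite_empty
    ext G
    simpa using (cardGrp_pos G).ne'
  have hn' : (n : ℤ_[p]) ≠ 0 := by exact_mod_cast hn.ne'
  have := finite_padicInt_quotient hn'
  let V := Fin n → ℤ_[p] ⧸ Ideal.span {(n : ℤ_[p])}
  have : Finite (Submodule ℤ_[p] V) := Finite.of_injective _ SetLike.coe_injective
  have hV : ∀ N : Submodule ℤ_[p] V, Finite (V ⧸ N) := fun N =>
    Finite.of_surjective _ N.mkQ_surjective
  refine (Set.finite_range fun N : Submodule ℤ_[p] V => toX₀ p (V ⧸ N)).subset fun G hG => ?_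
  let e : G.grp ≃ Fin n := Finite.equivFinOfCardEq hG
  have hk : ∀ x : G.grp, Ideal.span {(n : ℤ_[p])} ≤
      LinearMap.ker (LinearMap.toSpanSingleton ℤ_[p] G.grp x) := fun x => by
    rw [Ideal.span, Submodule.span_le, Set.singleton_subset_iff, SetLike.mem_coe,
      LinearMap.mem_ker, LinearMap.toSpanSingleton_apply, Nat.cast_smul_eq_nsmul]
    have : n = Nat.card G.grp := hG.symm
    rw [this]
    exact card_nsmul_eq_zero'
  let f : V →ₗ[ℤ_[p]] G.grp := LinearMap.lsum ℤ_[p] _ ℤ_[p] fun i =>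
    (Ideal.span {(n : ℤ_[p])}).liftQ _ (hk (e.symm i))
  have hf : Function.Surjective f := fun x => by
    refine ⟨Pi.single (e x) (Submodule.Quotient.mk 1), ?_⟩
    refine (LinearMap.lsum_piSingle _ _ _ _ _ _).trans ?_
    rw [Submodule.liftQ_apply, LinearMap.toSpanSingleton_apply, one_smul, e.symm_apply_apply]
  exact ⟨LinearMap.ker f, toX₀_eq_iff.2 ⟨f.quotKerEquivOfSurjective hf⟩⟩

theorem finite_setOf_cardGrp_le (n : ℕ) : {G : X₀ p | cardGrp G ≤ n}.Finite := by
  have : {G : X₀ p | cardGrp G ≤ n} = ⋃ k ∈ Set.Iic n, {G : X₀ p | cardGrp G = k} := by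
    ext G
    simp
  rw [this]
  exact (Set.finite_Iic n).biUnion fun k _ => finite_setOf_cardGrp_eq k

instance X₀.countable : Countable (X₀ p) := by
  rw [← Set.countable_univ_iff]
  have : (Set.univ : Set (X₀ p)) = ⋃ k : ℕ, {G : X₀ p | cardGrp G = k} := by
    ext G
    simp
  rw [this]
  exact Set.countable_iUnion fun k => (finite_setOf_cardGrp_eq k).countable

/-! ### The modules `ℤ_p × T` -/

theorem finrank_prod_finite {A B : Type} [AddCommGroup A] [Module ℤ_[p] A] [AddCommGroup B]
    [Module ℤ_[p] B] [Finite B] :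
    Module.finrank ℤ_[p] (A × B) = Module.finrank ℤ_[p] A := by
  rw [← (LinearMap.quotKerEquivOfSurjective (LinearMap.fst ℤ_[p] A B)
    LinearMap.fst_surjective).finrank_eq]
  refine (finrank_quotient_eq_of_le_torsion ?_).symm
  rintro ⟨a, b⟩ h
  obtain rfl : a = 0 := h
  obtain ⟨n, hn⟩ := exists_pow_smul_eq_zero (p := p) B
  exact ⟨⟨(p : ℤ_[p]) ^ n, mem_nonZeroDivisors_of_ne_zero (pow_ne_zero _ PadicInt.prime_p.ne_zero)⟩,
    Prod.ext (smul_zero _) (hn b)⟩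

/-- The structure theorem over the principal ideal domain `ℤ_p`, in rank one. -/
theorem exists_equiv_padicInt_prod (M : RankOnePModule p) :
    ∃ T : FinitePModule p, Nonempty (M.carrier ≃ₗ[ℤ_[p]] ℤ_[p] × T.carrier) := by
  obtain ⟨n, ι, _, q, hq, e, ⟨f⟩⟩ := Module.equiv_free_prod_directSum (R := ℤ_[p]) (M := M.carrier)
  have hfin : ∀ i, Finite (ℤ_[p] ⧸ Submodule.span ℤ_[p] {q i ^ e i}) := fun i =>
    finite_padicInt_quotient (pow_ne_zero _ (hq i).ne_zero)
  have : Finite (DirectSum ι fun i => ℤ_[p] ⧸ Submodule.span ℤ_[p] {q i ^ e i}) :=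
    Finite.of_equiv _ (DFinsupp.equivFunOnFintype (ι := ι)).symm
  have h1 : n = 1 := by
    have := M.finrank_eq_one
    rw [f.finrank_eq, finrank_prod_finite, Module.finrank_finsupp_self, Fintype.card_fin] at this
    exact this
  subst h1
  exact ⟨⟨DirectSum ι fun i => ℤ_[p] ⧸ Submodule.span ℤ_[p] {q i ^ e i}⟩,
    ⟨f.trans (LinearEquiv.prodCongr (Finsupp.uniqueLinearEquiv ℤ_[p] ℤ_[p] (0 : Fin 1))
      (LinearEquiv.refl _ _))⟩⟩

/-- The finite summand of `ℤ_p × T` consists of the torsion elements, so it is preserved by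
isomorphisms. -/
theorem equiv_of_padicInt_prod_equiv [Finite M] [Finite N]
    (e : (ℤ_[p] × M) ≃ₗ[ℤ_[p]] (ℤ_[p] × N)) : Nonempty (M ≃ₗ[ℤ_[p]] N) := by
  have key : ∀ {A B : Type} [AddCommGroup A] [Module ℤ_[p] A] [AddCommGroup B] [Module ℤ_[p] B]
      [Finite A] (f : (ℤ_[p] × A) →ₗ[ℤ_[p]] (ℤ_[p] × B)) (x : A), (f (0, x)).1 = 0 := by
    intro A B _ _ _ _ _ f x
    obtain ⟨n, hn⟩ := exists_pow_smul_eq_zero (p := p) A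
    have h : (p : ℤ_[p]) ^ n • f (0, x) = 0 := by
      rw [← map_smul]
      have : (p : ℤ_[p]) ^ n • ((0 : ℤ_[p]), x) = 0 := Prod.ext (smul_zero _) (hn x)
      rw [this, map_zero]
    have h1 : (p : ℤ_[p]) ^ n • (f (0, x)).1 = 0 := congrArg Prod.fst h
    exact (smul_eq_zero.1 h1).resolve_left (pow_ne_zero _ PadicInt.prime_p.ne_zero)
  refine ⟨LinearEquiv.ofLinearMap
    (LinearMap.snd ℤ_[p] _ _ ∘ₗ e.toLinearMap ∘ₗ LinearMap.inr ℤ_[p] _ _)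
    (LinearMap.snd ℤ_[p] _ _ ∘ₗ e.symm.toLinearMap ∘ₗ LinearMap.inr ℤ_[p] _ _) ?_ ?_⟩
  · ext x
    have h : ((0 : ℤ_[p]), (e.symm (0, x)).2) = e.symm (0, x) :=
      Prod.ext (key e.symm.toLinearMap x).symm rfl
    change (e (0, (e.symm (0, x)).2)).2 = x
    rw [h, e.apply_symm_apply]
  · ext x
    have h : ((0 : ℤ_[p]), (e (0, x)).2) = e (0, x) :=
      Prod.ext (key e.toLinearMap x).symm rfl
    change (e.symm (0, (e (0, x)).2)).2 = x
    rw [h, e.symm_apply_apply]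

/-- The class of `ℤ_p × T`. -/
def splitX₁ (p : ℕ) [Fact p.Prime] (T : Type) [AddCommGroup T] [Module ℤ_[p] T] [Finite T] :
    X₁ p :=
  Quotient.mk (RankOnePModule.isoSetoid p)
    ⟨ℤ_[p] × T, by rw [finrank_prod_finite, Module.finrank_self]⟩

theorem splitX₁_eq_iff [Finite T] {H : X₁ p} :
    splitX₁ p T = H ↔ Nonempty ((ℤ_[p] × T) ≃ₗ[ℤ_[p]] H.mod) :=
  Quotient.mk_eq_iff_out

/-- The torsion type of a rank one module: the class of `T` if the module is `ℤ_p × T`. -/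
def torsionClass (H : X₁ p) : X₀ p :=
  Quotient.mk (FinitePModule.isoSetoid p) (exists_equiv_padicInt_prod (Quotient.out H)).choose

theorem splitX₁_grp_torsionClass (H : X₁ p) : splitX₁ p (torsionClass H).grp = H := by
  rw [splitX₁_eq_iff]
  obtain ⟨e⟩ := (exists_equiv_padicInt_prod (Quotient.out H)).choose_spec
  have h : (torsionClass H).grp ≃ₗ[ℤ_[p]] _ :=
    (toX₀Equiv p (exists_equiv_padicInt_prod (Quotient.out H)).choose.carrier).symm
  exact ⟨(LinearEquiv.prodCongr (LinearEquiv.refl _ _) h).trans e.symm⟩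

/-- A splitting of a rank one module. -/
def modEquiv (H : X₁ p) : H.mod ≃ₗ[ℤ_[p]] ℤ_[p] × (torsionClass H).grp :=
  (splitX₁_eq_iff.1 (splitX₁_grp_torsionClass H)).some.symm

theorem splitX₁_eq_iff_torsionClass [Finite T] {H : X₁ p} :
    splitX₁ p T = H ↔ toX₀ p T = torsionClass H := by
  rw [splitX₁_eq_iff, toX₀_eq_iff]
  constructor
  · rintro ⟨e⟩
    exact equiv_of_padicInt_prod_equiv (e.trans (modEquiv H))
  · rintro ⟨e⟩
    exact ⟨(LinearEquiv.prodCongr (LinearEquiv.refl _ _) e).trans (modEquiv H).symm⟩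

/-- A rank one module is determined by its torsion. -/
def torsionEquiv (p : ℕ) [Fact p.Prime] : X₁ p ≃ X₀ p where
  toFun := torsionClass
  invFun T := splitX₁ p T.grp
  left_inv := splitX₁_grp_torsionClass
  right_inv T := (splitX₁_eq_iff_torsionClass.1 rfl).symm.trans (toX₀_grp T)

end

/-! ### Characters with a given kernel and cyclic extensions -/

section
variable {G T : Type} [AddCommGroup G] [Module ℤ_[p] G] [AddCommGroup T] [Module ℤ_[p] T]

theorem finite_prod_quotient [Finite T] {a : ℤ_[p]} (ha : a ≠ 0) (t : T) :
    Finite ((ℤ_[p] × T) ⧸ Submodule.span ℤ_[p] {(a, t)}) := by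
  obtain ⟨n, hn⟩ := exists_pow_smul_eq_zero (p := p) T
  have := finite_padicInt_quotient
    (mul_ne_zero (pow_ne_zero n (PadicInt.prime_p (p := p)).ne_zero) ha)
  let N := Submodule.span ℤ_[p] {(a, t)}
  have hle : Ideal.span {(p : ℤ_[p]) ^ n * a} ≤
      LinearMap.ker (N.mkQ ∘ₗ LinearMap.inl ℤ_[p] ℤ_[p] T) := by
    rw [Ideal.span, Submodule.span_le, Set.singleton_subset_iff, SetLike.mem_coe, LinearMap.mem_ker]
    exact (Submodule.Quotient.mk_eq_zero N).2 (Submodule.mem_span_singleton.2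
      ⟨(p : ℤ_[p]) ^ n, Prod.ext rfl (hn t)⟩)
  let f : ((ℤ_[p] ⧸ Ideal.span {(p : ℤ_[p]) ^ n * a}) × T) →ₗ[ℤ_[p]] (ℤ_[p] × T) ⧸ N :=
    LinearMap.coprod ((Ideal.span {(p : ℤ_[p]) ^ n * a}).liftQ _ hle)
      (N.mkQ ∘ₗ LinearMap.inr ℤ_[p] ℤ_[p] T)
  refine Finite.of_surjective f fun y => ?_
  obtain ⟨⟨b, s⟩, rfl⟩ := N.mkQ_surjective y
  refine ⟨(Submodule.Quotient.mk b, s), ?_⟩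
  rw [LinearMap.coprod_apply, Submodule.liftQ_apply, LinearMap.comp_apply, LinearMap.comp_apply,
    ← map_add]
  simp

instance finite_prod_quotient_pow [Finite T] (k : ℕ) (t : T) :
    Finite ((ℤ_[p] × T) ⧸ Submodule.span ℤ_[p] {((p : ℤ_[p]) ^ k, t)}) :=
  finite_prod_quotient (pow_ne_zero k PadicInt.prime_p.ne_zero) t

/-- The map `(z, t) ↦ z p⁻ᵏ` from `ℤ_p × T` to `ℚ_p / ℤ_p`. -/
def fstPrufer (p : ℕ) [Fact p.Prime] (T : Type) [AddCommGroup T] [Module ℤ_[p] T] (k : ℕ) :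
    (ℤ_[p] × T) →ₗ[ℤ_[p]] Prufer p :=
  LinearMap.toSpanSingleton ℤ_[p] _ (pruferGen p k) ∘ₗ LinearMap.fst ℤ_[p] ℤ_[p] T

/-- A character `χ` of `G` together with a map `q : ℤ_p × T → G` which identifies `T` with the
kernel of `χ` and sends `(1, 0)` to an element where `χ` takes the value `p⁻ᵏ`. -/
structure IsCharPresentation (k : ℕ) (χ : G →ₗ[ℤ_[p]] Prufer p) (q : (ℤ_[p] × T) →ₗ[ℤ_[p]] G) :
    Prop where
  comp_eq : χ ∘ₗ q = fstPrufer p T k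
  inj : ∀ t : T, q (0, t) = 0 → t = 0
  exists_of_ker : ∀ x : G, χ x = 0 → ∃ t : T, q (0, t) = x

namespace IsCharPresentation

variable {k : ℕ} {χ : G →ₗ[ℤ_[p]] Prufer p} {q : (ℤ_[p] × T) →ₗ[ℤ_[p]] G}

theorem apply_eq (h : IsCharPresentation k χ q) (x : ℤ_[p] × T) :
    χ (q x) = x.1 • pruferGen p k := LinearMap.congr_fun h.comp_eq x

/-- The kernel of the character is a copy of `T`. -/
def kerEquiv (h : IsCharPresentation k χ q) : T ≃ₗ[ℤ_[p]] LinearMap.ker χ :=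
  LinearEquiv.ofBijective
    ((q ∘ₗ LinearMap.inr ℤ_[p] ℤ_[p] T).codRestrict (LinearMap.ker χ) fun t => by
      rw [LinearMap.mem_ker, LinearMap.comp_apply, h.apply_eq]
      exact zero_smul _ _)
    ⟨(injective_iff_map_eq_zero _).2 fun t ht => h.inj t (congrArg Subtype.val ht),
      fun ⟨x, hx⟩ => by
        obtain ⟨t, ht⟩ := h.exists_of_ker x hx
        exact ⟨t, Subtype.ext ht⟩⟩

/-- The kernel of `q` is generated by `(p^k, t)`, where `q (0, t) = -q (p^k, 0)`. -/
theorem exists_ker_eq (h : IsCharPresentation k χ q) :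
    ∃ t : T, LinearMap.ker q = Submodule.span ℤ_[p] {((p : ℤ_[p]) ^ k, t)} := by
  obtain ⟨t, ht⟩ := h.exists_of_ker (q (-(p : ℤ_[p]) ^ k, 0)) (by
    rw [h.apply_eq]
    exact smul_pruferGen_eq_zero.2 (dvd_neg.2 dvd_rfl))
  have h0 : q ((p : ℤ_[p]) ^ k, t) = 0 := by
    have : ((p : ℤ_[p]) ^ k, t) = (0, t) - (-(p : ℤ_[p]) ^ k, (0 : T)) := by simp
    rw [this, map_sub, ht, sub_self]
  refine ⟨t, le_antisymm ?_ ?_⟩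
  · rintro ⟨z, s⟩ hz
    rw [LinearMap.mem_ker] at hz
    have hd : (p : ℤ_[p]) ^ k ∣ z := by
      rw [← smul_pruferGen_eq_zero, ← h.apply_eq (z, s), hz, map_zero]
    obtain ⟨c, rfl⟩ := hd
    have hs : s - c • t = 0 := h.inj _ (by
      have : ((0 : ℤ_[p]), s - c • t)
          = ((p : ℤ_[p]) ^ k * c, s) - c • ((p : ℤ_[p]) ^ k, t) := by
        simp [mul_comm]
      rw [this, map_sub, map_smul, h0, hz, smul_zero, sub_zero])
    refine Submodule.mem_span_singleton.2 ⟨c, ?_⟩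
    rw [sub_eq_zero.1 hs]
    simp [mul_comm]
  · rw [Submodule.span_le, Set.singleton_subset_iff]
    exact h0

theorem range_eq (h : IsCharPresentation k χ q) (hq : Function.Surjective q) :
    LinearMap.range χ = Submodule.span ℤ_[p] {pruferGen p k} := by
  have h1 : LinearMap.range χ = LinearMap.range (χ ∘ₗ q) :=
    (LinearMap.range_comp_of_range_eq_top χ (LinearMap.range_eq_top.2 hq)).symm
  have h2 : LinearMap.range (LinearMap.fst ℤ_[p] ℤ_[p] T) = ⊤ :=
    LinearMap.range_eq_top.2 LinearMap.fst_surjective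
  rw [h1, h.comp_eq, fstPrufer, LinearMap.range_comp_of_range_eq_top _ h2,
    LinearMap.span_singleton_eq_range]

theorem card_eq (h : IsCharPresentation k χ q) (hq : Function.Surjective q) :
    Nat.card G = p ^ k * Nat.card T := by
  rw [LinearMap.card_eq_card_range_mul_card_ker χ, h.range_eq hq, card_span_pruferGen,
    Nat.card_congr h.kerEquiv.toEquiv]

end IsCharPresentation

/-- If `#G = p^k #ker χ` then the values of `χ` are the multiples of `p⁻ᵏ`. -/
theorem range_eq_of_card [Finite G] {k : ℕ} {χ : G →ₗ[ℤ_[p]] Prufer p}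
    (h : Nat.card G = p ^ k * Nat.card (LinearMap.ker χ)) :
    LinearMap.range χ = Submodule.span ℤ_[p] {pruferGen p k} := by
  have hfr : Finite (LinearMap.range χ) := Finite.of_surjective _ χ.surjective_rangeRestrict
  have hc : Nat.card (LinearMap.range χ) = p ^ k := by
    rw [LinearMap.card_eq_card_range_mul_card_ker χ] at h
    exact Nat.eq_of_mul_eq_mul_right Nat.card_pos h
  have hle : LinearMap.range χ ≤ Submodule.span ℤ_[p] {pruferGen p k} := fun w hw => by
    obtain ⟨z, rfl⟩ := exists_smul_pruferGen (k := k) (w := w)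
      (congrArg Subtype.val (pow_smul_eq_zero_of_card hc ⟨w, hw⟩))
    exact Submodule.smul_mem _ _ (Submodule.mem_span_singleton_self _)
  have hfin : Finite (Submodule.span ℤ_[p] {pruferGen p k}) := by
    refine (Nat.card_pos_iff.1 ?_).2
    rw [card_span_pruferGen]
    exact pow_pos (Fact.out : p.Prime).pos _
  refine SetLike.coe_injective (Set.eq_of_subset_of_ncard_le hle ?_ (Set.toFinite _))
  change Nat.card (Submodule.span ℤ_[p] {pruferGen p k}) ≤ Nat.card (LinearMap.range χ)
  rw [hc, card_span_pruferGen]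

namespace IsCharPresentation

variable {k : ℕ} {χ : G →ₗ[ℤ_[p]] Prufer p} {q : (ℤ_[p] × T) →ₗ[ℤ_[p]] G}

theorem surjective [Finite G] (h : IsCharPresentation k χ q)
    (hc : Nat.card G = p ^ k * Nat.card T) : Function.Surjective q := fun y => by
  have hr := range_eq_of_card (χ := χ) (k := k) (by rw [hc, Nat.card_congr h.kerEquiv.toEquiv])
  have hy : χ y ∈ Submodule.span ℤ_[p] {pruferGen p k} := hr ▸ LinearMap.mem_range_self χ y
  obtain ⟨z, hz⟩ := Submodule.mem_span_singleton.1 hy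
  obtain ⟨t, ht⟩ := h.exists_of_ker (y - q (z, 0)) (by
    rw [map_sub, h.apply_eq, sub_eq_zero]
    exact hz.symm)
  refine ⟨(z, t), ?_⟩
  have : (z, t) = (z, (0 : T)) + (0, t) := by simp
  rw [this, map_add, ht, add_sub_cancel]

end IsCharPresentation

/-- Every character comes with a presentation. -/
theorem exists_isCharPresentation_of_equiv [Finite G] (χ : G →ₗ[ℤ_[p]] Prufer p)
    (ι : LinearMap.ker χ ≃ₗ[ℤ_[p]] T) :
    ∃ (k : ℕ) (q : (ℤ_[p] × T) →ₗ[ℤ_[p]] G), IsCharPresentation k χ q ∧ Function.Surjective q := by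
  obtain ⟨k, hk⟩ := exists_card_eq_pow (p := p) (G ⧸ LinearMap.ker χ)
  have hc : Nat.card G = p ^ k * Nat.card (LinearMap.ker χ) := by
    rw [Submodule.card_eq_card_quotient_mul_card' (LinearMap.ker χ), hk]
  have hr := range_eq_of_card hc
  have hmem : pruferGen p k ∈ LinearMap.range χ := hr ▸ Submodule.mem_span_singleton_self _
  obtain ⟨g, hg⟩ := hmem
  let q : (ℤ_[p] × T) →ₗ[ℤ_[p]] G := LinearMap.coprod (LinearMap.toSpanSingleton ℤ_[p] G g)
    ((LinearMap.ker χ).subtype ∘ₗ ι.symm.toLinearMap)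
  have hqa : ∀ z t, q (z, t) = z • g + ι.symm t := fun z t => rfl
  have hq : IsCharPresentation k χ q := by
    refine ⟨LinearMap.ext fun ⟨z, t⟩ => ?_, fun t ht => ?_, fun x hx => ⟨ι ⟨x, hx⟩, ?_⟩⟩
    · change χ (q (z, t)) = z • pruferGen p k
      rw [hqa, map_add, map_smul, hg, LinearMap.mem_ker.1 (ι.symm t).2, add_zero]
    · rw [hqa, zero_smul, zero_add] at ht
      exact (LinearEquiv.map_eq_zero_iff ι.symm).1 (Subtype.ext ht)
    · rw [hqa, zero_smul, zero_add, LinearEquiv.symm_apply_apply]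
  exact ⟨k, q, hq, hq.surjective (by rw [hc, Nat.card_congr ι.toEquiv])⟩

/-- A presentation of `G` as `(ℤ_p × T) / (p^k, t)` determines a character: `(z, s) ↦ z p⁻ᵏ`
vanishes on `(p^k, t)`. -/
theorem exists_isCharPresentation {k : ℕ} {q : (ℤ_[p] × T) →ₗ[ℤ_[p]] G}
    (hq : Function.Surjective q) {t : T}
    (hk : LinearMap.ker q = Submodule.span ℤ_[p] {((p : ℤ_[p]) ^ k, t)}) :
    ∃ χ : G →ₗ[ℤ_[p]] Prufer p, IsCharPresentation k χ q := by
  have hle : LinearMap.ker q ≤ LinearMap.ker (fstPrufer p T k) := by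
    rw [hk, Submodule.span_le, Set.singleton_subset_iff]
    exact smul_pruferGen_eq_zero.2 dvd_rfl
  obtain ⟨χ, hχ⟩ := LinearMap.exists_comp_eq_of_ker_le hq hle
  have hp : (p : ℤ_[p]) ^ k ≠ 0 := pow_ne_zero _ PadicInt.prime_p.ne_zero
  refine ⟨χ, LinearMap.ext hχ, fun s hs => ?_, fun x hx => ?_⟩
  · have hs' : ((0 : ℤ_[p]), s) ∈ LinearMap.ker q := hs
    rw [hk] at hs'
    obtain ⟨c, hc⟩ := Submodule.mem_span_singleton.1 hs'
    have h1 : c * (p : ℤ_[p]) ^ k = 0 := congrArg Prod.fst hc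
    have h2 : c • t = s := congrArg Prod.snd hc
    rw [← h2, (mul_eq_zero.1 h1).resolve_right hp, zero_smul]
  · obtain ⟨⟨z, s⟩, rfl⟩ := hq x
    have hx' : fstPrufer p T k (z, s) = 0 := by
      rw [← hχ]
      exact hx
    obtain ⟨c, rfl⟩ := smul_pruferGen_eq_zero.1 (show z • pruferGen p k = 0 from hx')
    have h0 : q ((p : ℤ_[p]) ^ k, t) = 0 := by
      rw [← LinearMap.mem_ker, hk]
      exact Submodule.mem_span_singleton_self _
    refine ⟨s - c • t, ?_⟩
    have : ((0 : ℤ_[p]), s - c • t)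
        = ((p : ℤ_[p]) ^ k * c, s) - c • ((p : ℤ_[p]) ^ k, t) := by
      simp [mul_comm]
    rw [this, map_sub, map_smul, h0, smul_zero, sub_zero]

theorem card_prod_quotient_pow [Finite T] (k : ℕ) (t : T) :
    Nat.card ((ℤ_[p] × T) ⧸ Submodule.span ℤ_[p] {((p : ℤ_[p]) ^ k, t)}) = p ^ k * Nat.card T := by
  obtain ⟨χ, hχ⟩ := exists_isCharPresentation (k := k) (t := t)
    (Submodule.mkQ_surjective (Submodule.span ℤ_[p] {((p : ℤ_[p]) ^ k, t)})) (Submodule.ker_mkQ _)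
  exact hχ.card_eq (Submodule.mkQ_surjective _)

/-- Presentations of `G` by `(ℤ_p × T) / (p^k, t)` amount to pairs `(χ, q)`. -/
theorem card_isCharPresentation_eq_sum [Finite G] [Finite T] {k : ℕ}
    (hc : Nat.card G = p ^ k * Nat.card T) :
    Nat.card {x : (G →ₗ[ℤ_[p]] Prufer p) × ((ℤ_[p] × T) →ₗ[ℤ_[p]] G) //
      IsCharPresentation k x.1 x.2} =
    Nat.card (Σ t : T,
      ((ℤ_[p] × T) ⧸ Submodule.span ℤ_[p] {((p : ℤ_[p]) ^ k, t)}) ≃ₗ[ℤ_[p]] G) := by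
  have hsurj : ∀ (t : T) (f : ((ℤ_[p] × T) ⧸
      Submodule.span ℤ_[p] {((p : ℤ_[p]) ^ k, t)}) ≃ₗ[ℤ_[p]] G),
      Function.Surjective (f.toLinearMap ∘ₗ Submodule.mkQ _) := fun t f =>
    f.surjective.comp (Submodule.mkQ_surjective _)
  have hker : ∀ (t : T) (f : ((ℤ_[p] × T) ⧸
      Submodule.span ℤ_[p] {((p : ℤ_[p]) ^ k, t)}) ≃ₗ[ℤ_[p]] G),
      LinearMap.ker (f.toLinearMap ∘ₗ Submodule.mkQ _)
        = Submodule.span ℤ_[p] {((p : ℤ_[p]) ^ k, t)} := fun t f => by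
    rw [LinearEquiv.ker_comp, Submodule.ker_mkQ]
  refine (Nat.card_congr (Equiv.ofBijective (fun x : (Σ t : T, ((ℤ_[p] × T) ⧸
      Submodule.span ℤ_[p] {((p : ℤ_[p]) ^ k, t)}) ≃ₗ[ℤ_[p]] G) =>
    (⟨((exists_isCharPresentation (hsurj x.1 x.2) (hker x.1 x.2)).choose,
      x.2.toLinearMap ∘ₗ Submodule.mkQ _),
      (exists_isCharPresentation (hsurj x.1 x.2) (hker x.1 x.2)).choose_spec⟩ :
      {x : (G →ₗ[ℤ_[p]] Prufer p) × ((ℤ_[p] × T) →ₗ[ℤ_[p]] G) //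
        IsCharPresentation k x.1 x.2})) ⟨?_, ?_⟩)).symm
  · rintro ⟨t, f⟩ ⟨s, g⟩ h
    have h2 : f.toLinearMap ∘ₗ Submodule.mkQ _ = g.toLinearMap ∘ₗ Submodule.mkQ _ :=
      congrArg (fun x => x.1.2) h
    obtain rfl : t = s := by
      have h3 : ((p : ℤ_[p]) ^ k, t) ∈ Submodule.span ℤ_[p] {((p : ℤ_[p]) ^ k, s)} := by
        rw [← hker s g, ← h2, hker]
        exact Submodule.mem_span_singleton_self _
      obtain ⟨c, hc⟩ := Submodule.mem_span_singleton.1 h3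
      have hp : (p : ℤ_[p]) ^ k ≠ 0 := pow_ne_zero _ PadicInt.prime_p.ne_zero
      have h4 : c * (p : ℤ_[p]) ^ k = (p : ℤ_[p]) ^ k := congrArg Prod.fst hc
      have h5 : c • s = t := congrArg Prod.snd hc
      rw [← h5, mul_eq_right₀ hp |>.1 h4, one_smul]
    congr 1
    exact LinearEquiv.toLinearMap_injective
      ((LinearMap.cancel_right (Submodule.mkQ_surjective _)).1 h2)
  · rintro ⟨⟨χ, q⟩, h⟩
    obtain ⟨t, ht⟩ := h.exists_ker_eq
    have hq := h.surjective hc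
    let f := (Submodule.quotEquivOfEq _ _ ht.symm).trans (q.quotKerEquivOfSurjective hq)
    have hf : f.toLinearMap ∘ₗ Submodule.mkQ _ = q := LinearMap.ext fun x => rfl
    refine ⟨⟨t, f⟩, Subtype.ext (Prod.ext ?_ hf)⟩
    have h3 := (exists_isCharPresentation (hsurj t f) (hker t f)).choose_spec.comp_eq
    refine (LinearMap.cancel_right (hsurj t f)).1 (h3.trans ?_)
    rw [hf]
    exact h.comp_eq.symm

/-- For a given character `χ`, the map `q` amounts to an identification of `T` with `ker χ` and the
image of `(1, 0)`. -/
theorem card_isCharPresentation_eq_sum_ker {k : ℕ} :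
    Nat.card {x : (G →ₗ[ℤ_[p]] Prufer p) × ((ℤ_[p] × T) →ₗ[ℤ_[p]] G) //
      IsCharPresentation k x.1 x.2} =
    Nat.card (Σ χ : G →ₗ[ℤ_[p]] Prufer p,
      (T ≃ₗ[ℤ_[p]] LinearMap.ker χ) × {g : G // χ g = pruferGen p k}) := by
  let q : (Σ χ : G →ₗ[ℤ_[p]] Prufer p,
      (T ≃ₗ[ℤ_[p]] LinearMap.ker χ) × {g : G // χ g = pruferGen p k}) →
      ((ℤ_[p] × T) →ₗ[ℤ_[p]] G) := fun x =>
    LinearMap.coprod (LinearMap.toSpanSingleton ℤ_[p] G x.2.2.1)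
      ((LinearMap.ker x.1).subtype ∘ₗ x.2.1.toLinearMap)
  have hq : ∀ x z t, q x (z, t) = z • x.2.2.1 + x.2.1 t := fun x z t => rfl
  refine (Nat.card_congr (Equiv.ofBijective (fun x => (⟨(x.1, q x), ?_, ?_, ?_⟩ :
    {x : (G →ₗ[ℤ_[p]] Prufer p) × ((ℤ_[p] × T) →ₗ[ℤ_[p]] G) //
      IsCharPresentation k x.1 x.2})) ⟨?_, ?_⟩)).symm
  · refine LinearMap.ext fun ⟨z, t⟩ => ?_
    change x.1 (q x (z, t)) = z • pruferGen p k
    rw [hq, map_add, map_smul, x.2.2.2, LinearMap.mem_ker.1 (x.2.1 t).2, add_zero]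
  · intro t ht
    rw [hq, zero_smul, zero_add] at ht
    exact (LinearEquiv.map_eq_zero_iff x.2.1).1 (Subtype.ext ht)
  · intro y hy
    refine ⟨x.2.1.symm ⟨y, hy⟩, ?_⟩
    rw [hq, zero_smul, zero_add, LinearEquiv.apply_symm_apply]
  · rintro ⟨χ, ι, g⟩ ⟨χ', ι', g'⟩ h
    have h1 : χ = χ' := congrArg (fun x => x.1.1) h
    subst h1
    have h2 : ∀ z t, z • g.1 + ι t = z • g'.1 + (ι' t : G) := fun z t =>
      LinearMap.congr_fun (congrArg (fun x => x.1.2) h) (z, t)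
    have h3 : ι = ι' := LinearEquiv.ext fun t => Subtype.ext (by simpa using h2 0 t)
    have h4 : g = g' := Subtype.ext (by simpa using h2 1 0)
    rw [h3, h4]
  · rintro ⟨⟨χ, f⟩, h⟩
    refine ⟨⟨χ, h.kerEquiv, ⟨f (1, 0), (h.apply_eq (1, 0)).trans (one_smul _ _)⟩⟩,
      Subtype.ext (Prod.ext rfl (LinearMap.ext fun ⟨z, t⟩ => ?_))⟩
    rw [hq]
    change z • f (1, 0) + f (0, t) = f (z, t)
    rw [← map_smul, ← map_add]
    simp

end

/-- The double count behind detailed balance: pairs of a character of `G` and a presentation are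
counted by quotients of `ℤ_p × T` isomorphic to `G`, and by characters with kernel isomorphic to
`T`. -/
theorem card_quotient_mul_cardAut {G T : X₀ p} {k : ℕ} (hc : cardGrp G = p ^ k * cardGrp T) :
    Nat.card {t : T.grp // toX₀ p ((ℤ_[p] × T.grp) ⧸
        Submodule.span ℤ_[p] {((p : ℤ_[p]) ^ k, t)}) = G} * cardAut G =
      Nat.card {χ : G.grp →ₗ[ℤ_[p]] Prufer p // toX₀ p (LinearMap.ker χ) = T} *
        (cardAut T * cardGrp T) := by
  classical
  have h1 := (card_isCharPresentation_eq_sum hc).symm.trans card_isCharPresentation_eq_sum_ker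
  have := Fintype.ofFinite T.grp
  have := Fintype.ofFinite (G.grp →ₗ[ℤ_[p]] Prufer p)
  have hfin : ∀ t : T.grp, Finite (((ℤ_[p] × T.grp) ⧸
      Submodule.span ℤ_[p] {((p : ℤ_[p]) ^ k, t)}) ≃ₗ[ℤ_[p]] G.grp) := fun t =>
    DFunLike.finite _
  have hfin' : ∀ χ : G.grp →ₗ[ℤ_[p]] Prufer p, Finite (T.grp ≃ₗ[ℤ_[p]] LinearMap.ker χ) :=
    fun χ => DFunLike.finite _
  rw [Nat.card_sigma, Nat.card_sigma] at h1
  have hL : ∀ t : T.grp, Nat.card (((ℤ_[p] × T.grp) ⧸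
      Submodule.span ℤ_[p] {((p : ℤ_[p]) ^ k, t)}) ≃ₗ[ℤ_[p]] G.grp) =
      if toX₀ p ((ℤ_[p] × T.grp) ⧸ Submodule.span ℤ_[p] {((p : ℤ_[p]) ^ k, t)}) = G
        then cardAut G else 0 := fun t => card_linearEquiv G
  have hR : ∀ χ : G.grp →ₗ[ℤ_[p]] Prufer p, Nat.card ((T.grp ≃ₗ[ℤ_[p]] LinearMap.ker χ) ×
      {g : G.grp // χ g = pruferGen p k}) =
      if toX₀ p (LinearMap.ker χ) = T then cardAut T * cardGrp T else 0 := fun χ => by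
    have h2 : Nat.card (T.grp ≃ₗ[ℤ_[p]] LinearMap.ker χ)
        = Nat.card (LinearMap.ker χ ≃ₗ[ℤ_[p]] T.grp) :=
      Nat.card_congr ⟨LinearEquiv.symm, LinearEquiv.symm, fun _ => rfl, fun _ => rfl⟩
    rw [Nat.card_prod, h2, card_linearEquiv]
    split_ifs with h
    · congr 1
      obtain ⟨e⟩ := toX₀_eq_iff.1 h
      have hcard : Nat.card (LinearMap.ker χ) = cardGrp T := Nat.card_congr e.toEquiv
      have hr := range_eq_of_card (χ := χ) (k := k) (by rw [hcard]; exact hc)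
      have hmem : pruferGen p k ∈ LinearMap.range χ := hr ▸ Submodule.mem_span_singleton_self _
      obtain ⟨g₀, hg₀⟩ := hmem
      rw [← hcard]
      refine Nat.card_congr ⟨fun g => ⟨g.1 - g₀, ?_⟩, fun x => ⟨x.1 + g₀, ?_⟩, fun g => ?_,
        fun x => ?_⟩
      · rw [LinearMap.mem_ker, map_sub, g.2, hg₀, sub_self]
      · rw [map_add, LinearMap.mem_ker.1 x.2, hg₀, zero_add]
      · simp
      · simp
    · exact zero_mul _
  rw [Finset.sum_congr rfl fun t _ => hL t, Finset.sum_congr rfl fun χ _ => hR χ,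
    ← Finset.sum_filter, ← Finset.sum_filter, Finset.sum_const, Finset.sum_const, smul_eq_mul,
    smul_eq_mul, ← Fintype.card_subtype, ← Fintype.card_subtype] at h1
  rw [Nat.card_eq_fintype_card, Nat.card_eq_fintype_card]
  exact h1

/-! ### Extensions by `ℤ_p` and characters -/

/-- The injective resolution `0 → ℤ_p → ℚ_p → ℚ_p / ℤ_p → 0`. -/
def pruferSequence (p : ℕ) [Fact p.Prime] : ShortComplex (ModuleCat ℤ_[p]) :=
  ShortComplex.mk (ModuleCat.ofHom (Algebra.linearMap ℤ_[p] ℚ_[p]))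
    (ModuleCat.ofHom (padicLattice p).mkQ) (by
      ext
      exact mkQ_prufer_eq_zero.2 ⟨1, rfl⟩)

theorem pruferSequence_shortExact : (pruferSequence p).ShortExact where
  exact := by
    rw [ShortComplex.moduleCat_exact_iff]
    intro x hx
    exact mkQ_prufer_eq_zero.1 hx
  mono_f := (ModuleCat.mono_iff_injective _).2 (FaithfulSMul.algebraMap_injective ℤ_[p] ℚ_[p])
  epi_g := (ModuleCat.epi_iff_surjective _).2 (padicLattice p).mkQ_surjective

instance injective_padic : Injective (ModuleCat.of ℤ_[p] ℚ_[p]) :=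
  Module.injective_object_of_injective_module (inj := baer_padic.injective)

theorem linearMap_padic_eq_zero {G : Type} [AddCommGroup G] [Module ℤ_[p] G] [Finite G]
    (f : G →ₗ[ℤ_[p]] ℚ_[p]) : f = 0 := by
  obtain ⟨n, hn⟩ := exists_pow_smul_eq_zero (p := p) G
  refine LinearMap.ext fun x => ?_
  have h : (p : ℤ_[p]) ^ n • f x = 0 := by rw [← map_smul, hn, map_zero]
  rw [Algebra.smul_def] at h
  refine (mul_eq_zero.1 h).resolve_left ?_
  rw [PadicInt.algebraMap_apply]
  push_cast
  exact pow_ne_zero _ (by exact_mod_cast (Fact.out : p.Prime).ne_zero)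

section
variable (G : Type) [AddCommGroup G] [Module ℤ_[p] G]

/-- The extension class of `G` by `ℤ_p` attached to a character of `G`: the pullback of
`0 → ℤ_p → ℚ_p → ℚ_p / ℤ_p → 0`. -/
def charExt (χ : G →ₗ[ℤ_[p]] Prufer p) :
    Abelian.Ext (ModuleCat.of ℤ_[p] G) (ModuleCat.of ℤ_[p] ℤ_[p]) 1 :=
  (Abelian.Ext.mk₀ (ModuleCat.ofHom χ :
      ModuleCat.of ℤ_[p] G ⟶ ModuleCat.of ℤ_[p] (Prufer p))).comp
    (pruferSequence_shortExact (p := p)).extClass (zero_add 1)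

/-- Every extension of a finite module `G` by `ℤ_p` comes from exactly one character, because
`ℚ_p` is injective and receives no nonzero map from `G`. -/
theorem charExt_bijective [Finite G] : Function.Bijective (charExt (p := p) G) := by
  constructor
  · intro χ ψ h
    have h0 : (Abelian.Ext.mk₀ (ModuleCat.ofHom (χ - ψ) :
        ModuleCat.of ℤ_[p] G ⟶ ModuleCat.of ℤ_[p] (Prufer p))).comp
          (pruferSequence_shortExact (p := p)).extClass (zero_add 1) = 0 := by
      have hadd : charExt G ((χ - ψ) + ψ) = charExt G (χ - ψ) + charExt G ψ := by
        let f : (G →ₗ[ℤ_[p]] Prufer p) →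
            Abelian.Ext (ModuleCat.of ℤ_[p] G) (pruferSequence p).X₃ 0 := fun φ =>
          Abelian.Ext.addEquiv₀.symm (ModuleCat.ofHom φ)
        have hf : f ((χ - ψ) + ψ) = f (χ - ψ) + f ψ :=
          map_add Abelian.Ext.addEquiv₀.symm (ModuleCat.ofHom (χ - ψ) :
            ModuleCat.of ℤ_[p] G ⟶ ModuleCat.of ℤ_[p] (Prufer p)) (ModuleCat.ofHom ψ)
        exact (congrArg (fun x => Abelian.Ext.comp x pruferSequence_shortExact.extClass
          (zero_add 1)) hf).trans (Abelian.Ext.add_comp _ _ _ _)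
      rw [sub_add_cancel, h] at hadd
      exact right_eq_add.1 hadd
    obtain ⟨x, hx⟩ := Abelian.Ext.covariant_sequence_exact₃ _ pruferSequence_shortExact _ _ h0
    obtain ⟨f, rfl⟩ := Abelian.Ext.addEquiv₀.symm.surjective x
    have hf : f = 0 := ModuleCat.hom_ext (linearMap_padic_eq_zero f.hom)
    rw [hf, map_zero, Abelian.Ext.zero_comp] at hx
    have h1 : (ModuleCat.ofHom (χ - ψ) :
        ModuleCat.of ℤ_[p] G ⟶ ModuleCat.of ℤ_[p] (Prufer p)) = 0 := by
      apply Abelian.Ext.addEquiv₀.symm.injective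
      rw [map_zero]
      exact hx.symm
    have h2 : χ - ψ = 0 := congrArg ModuleCat.Hom.hom h1
    exact sub_eq_zero.1 h2
  · intro e
    obtain ⟨x, hx⟩ := Abelian.Ext.covariant_sequence_exact₁ _ pruferSequence_shortExact e
      (Abelian.Ext.eq_zero_of_injective (I := ModuleCat.of ℤ_[p] ℚ_[p]) _) (zero_add 1)
    obtain ⟨f, rfl⟩ := Abelian.Ext.addEquiv₀.symm.surjective x
    exact ⟨f.hom, hx⟩

end

/-- A map of short exact sequences from `0 → ℤ_p → M → G → 0` to `0 → ℤ_p → ℚ_p → ℚ_p / ℤ_p → 0`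
identifies the extension class. -/
theorem extClass_eq_charExt {M G : Type} [AddCommGroup M] [Module ℤ_[p] M] [AddCommGroup G]
    [Module ℤ_[p] G] {i : ModuleCat.of ℤ_[p] ℤ_[p] ⟶ ModuleCat.of ℤ_[p] M}
    {q : ModuleCat.of ℤ_[p] M ⟶ ModuleCat.of ℤ_[p] G} {w : i ≫ q = 0}
    (h : (ShortComplex.mk i q w).ShortExact) (τ : M →ₗ[ℤ_[p]] ℚ_[p]) (χ : G →ₗ[ℤ_[p]] Prufer p)
    (hτ : ∀ z : ℤ_[p], τ (i.hom z) = z) (hχ : ∀ x, χ (q.hom x) = (padicLattice p).mkQ (τ x)) :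
    h.extClass = charExt G χ := by
  let f : ShortComplex.mk i q w ⟶ pruferSequence p :=
    { τ₁ := 𝟙 _
      τ₂ := ModuleCat.ofHom τ
      τ₃ := ModuleCat.ofHom χ
      comm₁₂ := by
        refine ModuleCat.hom_ext (LinearMap.ext fun z => ?_)
        exact (hτ z).symm
      comm₂₃ := by
        refine ModuleCat.hom_ext (LinearMap.ext fun x => ?_)
        exact (hχ x).symm }
  have := ShortComplex.ShortExact.extClass_naturality h pruferSequence_shortExact f
  rw [show f.τ₁ = 𝟙 _ from rfl] at this
  exact (Abelian.Ext.comp_mk₀_id _).symm.trans this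

/-- The extension attached to a character `χ` of `G` has middle term `ℤ_p × ker χ`. -/
theorem isExtensionClassWithMiddle_charExt_iff {G : X₀ p} {H : X₁ p}
    {χ : G.grp →ₗ[ℤ_[p]] Prufer p} :
    IsExtensionClassWithMiddle G H (charExt G.grp χ) ↔
      toX₀ p (LinearMap.ker χ) = torsionClass H := by
  constructor
  · rintro ⟨i, q, w, h, he⟩
    have hi : Function.Injective i.hom := (ModuleCat.mono_iff_injective _).1 h.mono_f
    have hq : Function.Surjective q.hom := (ModuleCat.epi_iff_surjective _).1 h.epi_g
    have hex : ∀ x : H.mod, q.hom x = 0 → ∃ z : ℤ_[p], i.hom z = x :=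
      (ShortComplex.moduleCat_exact_iff _).1 h.exact
    have hw : ∀ z : ℤ_[p], q.hom (i.hom z) = 0 := fun z =>
      LinearMap.congr_fun (congrArg ModuleCat.Hom.hom w) z
    obtain ⟨τ, hτ⟩ := baer_padic.extension_property i.hom hi (Algebra.linearMap ℤ_[p] ℚ_[p])
    have hτ' : ∀ z : ℤ_[p], τ (i.hom z) = z := fun z => LinearMap.congr_fun hτ z
    have hle : LinearMap.ker q.hom ≤ LinearMap.ker ((padicLattice p).mkQ ∘ₗ τ) := fun x hx => by
      obtain ⟨z, rfl⟩ := hex x hx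
      exact mkQ_prufer_eq_zero.2 ⟨z, (hτ' z).symm⟩
    obtain ⟨ψ, hψ⟩ : ∃ ψ : G.grp →ₗ[ℤ_[p]] Prufer p,
        ∀ x, ψ (q.hom x) = (padicLattice p).mkQ (τ x) :=
      LinearMap.exists_comp_eq_of_ker_le hq hle
    obtain rfl : ψ = χ :=
      (charExt_bijective _).1 ((extClass_eq_charExt h τ ψ hτ' hψ).symm.trans he)
    rw [← splitX₁_eq_iff_torsionClass, splitX₁_eq_iff]
    -- The kernel of `τ` is a copy of the kernel of the character; it is the torsion of `H`.
    have hdec : ∀ x, τ x = 0 ↔ ((modEquiv H) x).1 = 0 := fun x => by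
      have h2 : ∀ t : (torsionClass H).grp, τ ((modEquiv H).symm (0, t)) = 0 := fun t =>
        LinearMap.congr_fun (linearMap_padic_eq_zero
          (τ ∘ₗ (modEquiv H).symm.toLinearMap ∘ₗ LinearMap.inr ℤ_[p] _ _)) t
      have h3 : ∀ y : ℤ_[p] × (torsionClass H).grp,
          τ ((modEquiv H).symm y) = y.1 • τ ((modEquiv H).symm (1, 0)) := fun y => by
        have : y = y.1 • (1, 0) + (0, y.2) := by simp
        conv_lhs => rw [this]
        rw [map_add, map_add, h2, add_zero, map_smul, map_smul]
      have h4 : τ ((modEquiv H).symm (1, 0)) ≠ 0 := fun h0 => by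
        have h5 := h3 ((modEquiv H) (i.hom 1))
        rw [LinearEquiv.symm_apply_apply, h0, smul_zero, hτ'] at h5
        exact one_ne_zero (α := ℚ_[p]) (by simp at h5)
      have h6 := h3 ((modEquiv H) x)
      rw [LinearEquiv.symm_apply_apply, Algebra.smul_def] at h6
      rw [h6, mul_eq_zero, or_iff_left h4]
      simp
    have e1 : (torsionClass H).grp ≃ₗ[ℤ_[p]] LinearMap.ker ψ := by
      refine LinearEquiv.ofBijective
        ((q.hom ∘ₗ (modEquiv H).symm.toLinearMap ∘ₗ
          LinearMap.inr ℤ_[p] _ _).codRestrict (LinearMap.ker ψ) fun t => ?_)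
        ⟨(injective_iff_map_eq_zero _).2 fun t ht => ?_, ?_⟩
      · rw [LinearMap.mem_ker]
        refine (hψ _).trans ?_
        rw [(hdec _).2, map_zero]
        simp
      · obtain ⟨z, hz⟩ := hex ((modEquiv H).symm (0, t)) (congrArg Subtype.val ht)
        have h1 : τ ((modEquiv H).symm (0, t)) = 0 := (hdec _).2 (by simp)
        rw [← hz, hτ'] at h1
        have h2 : z = 0 := by simpa using h1
        rw [h2, map_zero, eq_comm, LinearEquiv.map_eq_zero_iff] at hz
        exact congrArg Prod.snd hz
      · rintro ⟨y, hy⟩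
        obtain ⟨x, rfl⟩ := hq y
        rw [LinearMap.mem_ker, hψ, mkQ_prufer_eq_zero] at hy
        obtain ⟨z, hz⟩ := hy
        have h1 : τ (x - i.hom z) = 0 := by rw [map_sub, hτ', hz, sub_self]
        refine ⟨((modEquiv H) (x - i.hom z)).2, Subtype.ext ?_⟩
        have h2 : ((0 : ℤ_[p]), ((modEquiv H) (x - i.hom z)).2) = (modEquiv H) (x - i.hom z) :=
          Prod.ext ((hdec _).1 h1).symm rfl
        change q.hom ((modEquiv H).symm (0, ((modEquiv H) (x - i.hom z)).2)) = q.hom x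
        rw [h2, LinearEquiv.symm_apply_apply, map_sub, hw, sub_zero]
    exact ⟨(LinearEquiv.prodCongr (LinearEquiv.refl _ _) e1.symm).trans (modEquiv H).symm⟩
  · intro h
    obtain ⟨ι⟩ := toX₀_eq_iff.1 h
    obtain ⟨k, q, hq, hqs⟩ := exists_isCharPresentation_of_equiv χ ι
    obtain ⟨t, ht⟩ := hq.exists_ker_eq
    have hp : ((p : ℚ_[p]) ^ k) ≠ 0 :=
      pow_ne_zero _ (by exact_mod_cast (Fact.out : p.Prime).ne_zero)
    let i' : ℤ_[p] →ₗ[ℤ_[p]] H.mod := LinearMap.toSpanSingleton ℤ_[p] _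
      ((modEquiv H).symm ((p : ℤ_[p]) ^ k, t))
    let q' : H.mod →ₗ[ℤ_[p]] G.grp := q ∘ₗ (modEquiv H).toLinearMap
    let τ : H.mod →ₗ[ℤ_[p]] ℚ_[p] := LinearMap.toSpanSingleton ℤ_[p] ℚ_[p] ((p : ℚ_[p]) ^ k)⁻¹ ∘ₗ
      LinearMap.fst ℤ_[p] _ _ ∘ₗ (modEquiv H).toLinearMap
    have hi' : ∀ z : ℤ_[p], i' z = (modEquiv H).symm (z • ((p : ℤ_[p]) ^ k, t)) := fun z =>
      (map_smul (modEquiv H).symm z _).symm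
    have hmem : ∀ x : ℤ_[p] × (torsionClass H).grp,
        q x = 0 ↔ ∃ z : ℤ_[p], z • ((p : ℤ_[p]) ^ k, t) = x := fun x => by
      rw [← LinearMap.mem_ker, ht, Submodule.mem_span_singleton]
    have hz : ∀ z, q' (i' z) = 0 := fun z => by
      rw [hi']
      change q ((modEquiv H) ((modEquiv H).symm _)) = 0
      rw [LinearEquiv.apply_symm_apply, hmem]
      exact ⟨z, rfl⟩
    refine ⟨ModuleCat.ofHom i', ModuleCat.ofHom q', ?_, ?_, ?_⟩
    · exact ModuleCat.hom_ext (LinearMap.ext hz)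
    · refine ShortComplex.ShortExact.mk' ?_ ?_ ?_
      · rw [ShortComplex.moduleCat_exact_iff]
        intro x hx
        obtain ⟨z, hz⟩ := (hmem _).1 (show q ((modEquiv H) x) = 0 from hx)
        refine ⟨z, (hi' z).trans ?_⟩
        rw [hz, LinearEquiv.symm_apply_apply]
      · refine (ModuleCat.mono_iff_injective _).2 ((injective_iff_map_eq_zero i').2 fun z hz => ?_)
        rw [hi', LinearEquiv.map_eq_zero_iff] at hz
        have h1 : z * (p : ℤ_[p]) ^ k = 0 := congrArg Prod.fst hz
        exact (mul_eq_zero.1 h1).resolve_right (pow_ne_zero _ PadicInt.prime_p.ne_zero)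
      · exact (ModuleCat.epi_iff_surjective _).2 (hqs.comp (modEquiv H).surjective)
    · refine extClass_eq_charExt _ τ χ (fun z => ?_) fun x => ?_
      · change ((modEquiv H) (i' z)).1 • ((p : ℚ_[p]) ^ k)⁻¹ = z
        rw [hi', LinearEquiv.apply_symm_apply]
        change (z * (p : ℤ_[p]) ^ k) • ((p : ℚ_[p]) ^ k)⁻¹ = z
        rw [Algebra.smul_def, PadicInt.algebraMap_apply]
        push_cast
        field_simp
      · change χ (q ((modEquiv H) x)) = _
        rw [hq.apply_eq]
        exact (map_smul (padicLattice p).mkQ _ _).symm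

/-- The random operator `d*` in terms of characters: the middle term of a random extension of `G`
is `ℤ_p × ker χ`, for a random character `χ` of `G`. -/
theorem probDStar_eq (G : X₀ p) (H : X₁ p) :
    probDStar G H = (Nat.card {χ : G.grp →ₗ[ℤ_[p]] Prufer p //
      toX₀ p (LinearMap.ker χ) = torsionClass H} : ℝ) / cardGrp G := by
  let e := Equiv.ofBijective _ (charExt_bijective (p := p) G.grp)
  have h1 : Nat.card (Abelian.Ext (ModuleCat.of ℤ_[p] G.grp) (ModuleCat.of ℤ_[p] ℤ_[p]) 1)
      = cardGrp G := (Nat.card_congr e.symm).trans (card_hom_prufer G.grp)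
  have h2 : Nat.card {x : Abelian.Ext (ModuleCat.of ℤ_[p] G.grp) (ModuleCat.of ℤ_[p] ℤ_[p]) 1 //
      IsExtensionClassWithMiddle G H x} = Nat.card {χ : G.grp →ₗ[ℤ_[p]] Prufer p //
      toX₀ p (LinearMap.ker χ) = torsionClass H} :=
    (Nat.card_congr (e.subtypeEquiv fun χ => isExtensionClassWithMiddle_charExt_iff.symm)).symm
  rw [probDStar, h1, h2]

/-! ### Haar measure of rank one modules -/

/-- If every point of `A` lies in exactly `c` of the sets `S i`, and no other point lies in any of
them, then the measures of the `S i` sum to `c` times that of `A`. -/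
theorem measure_sum_eq_mul {α ι : Type*} [MeasurableSpace α] [Fintype ι] (μ : Measure α)
    {S : ι → Set α} (hS : ∀ i, MeasurableSet (S i)) {A : Set α} (hA : MeasurableSet A) {c : ℕ}
    (h1 : ∀ x ∈ A, Nat.card {i // x ∈ S i} = c) (h0 : ∀ x ∉ A, ∀ i, x ∉ S i) :
    ∑ i, μ (S i) = c * μ A := by
  classical
  have h : ∀ x, ∑ i, (S i).indicator (1 : α → ENNReal) x = A.indicator (fun _ => (c : ENNReal)) x := by
    intro x
    by_cases hx : x ∈ A
    · rw [Set.indicator_of_mem hx, ← h1 x hx, Nat.card_eq_fintype_card, Fintype.card_subtype,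
        Finset.card_filter, Nat.cast_sum]
      refine Finset.sum_congr rfl fun i _ => ?_
      by_cases hi : x ∈ S i <;> simp [hi]
    · rw [Set.indicator_of_notMem hx]
      exact Finset.sum_eq_zero fun i _ => Set.indicator_of_notMem (h0 x hx i) _
  calc ∑ i, μ (S i) = ∑ i, ∫⁻ x, (S i).indicator (1 : α → ENNReal) x ∂μ :=
        Finset.sum_congr rfl fun i _ => (lintegral_indicator_one (hS i)).symm
    _ = ∫⁻ x, ∑ i, (S i).indicator (1 : α → ENNReal) x ∂μ :=
        (lintegral_finsetSum _ fun i _ => measurable_one.indicator (hS i)).symm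
    _ = ∫⁻ x, A.indicator (fun _ => (c : ENNReal)) x ∂μ := lintegral_congr h
    _ = c * μ A := lintegral_indicator_const hA _

theorem continuousSMul_of_finite (F : Type*) [AddCommGroup F] [Module ℤ_[p] F] [Finite F]
    [TopologicalSpace F] [DiscreteTopology F] : ContinuousSMul ℤ_[p] F where
  continuous_smul := by
    rw [continuous_prod_of_discrete_right]
    intro x
    refine continuous_of_continuousAt_zero ((LinearMap.toSpanSingleton ℤ_[p] F x).toAddMonoidHom) ?_
    obtain ⟨n, hn⟩ := exists_pow_smul_eq_zero (p := p) F
    have hev : ∀ᶠ z : ℤ_[p] in nhds 0,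
        (LinearMap.toSpanSingleton ℤ_[p] F x).toAddMonoidHom z = 0 := by
      have hpos : (0 : ℝ) < (p : ℝ) ^ (-n : ℤ) :=
        zpow_pos (by exact_mod_cast (Fact.out : p.Prime).pos) _
      filter_upwards [Metric.ball_mem_nhds 0 hpos] with z hz
      rw [mem_ball_zero_iff] at hz
      obtain ⟨c, rfl⟩ := Ideal.mem_span_singleton.1
        ((PadicInt.norm_le_pow_iff_mem_span_pow z n).1 hz.le)
      change ((p : ℤ_[p]) ^ n * c) • x = 0
      rw [mul_comm, mul_smul, hn, smul_zero]
    refine ContinuousAt.congr (f := fun _ => 0) continuousAt_const ?_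
    exact hev.mono fun z hz => hz.symm

theorem isOpen_ker {F : Type*} [AddCommGroup F] [Module ℤ_[p] F] [Finite F] (H : X₁ p)
    (f : H.mod →ₗ[ℤ_[p]] F) : IsOpen (LinearMap.ker f : Set H.mod) := by
  let _ : TopologicalSpace F := ⊥
  have : DiscreteTopology F := ⟨rfl⟩
  have := continuousSMul_of_finite (p := p) F
  have hf : Continuous f := IsModuleTopology.continuous_of_linearMap f
  exact (isOpen_discrete ({0} : Set F)).preimage hf

theorem isOpen_submodule (H : X₁ p) (N : Submodule ℤ_[p] H.mod) [Finite (H.mod ⧸ N)] :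
    IsOpen (N : Set H.mod) := by
  rw [← N.ker_mkQ]
  exact isOpen_ker H N.mkQ

theorem haar_univ (H : X₁ p) : H.haar Set.univ = 1 :=
  Measure.addHaarMeasure_self (K₀ := (⊤ : TopologicalSpace.PositiveCompacts H.mod))

instance X₁.isAddHaarMeasure (H : X₁ p) : H.haar.IsAddHaarMeasure :=
  inferInstanceAs (Measure.addHaarMeasure ⊤).IsAddHaarMeasure

instance X₁.isProbabilityMeasure (H : X₁ p) : IsProbabilityMeasure H.haar := ⟨haar_univ H⟩

theorem haar_ker {F : Type*} [AddCommGroup F] [Module ℤ_[p] F] [Finite F] (H : X₁ p)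
    {f : H.mod →ₗ[ℤ_[p]] F} (hf : Function.Surjective f) :
    H.haar (LinearMap.ker f : Set H.mod) = (Nat.card F : ENNReal)⁻¹ := by
  have hindex : (LinearMap.ker f).toAddSubgroup.index = Nat.card F :=
    Nat.card_congr (f.quotKerEquivOfSurjective hf).toEquiv
  have hpos : 0 < Nat.card F := Nat.card_pos
  have : (LinearMap.ker f).toAddSubgroup.FiniteIndex := ⟨by rw [hindex]; exact hpos.ne'⟩
  have h := (LinearMap.ker f).toAddSubgroup.index_mul_measure (isOpen_ker H f).measurableSet H.haar
  rw [hindex, haar_univ] at h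
  exact ENNReal.eq_inv_of_mul_eq_one_left ((mul_comm _ _).trans h)

/-! ### Quotients of rank one modules by a random element -/

theorem span_unit_smul {M : Type*} [AddCommGroup M] [Module ℤ_[p] M] (u : ℤ_[p]ˣ) (x : M) :
    Submodule.span ℤ_[p] {(u : ℤ_[p]) • x} = Submodule.span ℤ_[p] {x} :=
  Submodule.span_singleton_smul_eq u.isUnit x

/-- Up to a unit, a vector of `ℤ_p × T` with nonzero first coordinate is of the form `(p^k, t)`. -/
theorem span_eq_span_pow {T : Type} [AddCommGroup T] [Module ℤ_[p] T] (u : ℤ_[p]ˣ) (k : ℕ) (t : T) :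
    Submodule.span ℤ_[p] {((u : ℤ_[p]) * (p : ℤ_[p]) ^ k, t)} =
      Submodule.span ℤ_[p] {((p : ℤ_[p]) ^ k, u⁻¹ • t)} := by
  rw [← span_unit_smul u ((p : ℤ_[p]) ^ k, u⁻¹ • t)]
  congr 2
  refine Prod.ext rfl ?_
  change t = u • u⁻¹ • t
  rw [smul_inv_smul]

/-- The event that the quotient of `H` by a random element is isomorphic to `G`. -/
def quotientEvent (H : X₁ p) (G : X₀ p) : Set H.mod :=
  {h | Nonempty ((H.mod ⧸ Submodule.span ℤ_[p] {h}) ≃ₗ[ℤ_[p]] G.grp)}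

/-- The quotient by `h`, computed in the splitting `ℤ_p × T`. -/
def quotientSplitEquiv (H : X₁ p) (h : H.mod) : (H.mod ⧸ Submodule.span ℤ_[p] {h}) ≃ₗ[ℤ_[p]]
    ((ℤ_[p] × (torsionClass H).grp) ⧸ Submodule.span ℤ_[p] {modEquiv H h}) :=
  Submodule.Quotient.equiv _ _ (modEquiv H) (by
    rw [Submodule.map_span, Set.image_singleton]
    rfl)

theorem finite_quotient_of_ne (H : X₁ p) {h : H.mod} (h0 : (modEquiv H h).1 ≠ 0) :
    Finite (H.mod ⧸ Submodule.span ℤ_[p] {h}) := by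
  have := finite_prod_quotient h0 (modEquiv H h).2
  exact Finite.of_equiv _ (quotientSplitEquiv H h).symm.toEquiv

/-- If the first coordinate of `h` vanishes, then the infinite module `ℤ_p` is a quotient of
`H / h`. -/
theorem ne_of_mem_quotientEvent {H : X₁ p} {G : X₀ p} {h : H.mod} (hh : h ∈ quotientEvent H G) :
    (modEquiv H h).1 ≠ 0 := by
  intro h0
  obtain ⟨e⟩ := hh
  have hfin : Finite (H.mod ⧸ Submodule.span ℤ_[p] {h}) := Finite.of_equiv _ e.symm.toEquiv
  let f : H.mod →ₗ[ℤ_[p]] ℤ_[p] := LinearMap.fst ℤ_[p] ℤ_[p] (torsionClass H).grp ∘ₗ (modEquiv H).toLinearMap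
  have hf : Function.Surjective f :=
    (LinearMap.fst_surjective (R := ℤ_[p])).comp (modEquiv H).surjective
  have hle : Submodule.span ℤ_[p] {h} ≤ LinearMap.ker f := by
    rw [Submodule.span_le, Set.singleton_subset_iff]
    exact h0
  have : Finite ℤ_[p] := Finite.of_surjective ((Submodule.span ℤ_[p] {h}).liftQ f hle) fun z => by
    obtain ⟨x, rfl⟩ := hf z
    exact ⟨Submodule.Quotient.mk x, Submodule.liftQ_apply _ _ _⟩
  exact not_finite ℤ_[p]

/-- Nearby vectors span the same line: `h + c p h` is a unit multiple of `h`, and the multiples of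
`p h` form an open subgroup. -/
theorem isOpen_quotientEvent (H : X₁ p) (G : X₀ p) : IsOpen (quotientEvent H G) := by
  rw [isOpen_iff_mem_nhds]
  intro h hh
  have h0 : (modEquiv H ((p : ℤ_[p]) • h)).1 ≠ 0 := by
    rw [map_smul]
    exact mul_ne_zero PadicInt.prime_p.ne_zero (ne_of_mem_quotientEvent hh)
  have := finite_quotient_of_ne H h0
  have ho := isOpen_submodule H (Submodule.span ℤ_[p] {(p : ℤ_[p]) • h})
  have ho' : IsOpen ((fun x => -h + x) ⁻¹'
      (Submodule.span ℤ_[p] {(p : ℤ_[p]) • h} : Set H.mod)) :=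
    ho.preimage (continuous_const.add continuous_id)
  refine Filter.mem_of_superset (ho'.mem_nhds (by simp)) fun x hx => ?_
  obtain ⟨c, hc⟩ := Submodule.mem_span_singleton.1 hx
  have hu : IsUnit (1 + (p : ℤ_[p]) * c) := by
    have hn : ¬ IsUnit (-((p : ℤ_[p]) * c)) := fun hu =>
      PadicInt.prime_p.not_isUnit (isUnit_of_mul_isUnit_left (IsUnit.neg_iff _ |>.1 hu))
    have := IsLocalRing.isUnit_one_sub_self_of_mem_nonunits _ hn
    simpa using this
  obtain ⟨u, hu⟩ := hu
  have hx' : x = (u : ℤ_[p]) • h := by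
    have hc' : c • (p : ℤ_[p]) • h = -h + x := hc
    rw [hu, add_smul, one_smul, mul_comm, mul_smul, hc', add_neg_cancel_left]
  change Nonempty ((H.mod ⧸ Submodule.span ℤ_[p] {x}) ≃ₗ[ℤ_[p]] G.grp)
  rw [hx', span_unit_smul]
  exact hh

theorem measurableSet_quotientEvent (H : X₁ p) (G : X₀ p) : MeasurableSet (quotientEvent H G) :=
  (isOpen_quotientEvent H G).measurableSet

theorem mem_quotientEvent_iff {H : X₁ p} {G : X₀ p} {h : H.mod} {u : ℤ_[p]ˣ} {k : ℕ}
    (hu : (modEquiv H h).1 = u * (p : ℤ_[p]) ^ k) :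
    h ∈ quotientEvent H G ↔ toX₀ p ((ℤ_[p] × (torsionClass H).grp) ⧸
      Submodule.span ℤ_[p] {((p : ℤ_[p]) ^ k, u⁻¹ • (modEquiv H h).2)}) = G := by
  have hspan : Submodule.span ℤ_[p] {modEquiv H h} =
      Submodule.span ℤ_[p] {((p : ℤ_[p]) ^ k, u⁻¹ • (modEquiv H h).2)} := by
    rw [← span_eq_span_pow u k, ← hu]
  rw [toX₀_eq_iff]
  have e := (quotientSplitEquiv H h).trans (Submodule.quotEquivOfEq _ _ hspan)
  exact ⟨fun ⟨f⟩ => ⟨e.symm.trans f⟩, fun ⟨f⟩ => ⟨e.trans f⟩⟩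

theorem cardGrp_of_mem_quotientEvent {H : X₁ p} {G : X₀ p} {h : H.mod}
    (hh : h ∈ quotientEvent H G) :
    ∃ (u : ℤ_[p]ˣ) (k : ℕ), (modEquiv H h).1 = u * (p : ℤ_[p]) ^ k ∧
      cardGrp G = p ^ k * cardGrp (torsionClass H) := by
  have h0 := ne_of_mem_quotientEvent hh
  refine ⟨_, _, PadicInt.unitCoeff_spec h0, ?_⟩
  rw [← (mem_quotientEvent_iff (PadicInt.unitCoeff_spec h0)).1 hh, cardGrp_toX₀,
    card_prod_quotient_pow]
  rfl

/-- The elements of `H` whose first coordinate in the splitting is divisible by `p^k`. -/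
def divisibleSet (H : X₁ p) (k : ℕ) : Set H.mod := {h | (p : ℤ_[p]) ^ k ∣ (modEquiv H h).1}

theorem measurableSet_divisibleSet (H : X₁ p) (k : ℕ) : MeasurableSet (divisibleSet H k) ∧
    H.haar (divisibleSet H k) = ((p : ENNReal) ^ k)⁻¹ := by
  have := finite_padicInt_quotient (pow_ne_zero k (PadicInt.prime_p (p := p)).ne_zero)
  let f : H.mod →ₗ[ℤ_[p]] ℤ_[p] ⧸ Ideal.span {(p : ℤ_[p]) ^ k} :=
    Submodule.mkQ _ ∘ₗ LinearMap.fst ℤ_[p] ℤ_[p] (torsionClass H).grp ∘ₗ (modEquiv H).toLinearMap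
  have hf : Function.Surjective f := (Submodule.mkQ_surjective _).comp
    ((LinearMap.fst_surjective (R := ℤ_[p])).comp (modEquiv H).surjective)
  have hker : divisibleSet H k = (LinearMap.ker f : Set H.mod) := by
    ext h
    change _ ↔ (Submodule.Quotient.mk (modEquiv H h).1 : ℤ_[p] ⧸ Ideal.span {(p : ℤ_[p]) ^ k}) = 0
    rw [Submodule.Quotient.mk_eq_zero, Ideal.mem_span_singleton]
    rfl
  rw [hker]
  refine ⟨(isOpen_ker H f).measurableSet, ?_⟩
  rw [haar_ker H hf, card_padicInt_quotient_pow, Nat.cast_pow]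

theorem haar_divisibleSet_sdiff (H : X₁ p) (k : ℕ) :
    H.haar (divisibleSet H k \ divisibleSet H (k + 1)) =
      ((p : ENNReal) ^ k)⁻¹ - ((p : ENNReal) ^ (k + 1))⁻¹ := by
  have hsub : divisibleSet H (k + 1) ⊆ divisibleSet H k := fun h hh =>
    (pow_dvd_pow _ (Nat.le_succ k)).trans hh
  rw [measure_sdiff hsub (measurableSet_divisibleSet H (k + 1)).1.nullMeasurableSet (measure_ne_top _ _),
    (measurableSet_divisibleSet H k).2, (measurableSet_divisibleSet H (k + 1)).2]

theorem mem_divisibleSet_sdiff_iff {H : X₁ p} {h : H.mod} {k : ℕ} :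
    h ∈ divisibleSet H k \ divisibleSet H (k + 1) ↔
      ∃ u : ℤ_[p]ˣ, (modEquiv H h).1 = u * (p : ℤ_[p]) ^ k := by
  have hp : (p : ℤ_[p]) ^ k ≠ 0 := pow_ne_zero _ PadicInt.prime_p.ne_zero
  constructor
  · rintro ⟨⟨c, hc⟩, h2⟩
    have hu : IsUnit c := by
      by_contra hn
      have hlt := PadicInt.not_isUnit_iff.1 hn
      rw [PadicInt.norm_lt_one_iff_dvd] at hlt
      refine h2 ?_
      change (p : ℤ_[p]) ^ (k + 1) ∣ (modEquiv H h).1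
      rw [hc, pow_succ]
      exact mul_dvd_mul_left _ hlt
    obtain ⟨u, rfl⟩ := hu
    exact ⟨u, by rw [hc, mul_comm]⟩
  · rintro ⟨u, hu⟩
    refine ⟨Dvd.intro_left _ hu.symm, fun h2 => ?_⟩
    obtain ⟨c, hc⟩ : (p : ℤ_[p]) ^ (k + 1) ∣ (modEquiv H h).1 := h2
    rw [hu, pow_succ, mul_assoc, mul_comm] at hc
    have h3 := mul_left_cancel₀ hp hc
    exact PadicInt.prime_p.not_isUnit (isUnit_of_dvd_unit (h3 ▸ dvd_mul_right _ _) u.isUnit)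

/-- The law of the quotient of `ℤ_p × T` by a random element: with first coordinate `p^k` up to a
unit, the class of the quotient depends on a uniformly random `t ∈ T` only. The average over the
translates by `T` replaces a disintegration of Haar measure. -/
theorem cardGrp_mul_haar_quotientEvent {H : X₁ p} {G : X₀ p} {k : ℕ}
    (hc : cardGrp G = p ^ k * cardGrp (torsionClass H)) :
    cardGrp (torsionClass H) * H.haar (quotientEvent H G) =
      Nat.card {t : (torsionClass H).grp // toX₀ p ((ℤ_[p] × (torsionClass H).grp) ⧸
        Submodule.span ℤ_[p] {((p : ℤ_[p]) ^ k, t)}) = G} *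
        (((p : ENNReal) ^ k)⁻¹ - ((p : ENNReal) ^ (k + 1))⁻¹) := by
  have := Fintype.ofFinite (torsionClass H).grp
  let v : (torsionClass H).grp → H.mod := fun t => (modEquiv H).symm (0, t)
  have hv : ∀ t h, modEquiv H (v t + h) = ((modEquiv H h).1, t + (modEquiv H h).2) := fun t h => by
    rw [map_add, LinearEquiv.apply_symm_apply]
    exact Prod.ext (zero_add _) rfl
  have hp : (p : ℤ_[p]) ≠ 0 := PadicInt.prime_p.ne_zero
  have hTpos : 0 < cardGrp (torsionClass H) := cardGrp_pos _
  have hsum := measure_sum_eq_mul (H.haar)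
    (S := fun t : (torsionClass H).grp => (fun h => v t + h) ⁻¹' quotientEvent H G)
    (fun t => (measurable_const_add (v t)) (measurableSet_quotientEvent H G))
    ((measurableSet_divisibleSet H k).1.diff (measurableSet_divisibleSet H (k + 1)).1)
    (c := Nat.card {t : (torsionClass H).grp // toX₀ p ((ℤ_[p] × (torsionClass H).grp) ⧸
        Submodule.span ℤ_[p] {((p : ℤ_[p]) ^ k, t)}) = G}) ?_ ?_
  · rw [haar_divisibleSet_sdiff] at hsum
    rw [← hsum]
    rw [Finset.sum_congr rfl fun t _ => measure_preimage_add H.haar (v t) _, Finset.sum_const,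
      Finset.card_univ, nsmul_eq_mul, ← Nat.card_eq_fintype_card]
    rfl
  · intro h hh
    obtain ⟨u, hu⟩ := mem_divisibleSet_sdiff_iff.1 hh
    have hiff : ∀ t, h ∈ (fun h => v t + h) ⁻¹' quotientEvent H G ↔
        toX₀ p ((ℤ_[p] × (torsionClass H).grp) ⧸ Submodule.span ℤ_[p]
          {((p : ℤ_[p]) ^ k, u⁻¹ • (t + (modEquiv H h).2))}) = G := fun t => by
      have hu' : (modEquiv H (v t + h)).1 = u * (p : ℤ_[p]) ^ k := by rw [hv, hu]
      change v t + h ∈ quotientEvent H G ↔ _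
      rw [mem_quotientEvent_iff hu', hv]
    exact Nat.card_congr (((Equiv.addRight (modEquiv H h).2).trans
      (MulAction.toPerm u⁻¹)).subtypeEquiv hiff)
  · intro h hh t ht
    refine hh ?_
    obtain ⟨u, j, hu, hj⟩ := cardGrp_of_mem_quotientEvent ht
    have hkj : k = j := by
      rw [hc] at hj
      exact Nat.pow_right_injective (Fact.out : p.Prime).two_le
        (Nat.eq_of_mul_eq_mul_right hTpos hj)
    rw [hv] at hu
    exact mem_divisibleSet_sdiff_iff.2 ⟨u, hkj ▸ hu⟩

theorem quotientEvent_eq_empty {H : X₁ p} {G : X₀ p}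
    (hc : ∀ k, cardGrp G ≠ p ^ k * cardGrp (torsionClass H)) : quotientEvent H G = ∅ := by
  refine Set.eq_empty_of_forall_notMem fun h hh => ?_
  obtain ⟨u, k, -, hk⟩ := cardGrp_of_mem_quotientEvent hh
  exact hc k hk

theorem pairwise_disjoint_quotientEvent (H : X₁ p) :
    Pairwise (Function.onFun Disjoint (quotientEvent H)) := by
  intro G G' hne
  refine Set.disjoint_left.2 fun h ⟨e⟩ ⟨e'⟩ => hne ?_
  rw [← toX₀_grp G]
  exact toX₀_eq_iff.2 ⟨e.symm.trans e'⟩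

/-- Almost every element of a rank one module has finite quotient. -/
theorem haar_compl_iUnion_quotientEvent (H : X₁ p) :
    H.haar (⋃ G : X₀ p, quotientEvent H G)ᶜ = 0 := by
  have hle : ∀ k, H.haar (⋃ G : X₀ p, quotientEvent H G)ᶜ ≤ ((p : ENNReal)⁻¹) ^ k := fun k => by
    rw [← ENNReal.inv_pow, ← (measurableSet_divisibleSet H k).2]
    refine measure_mono fun h hh => ?_
    by_cases h0 : (modEquiv H h).1 = 0
    · change (p : ℤ_[p]) ^ k ∣ (modEquiv H h).1
      rw [h0]
      exact dvd_zero _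
    · refine absurd (Set.mem_iUnion.2 ?_) hh
      have := finite_quotient_of_ne H h0
      exact ⟨toX₀ p (H.mod ⧸ Submodule.span ℤ_[p] {h}), ⟨toX₀Equiv p _⟩⟩
  have hlim := ENNReal.tendsto_pow_atTop_nhds_zero_of_lt_one
    (r := (p : ENNReal)⁻¹) (ENNReal.inv_lt_one.2 (by exact_mod_cast (Fact.out : p.Prime).one_lt))
  exact le_antisymm (ge_of_tendsto' hlim hle) zero_le

/-- The expected number of surjections from the quotient by a random element: a surjection from `H`
to `F` factors through the quotient with probability `1 / #F`. -/
theorem tsum_haar_mul_cardSur (H : X₁ p) (F : X₀ p) :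
    ∑' G : X₀ p, H.haar (quotientEvent H G) * cardSur G F =
      numSur p H.mod F.grp * (cardGrp F : ENNReal)⁻¹ := by
  have : Finite (H.mod →ₗ[ℤ_[p]] F.grp) := LinearMap.finite_of_fg
  have := Fintype.ofFinite {f : H.mod →ₗ[ℤ_[p]] F.grp // Function.Surjective f}
  have hmeas : ∀ (f : {f : H.mod →ₗ[ℤ_[p]] F.grp // Function.Surjective f}) (G : X₀ p),
      MeasurableSet ((LinearMap.ker f.1 : Set H.mod) ∩ quotientEvent H G) := fun f G =>
    (isOpen_ker H f.1).measurableSet.inter (measurableSet_quotientEvent H G)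
  have h1 : ∀ G : X₀ p, H.haar (quotientEvent H G) * cardSur G F =
      ∑ f : {f : H.mod →ₗ[ℤ_[p]] F.grp // Function.Surjective f},
        H.haar ((LinearMap.ker f.1 : Set H.mod) ∩ quotientEvent H G) := fun G => by
    rw [mul_comm]
    refine (measure_sum_eq_mul H.haar (fun f => hmeas f G) (measurableSet_quotientEvent H G)
      (fun h hh => ?_) fun h hh f hf => hh hf.2).symm
    obtain ⟨e⟩ := id hh
    have h2 : cardSur G F = numSur p (H.mod ⧸ Submodule.span ℤ_[p] {h}) F.grp :=
      numSur_congr e.symm (LinearEquiv.refl _ _)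
    rw [h2, numSur]
    refine Nat.card_congr (Equiv.ofBijective (fun f => ⟨(Submodule.span ℤ_[p] {h}).liftQ f.1.1 ?_,
      fun y => ?_⟩) ⟨fun f g hfg => ?_, fun g => ⟨⟨⟨g.1 ∘ₗ Submodule.mkQ _,
        g.2.comp (Submodule.mkQ_surjective _)⟩, ?_, hh⟩, ?_⟩⟩)
    · rw [Submodule.span_le, Set.singleton_subset_iff]
      exact f.2.1
    · obtain ⟨x, rfl⟩ := f.1.2 y
      exact ⟨Submodule.Quotient.mk x, Submodule.liftQ_apply _ _ _⟩
    · refine Subtype.ext (Subtype.ext ?_)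
      have h3 := congrArg (fun q => q ∘ₗ Submodule.mkQ _) (congrArg Subtype.val hfg)
      simpa only [Submodule.liftQ_mkQ] using h3
    · change g.1 (Submodule.mkQ _ h) = 0
      have : Submodule.mkQ (Submodule.span ℤ_[p] {h}) h = 0 :=
        (Submodule.Quotient.mk_eq_zero _).2 (Submodule.mem_span_singleton_self h)
      rw [this, map_zero]
    · refine Subtype.ext ((LinearMap.cancel_right (Submodule.mkQ_surjective _)).1 ?_)
      exact Submodule.liftQ_mkQ _ _ _
  have h2 : ∀ f : {f : H.mod →ₗ[ℤ_[p]] F.grp // Function.Surjective f},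
      ∑' G : X₀ p, H.haar ((LinearMap.ker f.1 : Set H.mod) ∩ quotientEvent H G) =
        (cardGrp F : ENNReal)⁻¹ := fun f => by
    rw [← measure_iUnion (fun G G' hne => ((pairwise_disjoint_quotientEvent H hne).mono
      Set.inter_subset_right Set.inter_subset_right)) (hmeas f), ← Set.inter_iUnion]
    have h3 : H.haar ((LinearMap.ker f.1 : Set H.mod) ∩ ⋃ G : X₀ p, quotientEvent H G) =
        H.haar (LinearMap.ker f.1 : Set H.mod) :=
      measure_inter_conull (haar_compl_iUnion_quotientEvent H)
    rw [h3]
    exact haar_ker H f.2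
  rw [tsum_congr h1, Summable.tsum_finsetSum (fun _ _ => ENNReal.summable),
    Finset.sum_congr rfl fun f _ => h2 f, Finset.sum_const, nsmul_eq_mul, Finset.card_univ,
    ← Nat.card_eq_fintype_card]
  rfl

/-! ### Surjections from a random extension -/

section
variable {G F : Type} [AddCommGroup G] [Module ℤ_[p] G] [AddCommGroup F] [Module ℤ_[p] F]

/-- The middle term `{(g, y) ∈ G × ℚ_p | χ g = [y]}` of the extension attached to `χ`. -/
def charPullback (χ : G →ₗ[ℤ_[p]] Prufer p) : Submodule ℤ_[p] (G × ℚ_[p]) :=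
  LinearMap.ker (χ ∘ₗ LinearMap.fst ℤ_[p] G ℚ_[p] -
    (padicLattice p).mkQ ∘ₗ LinearMap.snd ℤ_[p] G ℚ_[p])

theorem mem_charPullback {χ : G →ₗ[ℤ_[p]] Prufer p} {x : G × ℚ_[p]} :
    x ∈ charPullback χ ↔ χ x.1 = (padicLattice p).mkQ x.2 := by
  rw [charPullback, LinearMap.mem_ker, LinearMap.sub_apply, sub_eq_zero]
  rfl

theorem nonempty_equiv_charPullback [Finite G] (χ : G →ₗ[ℤ_[p]] Prufer p) :
    Nonempty ((ℤ_[p] × LinearMap.ker χ) ≃ₗ[ℤ_[p]] charPullback χ) := by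
  obtain ⟨k, q, hq, hqs⟩ := exists_isCharPresentation_of_equiv χ (LinearEquiv.refl _ _)
  have hp : ((p : ℚ_[p]) ^ k) ≠ 0 := pow_ne_zero _ (by exact_mod_cast (Fact.out : p.Prime).ne_zero)
  let τ : (ℤ_[p] × LinearMap.ker χ) →ₗ[ℤ_[p]] ℚ_[p] :=
    LinearMap.toSpanSingleton ℤ_[p] ℚ_[p] ((p : ℚ_[p]) ^ k)⁻¹ ∘ₗ LinearMap.fst ℤ_[p] _ _
  have hτ : ∀ x, τ x = (x.1 : ℚ_[p]) * ((p : ℚ_[p]) ^ k)⁻¹ := fun x =>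
    Algebra.smul_def (A := ℚ_[p]) x.1 _
  have hχ : ∀ x, χ (q x) = (padicLattice p).mkQ (τ x) := fun x =>
    (hq.apply_eq x).trans (map_smul (padicLattice p).mkQ _ _).symm
  refine ⟨LinearEquiv.ofBijective ((q.prod τ).codRestrict _ fun x => mem_charPullback.2 (hχ x))
    ⟨(injective_iff_map_eq_zero _).2 fun x hx => ?_, ?_⟩⟩
  · have h1 : q x = 0 := congrArg (fun y => y.1.1) hx
    have h2 : τ x = 0 := congrArg (fun y => y.1.2) hx
    have h3 : x.1 = 0 := by
      rw [hτ] at h2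
      simpa using (mul_eq_zero.1 h2).resolve_right (inv_ne_zero hp)
    have h4 : x = (0, x.2) := Prod.ext h3 rfl
    rw [h4] at h1 ⊢
    rw [hq.inj _ h1]
    rfl
  · rintro ⟨⟨g, y⟩, hy⟩
    have hy' : χ g = (padicLattice p).mkQ y := mem_charPullback.1 hy
    obtain ⟨x, rfl⟩ := hqs g
    rw [hχ, ← sub_eq_zero, ← map_sub, mkQ_prufer_eq_zero] at hy'
    obtain ⟨c, hc⟩ := hy'
    -- Correct the lift `x` by `c p^k` in the first coordinate, compensating in the kernel.
    obtain ⟨t, ht⟩ := hq.exists_of_ker (q (c * (p : ℤ_[p]) ^ k, 0)) (by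
      rw [hq.apply_eq]
      exact smul_pruferGen_eq_zero.2 (dvd_mul_left _ _))
    refine ⟨x - (c * (p : ℤ_[p]) ^ k, 0) + (0, t), Subtype.ext (Prod.ext ?_ ?_)⟩
    · change q (x - (c * (p : ℤ_[p]) ^ k, 0) + (0, t)) = q x
      rw [map_add, map_sub, ht, sub_add_cancel]
    · change τ (x - (c * (p : ℤ_[p]) ^ k, 0) + (0, t)) = y
      rw [map_add, map_sub, hτ (c * (p : ℤ_[p]) ^ k, 0), hτ (0, t)]
      push_cast
      rw [mul_assoc, mul_inv_cancel₀ hp, mul_one, hc]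
      simp

/-- The pushout of `ℤ_p → ℚ_p` along the map `ℤ_p → F` with value `x` at `1`. -/
abbrev padicPushout (x : F) : Type :=
  (ℚ_[p] × F) ⧸ Submodule.span ℤ_[p] {((1 : ℚ_[p]), x)}

theorem mk_padicPushout_eq_zero {x : F} {y : ℚ_[p]} {f : F} :
    (Submodule.Quotient.mk (y, f) : padicPushout x) = 0 ↔ ∃ c : ℤ_[p], (c : ℚ_[p]) = y ∧ c • x = f := by
  rw [Submodule.Quotient.mk_eq_zero, Submodule.mem_span_singleton]
  refine exists_congr fun c => ?_
  rw [Prod.ext_iff]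
  change (c • (1 : ℚ_[p]) = y ∧ c • x = f) ↔ _
  rw [Algebra.smul_def, mul_one, PadicInt.algebraMap_apply]

/-- The projection of the pushout to `ℚ_p / ℤ_p`. -/
def pushoutFst (x : F) : padicPushout (p := p) x →ₗ[ℤ_[p]] Prufer p :=
  (Submodule.span ℤ_[p] {((1 : ℚ_[p]), x)}).liftQ ((padicLattice p).mkQ ∘ₗ LinearMap.fst _ _ _) (by
    rw [Submodule.span_le, Set.singleton_subset_iff]
    exact mkQ_prufer_eq_zero.2 ⟨1, rfl⟩)

/-- The projection of the pushout to `F / x`. -/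
def pushoutSnd (x : F) : padicPushout (p := p) x →ₗ[ℤ_[p]] F ⧸ Submodule.span ℤ_[p] {x} :=
  (Submodule.span ℤ_[p] {((1 : ℚ_[p]), x)}).liftQ
    ((Submodule.span ℤ_[p] {x}).mkQ ∘ₗ LinearMap.snd _ _ _) (by
    rw [Submodule.span_le, Set.singleton_subset_iff]
    exact (Submodule.Quotient.mk_eq_zero _).2 (Submodule.mem_span_singleton_self x))

theorem pushoutFst_mk (x : F) (y : ℚ_[p]) (f : F) :
    pushoutFst x (Submodule.Quotient.mk (y, f)) = (padicLattice p).mkQ y := rfl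

theorem pushoutSnd_mk (x : F) (y : ℚ_[p]) (f : F) :
    pushoutSnd (p := p) x (Submodule.Quotient.mk (y, f)) = (Submodule.span ℤ_[p] {x}).mkQ f := rfl

/-- The kernel of the projection to `F / x` is a copy of the injective module `ℚ_p / ℤ_p`, so the
pushout splits. -/
theorem nonempty_equiv_pushout [Finite F] (x : F) :
    ∃ e : padicPushout (p := p) x ≃ₗ[ℤ_[p]] Prufer p × (F ⧸ Submodule.span ℤ_[p] {x}),
      ∀ d, (e d).2 = pushoutSnd x d := by
  obtain ⟨n, hn⟩ : ∃ n : ℕ, LinearMap.ker (LinearMap.toSpanSingleton ℤ_[p] F x) =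
      Ideal.span {(p : ℤ_[p]) ^ n} := by
    refine PadicInt.ideal_eq_span_pow_p fun hb => ?_
    obtain ⟨n, hn⟩ := exists_pow_smul_eq_zero (p := p) F
    have : (p : ℤ_[p]) ^ n ∈ LinearMap.ker (LinearMap.toSpanSingleton ℤ_[p] F x) := hn x
    rw [hb, Submodule.mem_bot] at this
    exact pow_ne_zero _ PadicInt.prime_p.ne_zero this
  have hn' : ∀ c : ℤ_[p], c • x = 0 ↔ (p : ℤ_[p]) ^ n ∣ c := fun c => by
    rw [← Ideal.mem_span_singleton, ← hn]
    rfl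
  have hp : ((p : ℚ_[p]) ^ n) ≠ 0 := pow_ne_zero _ (by exact_mod_cast (Fact.out : p.Prime).ne_zero)
  let j₀ : ℚ_[p] →ₗ[ℤ_[p]] padicPushout (p := p) x :=
    Submodule.mkQ _ ∘ₗ LinearMap.inl ℤ_[p] ℚ_[p] F ∘ₗ LinearMap.lsmul ℤ_[p] ℚ_[p] ((p : ℤ_[p]) ^ n)
  have hj₀ : ∀ y, j₀ y = Submodule.Quotient.mk ((p : ℚ_[p]) ^ n * y, 0) := fun y => by
    change Submodule.Quotient.mk ((p : ℤ_[p]) ^ n • y, (0 : F)) = _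
    rw [Algebra.smul_def, PadicInt.algebraMap_apply]
    push_cast
    rfl
  have hker : ∀ y, j₀ y = 0 ↔ y ∈ padicLattice p := fun y => by
    rw [hj₀, mk_padicPushout_eq_zero]
    constructor
    · rintro ⟨c, hc, hx⟩
      obtain ⟨d, rfl⟩ := (hn' c).1 hx
      push_cast at hc
      exact ⟨d, mul_left_cancel₀ hp hc⟩
    · rintro ⟨d, rfl⟩
      refine ⟨(p : ℤ_[p]) ^ n * d, ?_, (hn' _).2 (dvd_mul_right _ _)⟩
      push_cast
      rfl
  let j : Prufer p →ₗ[ℤ_[p]] padicPushout (p := p) x :=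
    (padicLattice p).liftQ j₀ fun y hy => (hker y).2 hy
  have hj : Function.Injective j := by
    rw [injective_iff_map_eq_zero]
    intro w hw
    obtain ⟨y, rfl⟩ := (padicLattice p).mkQ_surjective w
    exact (Submodule.Quotient.mk_eq_zero _).2 ((hker y).1 hw)
  have hjs : ∀ w, pushoutSnd x (j w) = 0 := fun w => by
    obtain ⟨y, rfl⟩ := (padicLattice p).mkQ_surjective w
    change pushoutSnd x (j₀ y) = 0
    rw [hj₀, pushoutSnd_mk, map_zero]
  have hrange : ∀ d, pushoutSnd x d = 0 → ∃ w, j w = d := fun d hd => by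
    obtain ⟨⟨y, f⟩, rfl⟩ := Submodule.mkQ_surjective _ d
    obtain ⟨c, rfl⟩ := Submodule.mem_span_singleton.1 ((Submodule.Quotient.mk_eq_zero _).1 hd)
    refine ⟨(padicLattice p).mkQ (((p : ℚ_[p]) ^ n)⁻¹ * (y - c)), ?_⟩
    change j₀ _ = Submodule.Quotient.mk _
    rw [hj₀, mul_inv_cancel_left₀ hp, ← sub_eq_zero, ← Submodule.Quotient.mk_sub,
      Prod.mk_sub_mk, mk_padicPushout_eq_zero]
    exact ⟨-c, by push_cast; ring, by simp⟩
  obtain ⟨r, hr⟩ := baer_prufer.extension_property j hj LinearMap.id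
  have hr' : ∀ w, r (j w) = w := LinearMap.congr_fun hr
  have hsnd : Function.Surjective (pushoutSnd (p := p) x) := fun c => by
    obtain ⟨f, rfl⟩ := Submodule.mkQ_surjective _ c
    exact ⟨Submodule.Quotient.mk (0, f), rfl⟩
  refine ⟨LinearEquiv.ofBijective (r.prod (pushoutSnd x))
    ⟨(injective_iff_map_eq_zero _).2 fun d hd => ?_, ?_⟩, fun d => rfl⟩
  · obtain ⟨w, rfl⟩ := hrange d (congrArg Prod.snd hd)
    have h1 : r (j w) = 0 := congrArg Prod.fst hd
    rw [hr'] at h1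
    rw [h1, map_zero]
  · rintro ⟨w, c⟩
    obtain ⟨d, rfl⟩ := hsnd c
    refine ⟨d + j (w - r d), Prod.ext ?_ ?_⟩
    · change r (d + j (w - r d)) = w
      rw [map_add, hr', add_sub_cancel]
    · change pushoutSnd x (d + j (w - r d)) = _
      rw [map_add, hjs, add_zero]

/-- As the pushout splits, a homomorphism into it is a character together with a homomorphism to
`F / x`. -/
theorem card_hom_pushout [Finite G] [Finite F] (x : F) :
    Nat.card {Ψ : G →ₗ[ℤ_[p]] padicPushout (p := p) x //
      Function.Surjective (pushoutSnd x ∘ₗ Ψ)} =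
    Nat.card G * numSur p G (F ⧸ Submodule.span ℤ_[p] {x}) := by
  obtain ⟨e, he⟩ := nonempty_equiv_pushout (p := p) x
  rw [← card_hom_prufer (p := p) G, numSur, ← Nat.card_prod]
  refine Nat.card_congr ⟨fun Ψ => (LinearMap.fst _ _ _ ∘ₗ e.toLinearMap ∘ₗ Ψ.1,
    ⟨pushoutSnd x ∘ₗ Ψ.1, Ψ.2⟩), fun a => ⟨e.symm.toLinearMap ∘ₗ a.1.prod a.2.1, ?_⟩,
    fun Ψ => ?_, fun a => ?_⟩
  · have : pushoutSnd x ∘ₗ e.symm.toLinearMap ∘ₗ a.1.prod a.2.1 = a.2.1 := LinearMap.ext fun g => by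
      change pushoutSnd x (e.symm _) = _
      rw [← he, e.apply_symm_apply]
      rfl
    rw [this]
    exact a.2.2
  · refine Subtype.ext (LinearMap.ext fun g => ?_)
    change e.symm ((e (Ψ.1 g)).1, pushoutSnd x (Ψ.1 g)) = Ψ.1 g
    rw [← he, Prod.mk.eta, e.symm_apply_apply]
  · refine Prod.ext (LinearMap.ext fun g => ?_) (Subtype.ext (LinearMap.ext fun g => ?_))
    · change (e (e.symm (a.1 g, a.2.1 g))).1 = a.1 g
      rw [e.apply_symm_apply]
    · change pushoutSnd x (e.symm (a.1 g, a.2.1 g)) = a.2.1 g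
      rw [← he, e.apply_symm_apply]

/-- The image of `1` under the inclusion of `ℤ_p` into the middle term of the extension. -/
def charPullbackOne (χ : G →ₗ[ℤ_[p]] Prufer p) : charPullback χ :=
  ⟨(0, 1), mem_charPullback.2 (by
    rw [map_zero]
    exact (mkQ_prufer_eq_zero.2 ⟨1, rfl⟩).symm)⟩

/-- Given a map from the middle term of the extension `χ` to `F` with value `x` at `1`, the map of
`G` to the pushout which sends `g` to the class of `(y, s (g, y))`. -/
theorem exists_hom_pushout {x : F} (χ : G →ₗ[ℤ_[p]] Prufer p) (s : charPullback χ →ₗ[ℤ_[p]] F)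
    (hs : s (charPullbackOne χ) = x) :
    ∃ Ψ : G →ₗ[ℤ_[p]] padicPushout (p := p) x,
      ∀ a : charPullback χ, Ψ a.1.1 = Submodule.Quotient.mk (a.1.2, s a) := by
  let q : charPullback χ →ₗ[ℤ_[p]] G := LinearMap.fst _ _ _ ∘ₗ (charPullback χ).subtype
  have hq : Function.Surjective q := fun g => by
    obtain ⟨y, hy⟩ := (padicLattice p).mkQ_surjective (χ g)
    exact ⟨⟨(g, y), mem_charPullback.2 hy.symm⟩, rfl⟩
  let f : charPullback χ →ₗ[ℤ_[p]] padicPushout (p := p) x :=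
    Submodule.mkQ _ ∘ₗ (LinearMap.snd _ _ _ ∘ₗ (charPullback χ).subtype).prod s
  refine LinearMap.exists_comp_eq_of_ker_le (f := f) hq fun a ha => ?_
  have ha' : a.1.1 = 0 := ha
  obtain ⟨z, hz⟩ : ∃ z : ℤ_[p], (z : ℚ_[p]) = a.1.2 := by
    rw [← mkQ_prufer_eq_zero, ← mem_charPullback.1 a.2, ha', map_zero]
  change (Submodule.Quotient.mk (a.1.2, s a) : padicPushout (p := p) x) = 0
  have ha2 : a = z • charPullbackOne χ := Subtype.ext (Prod.ext (by rw [ha']; simp [charPullbackOne])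
    (by
      rw [← hz]
      change _ = z • (1 : ℚ_[p])
      rw [Algebra.smul_def, mul_one, PadicInt.algebraMap_apply]))
  refine mk_padicPushout_eq_zero.2 ⟨z, hz, ?_⟩
  conv_rhs => rw [ha2]
  rw [map_smul, hs]

/-- A character `χ` with a map to `F` from the middle term of its extension, of value `x` at `1`, is
the same as a map from `G` to the pushout: `χ` is its projection to `ℚ_p / ℤ_p`. -/
theorem card_sigma_surjective_charPullback (x : F) :
    Nat.card (Σ χ : G →ₗ[ℤ_[p]] Prufer p, {s : charPullback χ →ₗ[ℤ_[p]] F //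
      Function.Surjective s ∧ s (charPullbackOne χ) = x}) =
    Nat.card {Ψ : G →ₗ[ℤ_[p]] padicPushout (p := p) x //
      Function.Surjective (pushoutSnd x ∘ₗ Ψ)} := by
  have hex : ∀ (χ : G →ₗ[ℤ_[p]] Prufer p) (g : G), ∃ y, (g, y) ∈ charPullback χ := fun χ g => by
    obtain ⟨y, hy⟩ := (padicLattice p).mkQ_surjective (χ g)
    exact ⟨y, mem_charPullback.2 hy.symm⟩
  have hsurj : ∀ (χ : G →ₗ[ℤ_[p]] Prufer p) (s : charPullback χ →ₗ[ℤ_[p]] F)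
      (_ : s (charPullbackOne χ) = x) (Ψ : G →ₗ[ℤ_[p]] padicPushout (p := p) x)
      (_ : ∀ a : charPullback χ, Ψ a.1.1 = Submodule.Quotient.mk (a.1.2, s a)),
      Function.Surjective s ↔ Function.Surjective (pushoutSnd x ∘ₗ Ψ) := by
    intro χ s hs Ψ hΨ
    have h1 : ∀ a : charPullback χ,
        pushoutSnd x (Ψ a.1.1) = (Submodule.span ℤ_[p] {x}).mkQ (s a) := fun a => by
      rw [hΨ, pushoutSnd_mk]
    constructor
    · intro h c
      obtain ⟨f, rfl⟩ := Submodule.mkQ_surjective _ c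
      obtain ⟨a, rfl⟩ := h f
      exact ⟨a.1.1, h1 a⟩
    · intro h f
      obtain ⟨g, hg⟩ := h ((Submodule.span ℤ_[p] {x}).mkQ f)
      obtain ⟨y, hy⟩ := hex χ g
      have h2 : (Submodule.span ℤ_[p] {x}).mkQ (f - s ⟨(g, y), hy⟩) = 0 := by
        rw [map_sub, ← h1 ⟨(g, y), hy⟩, sub_eq_zero]
        exact hg.symm
      obtain ⟨c, hc⟩ := Submodule.mem_span_singleton.1 ((Submodule.Quotient.mk_eq_zero _).1 h2)
      refine ⟨⟨(g, y), hy⟩ + c • charPullbackOne χ, ?_⟩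
      rw [map_add, map_smul, hs, hc, add_sub_cancel]
  refine Nat.card_congr (Equiv.ofBijective (fun a =>
    ⟨(exists_hom_pushout a.1 a.2.1 a.2.2.2).choose, (hsurj a.1 a.2.1 a.2.2.2 _
      (exists_hom_pushout a.1 a.2.1 a.2.2.2).choose_spec).1 a.2.2.1⟩) ⟨?_, ?_⟩)
  · rintro ⟨χ, s, hs⟩ ⟨χ', s', hs'⟩ h
    have h1 := (exists_hom_pushout χ s hs.2).choose_spec
    have h2 := (exists_hom_pushout χ' s' hs'.2).choose_spec
    have h3 : (exists_hom_pushout χ s hs.2).choose = (exists_hom_pushout χ' s' hs'.2).choose :=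
      congrArg Subtype.val h
    rw [h3] at h1
    obtain rfl : χ = χ' := LinearMap.ext fun g => by
      obtain ⟨y, hy⟩ := hex χ g
      obtain ⟨y', hy'⟩ := hex χ' g
      have h4 := congrArg (pushoutFst x) ((h1 ⟨(g, y), hy⟩).symm.trans (h2 ⟨(g, y'), hy'⟩))
      rw [pushoutFst_mk, pushoutFst_mk] at h4
      rw [mem_charPullback.1 hy, mem_charPullback.1 hy']
      exact h4
    congr 1
    refine Subtype.ext (LinearMap.ext fun a => ?_)
    have h4 := (h1 a).symm.trans (h2 a)
    rw [← sub_eq_zero, ← Submodule.Quotient.mk_sub, Prod.mk_sub_mk, sub_self,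
      mk_padicPushout_eq_zero] at h4
    obtain ⟨c, hc, hc'⟩ := h4
    have h5 : c = 0 := by simpa using hc
    rw [h5, zero_smul] at hc'
    exact sub_eq_zero.1 hc'.symm
  · rintro ⟨Ψ, hΨ⟩
    let χ := pushoutFst x ∘ₗ Ψ
    let j : F →ₗ[ℤ_[p]] padicPushout (p := p) x := Submodule.mkQ _ ∘ₗ LinearMap.inr _ _ _
    have hj : Function.Injective j := by
      rw [injective_iff_map_eq_zero]
      intro f hf
      obtain ⟨c, hc, hc'⟩ := mk_padicPushout_eq_zero.1 hf
      have h5 : c = 0 := by simpa using hc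
      have hc2 : c • x = f := hc'
      rw [← hc2, h5, zero_smul]
    let m : charPullback χ →ₗ[ℤ_[p]] padicPushout (p := p) x :=
      Ψ ∘ₗ LinearMap.fst _ _ _ ∘ₗ (charPullback χ).subtype -
        Submodule.mkQ _ ∘ₗ LinearMap.inl _ _ _ ∘ₗ LinearMap.snd _ _ _ ∘ₗ (charPullback χ).subtype
    have hm : ∀ a, m a = Ψ a.1.1 - Submodule.Quotient.mk (a.1.2, 0) := fun a => rfl
    have hmem : ∀ a, m a ∈ LinearMap.range j := fun a => by
      have h1 : pushoutFst x (Ψ a.1.1) = (padicLattice p).mkQ a.1.2 := mem_charPullback.1 a.2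
      obtain ⟨⟨y, f⟩, hyf⟩ := Submodule.mkQ_surjective _ (Ψ a.1.1)
      have hyf' : Ψ a.1.1 = Submodule.Quotient.mk (y, f) := hyf.symm
      rw [hyf', pushoutFst_mk, ← sub_eq_zero, ← map_sub, mkQ_prufer_eq_zero] at h1
      obtain ⟨z, hz⟩ := h1
      refine ⟨f - z • x, ?_⟩
      rw [hm, hyf']
      change Submodule.Quotient.mk (0, f - z • x) = _
      rw [← sub_eq_zero, ← Submodule.Quotient.mk_sub, ← Submodule.Quotient.mk_sub, Prod.mk_sub_mk,
        Prod.mk_sub_mk, mk_padicPushout_eq_zero]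
      exact ⟨-z, by push_cast; rw [hz]; ring, by simp⟩
    let s : charPullback χ →ₗ[ℤ_[p]] F :=
      (LinearEquiv.ofInjective j hj).symm.toLinearMap ∘ₗ m.codRestrict _ hmem
    have hjs : ∀ a, j (s a) = m a := fun a =>
      congrArg Subtype.val ((LinearEquiv.ofInjective j hj).apply_symm_apply ⟨m a, hmem a⟩)
    have hs : ∀ a : charPullback χ, Ψ a.1.1 = Submodule.Quotient.mk (a.1.2, s a) := fun a => by
      have h1 := hjs a
      rw [hm, eq_sub_iff_add_eq] at h1
      rw [← h1]
      change Submodule.Quotient.mk ((0, s a) + (a.1.2, 0)) = _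
      simp
    have hs1 : s (charPullbackOne χ) = x := by
      have h1 := hs (charPullbackOne χ)
      have h2 : Ψ (charPullbackOne χ).1.1 = 0 := map_zero Ψ
      rw [h2, eq_comm] at h1
      obtain ⟨c, hc, hc'⟩ := mk_padicPushout_eq_zero.1 h1
      have hc1 : (c : ℚ_[p]) = 1 := hc
      have h5 : c = 1 := Subtype.ext hc1
      rw [← hc', h5, one_smul]
    refine ⟨⟨χ, s, (hsurj χ s hs1 Ψ hs).2 hΨ, hs1⟩, Subtype.ext (LinearMap.ext fun g => ?_)⟩
    obtain ⟨y, hy⟩ := hex χ g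
    exact ((exists_hom_pushout χ s hs1).choose_spec ⟨(g, y), hy⟩).trans (hs ⟨(g, y), hy⟩).symm

/-- The mean number of surjections onto `F` from a random extension of `G` by `ℤ_p`. -/
theorem sum_numSur_prod_ker [Finite G] [Finite F] [Fintype (G →ₗ[ℤ_[p]] Prufer p)] [Fintype F] :
    ∑ χ : G →ₗ[ℤ_[p]] Prufer p, numSur p (ℤ_[p] × LinearMap.ker χ) F =
      Nat.card G * ∑ x : F, numSur p G (F ⧸ Submodule.span ℤ_[p] {x}) := by
  have hfin : ∀ χ : G →ₗ[ℤ_[p]] Prufer p, Finite (charPullback χ →ₗ[ℤ_[p]] F) := fun χ => by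
    obtain ⟨e⟩ := nonempty_equiv_charPullback χ
    have : Module.Finite ℤ_[p] (charPullback χ) := Module.Finite.equiv e
    exact LinearMap.finite_of_fg
  have h1 : ∀ χ : G →ₗ[ℤ_[p]] Prufer p, numSur p (ℤ_[p] × LinearMap.ker χ) F =
      ∑ x : F, Nat.card {s : charPullback χ →ₗ[ℤ_[p]] F //
        Function.Surjective s ∧ s (charPullbackOne χ) = x} := fun χ => by
    obtain ⟨e⟩ := nonempty_equiv_charPullback χ
    rw [numSur_congr e (LinearEquiv.refl _ F), numSur, ← Nat.card_sigma]
    exact Nat.card_congr ⟨fun s => ⟨s.1 (charPullbackOne χ), s.1, s.2, rfl⟩,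
      fun a => ⟨a.2.1, a.2.2.1⟩, fun s => rfl, fun ⟨x, s, hs, hx⟩ => by subst hx; rfl⟩
  rw [Finset.sum_congr rfl fun χ _ => h1 χ, Finset.sum_comm, Finset.mul_sum]
  refine Finset.sum_congr rfl fun x _ => ?_
  rw [← Nat.card_sigma, card_sigma_surjective_charPullback, card_hom_pushout]

end

/-! ### Detailed balance -/

/-- The reversing measure on `X₁`, up to normalization: `H = ℤ_p × T` has mass
`((1 - p⁻¹) #T #Aut T)⁻¹`. -/
def rankOneWeight (H : X₁ p) : ℝ :=
  ((1 - (p : ℝ)⁻¹) * cardGrp (torsionClass H) * cardAut (torsionClass H))⁻¹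

theorem one_sub_inv_pos : (0 : ℝ) < 1 - (p : ℝ)⁻¹ := by
  have : (1 : ℝ) < p := by exact_mod_cast (Fact.out : p.Prime).one_lt
  linarith [inv_lt_one_of_one_lt₀ this]

theorem rankOneWeight_pos (H : X₁ p) : 0 < rankOneWeight H := by
  have h1 : (0 : ℝ) < cardGrp (torsionClass H) := by exact_mod_cast cardGrp_pos _
  have h2 : (0 : ℝ) < cardAut (torsionClass H) := by exact_mod_cast cardAut_pos _
  have h3 := one_sub_inv_pos (p := p)
  rw [rankOneWeight]
  positivity

theorem probDStar_nonneg (G : X₀ p) (H : X₁ p) : 0 ≤ probDStar G H := by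
  rw [probDStar]
  positivity

theorem probD_nonneg (H : X₁ p) (G : X₀ p) : 0 ≤ probD H G := measureReal_nonneg

theorem probD_eq (H : X₁ p) (G : X₀ p) : probD H G = (H.haar (quotientEvent H G)).toReal := rfl

theorem ofReal_probD (H : X₁ p) (G : X₀ p) :
    ENNReal.ofReal (probD H G) = H.haar (quotientEvent H G) := by
  rw [probD_eq, ENNReal.ofReal_toReal (measure_ne_top _ _)]

/-- The kernels of `d*` and `d` are reverse to each other. Both sides vanish unless `#T` divides
`#G`, where `H = ℤ_p × T`. -/
theorem detailed_balance (G : X₀ p) (H : X₁ p) :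
    (cardAut G : ℝ)⁻¹ * probDStar G H = rankOneWeight H * probD H G := by
  by_cases hk : ∃ k, cardGrp G = p ^ k * cardGrp (torsionClass H)
  · obtain ⟨k, hk⟩ := hk
    have h1 := congrArg ENNReal.toReal (cardGrp_mul_haar_quotientEvent hk)
    have hp : (0 : ℝ) < p := by exact_mod_cast (Fact.out : p.Prime).pos
    have hp1 := one_sub_inv_pos (p := p)
    have hsub : (((p : ENNReal) ^ k)⁻¹ - ((p : ENNReal) ^ (k + 1))⁻¹).toReal =
        ((p : ℝ) ^ k)⁻¹ * (1 - (p : ℝ)⁻¹) := by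
      rw [ENNReal.toReal_sub_of_le]
      · simp only [ENNReal.toReal_inv, ENNReal.toReal_pow, ENNReal.toReal_natCast]
        rw [pow_succ, mul_inv]
        ring
      · rw [ENNReal.inv_le_inv]
        exact pow_le_pow_right₀ (by exact_mod_cast (Fact.out : p.Prime).one_le) (Nat.le_succ k)
      · rw [Ne, ENNReal.inv_eq_top]
        exact pow_ne_zero _ (by exact_mod_cast (Fact.out : p.Prime).ne_zero)
    rw [ENNReal.toReal_mul, ENNReal.toReal_mul, ← probD_eq, ENNReal.toReal_natCast,
      ENNReal.toReal_natCast, hsub] at h1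
    have h2 : (_ : ℝ) = _ := congrArg (Nat.cast (R := ℝ)) (card_quotient_mul_cardAut hk)
    have hk' : (cardGrp G : ℝ) = (p : ℝ) ^ k * cardGrp (torsionClass H) := by
      rw [hk]
      push_cast
      rfl
    push_cast at h2
    have hG : (0 : ℝ) < cardGrp G := by exact_mod_cast cardGrp_pos _
    have hA : (0 : ℝ) < cardAut G := by exact_mod_cast cardAut_pos _
    have hT : (0 : ℝ) < cardGrp (torsionClass H) := by exact_mod_cast cardGrp_pos _
    have hB : (0 : ℝ) < cardAut (torsionClass H) := by exact_mod_cast cardAut_pos _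
    rw [probDStar_eq, rankOneWeight, hk']
    set s : ℝ := (Nat.card {t : (torsionClass H).grp // toX₀ p ((ℤ_[p] × (torsionClass H).grp) ⧸
        Submodule.span ℤ_[p] {((p : ℤ_[p]) ^ k, t)}) = G} : ℝ)
    set c : ℝ := (Nat.card {χ : G.grp →ₗ[ℤ_[p]] Prufer p //
        toX₀ p (LinearMap.ker χ) = torsionClass H} : ℝ)
    have h3 : probD H G = s * (((p : ℝ) ^ k)⁻¹ * (1 - (p : ℝ)⁻¹)) / cardGrp (torsionClass H) := by
      rw [← h1]
      field_simp
    have h4 : s = c * (cardAut (torsionClass H) * cardGrp (torsionClass H)) / cardAut G := by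
      rw [← h2]
      field_simp
    rw [h3, h4]
    have hpk : (0 : ℝ) < (p : ℝ) ^ k := by positivity
    set q : ℝ := 1 - (p : ℝ)⁻¹
    field_simp
  · push Not at hk
    have h1 : Nat.card {χ : G.grp →ₗ[ℤ_[p]] Prufer p //
        toX₀ p (LinearMap.ker χ) = torsionClass H} = 0 := by
      refine Nat.card_eq_zero.2 (Or.inl ⟨fun ⟨χ, hχ⟩ => ?_⟩)
      have : Finite (LinearMap.range χ) := Finite.of_surjective _ χ.surjective_rangeRestrict
      obtain ⟨k, hr⟩ := exists_card_eq_pow (p := p) (LinearMap.range χ)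
      refine hk k ?_
      rw [← hr, ← hχ, cardGrp_toX₀]
      exact LinearMap.card_eq_card_range_mul_card_ker χ
    rw [probDStar_eq, h1, probD_eq, quotientEvent_eq_empty hk]
    simp

/-! ### Averages over the two kernels -/

/-- `1 / #Aut G`, as an extended nonnegative real. -/
def autWeight (G : X₀ p) : ENNReal := ENNReal.ofReal (cardAut G : ℝ)⁻¹

theorem autWeight_mul_probDStar (G : X₀ p) (H : X₁ p) :
    autWeight G * ENNReal.ofReal (probDStar G H) =
      ENNReal.ofReal (rankOneWeight H) * ENNReal.ofReal (probD H G) := by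
  rw [autWeight, ← ENNReal.ofReal_mul (by positivity), detailed_balance,
    ENNReal.ofReal_mul (rankOneWeight_pos H).le]

theorem autWeight_le_one (G : X₀ p) : autWeight G ≤ 1 := by
  rw [autWeight, ENNReal.ofReal_le_one]
  exact inv_le_one_of_one_le₀ (by exact_mod_cast cardAut_pos G)

theorem tsum_probDStar_mul (G : X₀ p) (f : X₁ p → ENNReal) [Fintype (G.grp →ₗ[ℤ_[p]] Prufer p)] :
    ∑' H, ENNReal.ofReal (probDStar G H) * f H =
      (cardGrp G : ENNReal)⁻¹ *
        ∑ χ : G.grp →ₗ[ℤ_[p]] Prufer p, f (splitX₁ p (LinearMap.ker χ)) := by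
  classical
  have hG : (0 : ℝ) < cardGrp G := by exact_mod_cast cardGrp_pos _
  have h1 : ∀ H, ENNReal.ofReal (probDStar G H) * f H = ∑ χ : G.grp →ₗ[ℤ_[p]] Prufer p,
      if H = splitX₁ p (LinearMap.ker χ) then
        (cardGrp G : ENNReal)⁻¹ * f (splitX₁ p (LinearMap.ker χ)) else 0 := fun H => by
    have h2 : Nat.card {χ : G.grp →ₗ[ℤ_[p]] Prufer p // toX₀ p (LinearMap.ker χ) = torsionClass H}
        = ∑ χ : G.grp →ₗ[ℤ_[p]] Prufer p, if H = splitX₁ p (LinearMap.ker χ) then 1 else 0 := by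
      rw [← Finset.card_filter, ← Fintype.card_subtype, Nat.card_eq_fintype_card]
      exact Fintype.card_congr (Equiv.subtypeEquivRight fun χ =>
        splitX₁_eq_iff_torsionClass.symm.trans eq_comm)
    rw [probDStar_eq, div_eq_mul_inv, ENNReal.ofReal_mul (by positivity), ENNReal.ofReal_natCast,
      ENNReal.ofReal_inv_of_pos hG, ENNReal.ofReal_natCast, h2, Nat.cast_sum, Finset.sum_mul,
      Finset.sum_mul]
    refine Finset.sum_congr rfl fun χ _ => ?_
    split_ifs with h
    · rw [Nat.cast_one, one_mul, ← h]
    · rw [Nat.cast_zero, zero_mul, zero_mul]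
  rw [tsum_congr h1, Summable.tsum_finsetSum (fun _ _ => ENNReal.summable), Finset.mul_sum]
  exact Finset.sum_congr rfl fun χ _ => tsum_ite_eq _ _

theorem tsum_probDStar (G : X₀ p) : ∑' H, ENNReal.ofReal (probDStar G H) = 1 := by
  have := Fintype.ofFinite (G.grp →ₗ[ℤ_[p]] Prufer p)
  have h := tsum_probDStar_mul G fun _ => 1
  simp only [mul_one] at h
  rw [h, Finset.sum_const, Finset.card_univ, ← Nat.card_eq_fintype_card, card_hom_prufer,
    nsmul_eq_mul, mul_one]
  exact ENNReal.inv_mul_cancel (by exact_mod_cast (cardGrp_pos G).ne') (ENNReal.natCast_ne_top _)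

theorem tsum_probD (H : X₁ p) : ∑' G, ENNReal.ofReal (probD H G) = 1 := by
  rw [tsum_congr fun G => ofReal_probD H G, ← measure_iUnion (pairwise_disjoint_quotientEvent H)
    (measurableSet_quotientEvent H)]
  have hm : MeasurableSet (⋃ G : X₀ p, quotientEvent H G) :=
    MeasurableSet.iUnion (measurableSet_quotientEvent H)
  exact (prob_compl_eq_zero_iff hm).1 (haar_compl_iUnion_quotientEvent H)

theorem tsum_probD_mul_cardSur (H : X₁ p) (F : X₀ p) :
    ∑' G, ENNReal.ofReal (probD H G) * cardSur G F =
      numSur p H.mod F.grp * (cardGrp F : ENNReal)⁻¹ := by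
  simp only [ofReal_probD]
  exact tsum_haar_mul_cardSur H F

theorem tsum_probDStar_mul_numSur (G F : X₀ p) :
    ∑' H : X₁ p, ENNReal.ofReal (probDStar G H) * numSur p H.mod F.grp =
      ∑' x : F.grp, (cardSur G (toX₀ p (F.grp ⧸ Submodule.span ℤ_[p] {x})) : ENNReal) := by
  have := Fintype.ofFinite (G.grp →ₗ[ℤ_[p]] Prufer p)
  have := Fintype.ofFinite F.grp
  have h1 : ∀ χ : G.grp →ₗ[ℤ_[p]] Prufer p,
      numSur p (splitX₁ p (LinearMap.ker χ)).mod F.grp =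
        numSur p (ℤ_[p] × LinearMap.ker χ) F.grp := fun χ =>
    numSur_congr (splitX₁_eq_iff.1 rfl).some.symm (LinearEquiv.refl _ _)
  rw [tsum_probDStar_mul G, tsum_fintype]
  simp only [h1, cardSur_toX₀_right]
  rw [← Nat.cast_sum, sum_numSur_prod_ker, Nat.cast_mul, ← mul_assoc]
  have h2 : (cardGrp G : ENNReal)⁻¹ * (Nat.card G.grp : ENNReal) = 1 :=
    ENNReal.inv_mul_cancel (by exact_mod_cast (cardGrp_pos G).ne') (ENNReal.natCast_ne_top _)
  rw [h2, one_mul, Nat.cast_sum]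

/-- The transpose of `Δ₀`: the expectation of `f` after a step of `d*` and a step of `d` from `G`. -/
def transition (f : X₀ p → ENNReal) (G : X₀ p) : ENNReal :=
  ∑' H, ENNReal.ofReal (probDStar G H) * ∑' G', ENNReal.ofReal (probD H G') * f G'

theorem transition_mono {f g : X₀ p → ENNReal} (h : f ≤ g) : transition f ≤ transition g :=
  fun _ => ENNReal.tsum_le_tsum fun _ => mul_le_mul_right
    (ENNReal.tsum_le_tsum fun G' => mul_le_mul_right (h G') _) _

theorem transition_const (c : ENNReal) (G : X₀ p) : transition (fun _ => c) G = c := by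
  simp only [transition, ENNReal.tsum_mul_right, tsum_probD, tsum_probDStar, one_mul]

/-- `1 / #Aut` is a stationary measure. -/
theorem tsum_autWeight_mul_transition (f : X₀ p → ENNReal) :
    ∑' G, autWeight G * transition f G = ∑' G, autWeight G * f G := by
  calc ∑' G, autWeight G * transition f G
      = ∑' G, ∑' H, (ENNReal.ofReal (rankOneWeight H) * ∑' G', ENNReal.ofReal (probD H G') * f G')
          * ENNReal.ofReal (probD H G) := by
        refine tsum_congr fun G => ?_
        rw [transition, ← ENNReal.tsum_mul_left]
        refine tsum_congr fun H => ?_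
        rw [← mul_assoc, autWeight_mul_probDStar]
        ring
    _ = ∑' H, ENNReal.ofReal (rankOneWeight H) * ∑' G', ENNReal.ofReal (probD H G') * f G' := by
        rw [ENNReal.tsum_comm]
        refine tsum_congr fun H => ?_
        rw [ENNReal.tsum_mul_left, tsum_probD, mul_one]
    _ = ∑' H, ∑' G, autWeight G * f G * ENNReal.ofReal (probDStar G H) := by
        refine tsum_congr fun H => ?_
        rw [← ENNReal.tsum_mul_left]
        refine tsum_congr fun G => ?_
        rw [← mul_assoc, ← autWeight_mul_probDStar]
        ring
    _ = ∑' G, autWeight G * f G := by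
        rw [ENNReal.tsum_comm]
        refine tsum_congr fun G => ?_
        rw [ENNReal.tsum_mul_left, tsum_probDStar, mul_one]

theorem transition_cardSur (F G : X₀ p) :
    transition (fun G => (cardSur G F : ENNReal)) G = (cardGrp F : ENNReal)⁻¹ *
      ∑' x : F.grp, (cardSur G (toX₀ p (F.grp ⧸ Submodule.span ℤ_[p] {x})) : ENNReal) := by
  simp only [transition, tsum_probD_mul_cardSur, ← mul_assoc]
  rw [ENNReal.tsum_mul_right, tsum_probDStar_mul_numSur, mul_comm]

theorem tsum_eq_toReal_tsum_ofReal {ι : Type*} {f : ι → ℝ} (hf : ∀ i, 0 ≤ f i) :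
    ∑' i, f i = (∑' i, ENNReal.ofReal (f i)).toReal := by
  rw [ENNReal.tsum_toReal_eq fun i => ENNReal.ofReal_ne_top]
  exact tsum_congr fun i => (ENNReal.toReal_ofReal (hf i)).symm

theorem dStar_surToFun (F : X₀ p) (H : X₁ p) :
    dStar (surToFun F) H = rankOneWeight H * (numSur p H.mod F.grp * (cardGrp F : ℝ)⁻¹) := by
  have h1 : ∀ G, surToFun F G * probDStar G H = rankOneWeight H * (probD H G * cardSur G F) :=
    fun G => by
      rw [surToFun, div_eq_mul_inv, mul_assoc, detailed_balance]
      ring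
  rw [dStar, tsum_congr h1, tsum_mul_left, tsum_eq_toReal_tsum_ofReal fun G =>
    mul_nonneg (probD_nonneg H G) (Nat.cast_nonneg _)]
  simp only [ENNReal.ofReal_mul (probD_nonneg H _), ENNReal.ofReal_natCast, tsum_probD_mul_cardSur,
    ENNReal.toReal_mul, ENNReal.toReal_natCast, ENNReal.toReal_inv]

/-- The Laplacian on the measures `#Sur(·, F) / #Aut(·)`. -/
theorem dOp_dStar_surToFun (F G : X₀ p) :
    dOp (dStar (surToFun F)) G = (cardGrp F : ℝ)⁻¹ *
      ∑' x : F.grp, surToFun (toX₀ p (F.grp ⧸ Submodule.span ℤ_[p] {x})) G := by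
  have h1 : ∀ H, dStar (surToFun F) H * probD H G =
      (cardGrp F : ℝ)⁻¹ * (cardAut G : ℝ)⁻¹ * (probDStar G H * numSur p H.mod F.grp) := fun H => by
    rw [dStar_surToFun, mul_right_comm, ← detailed_balance]
    ring
  rw [dOp, tsum_congr h1, tsum_mul_left, tsum_eq_toReal_tsum_ofReal fun H =>
    mul_nonneg (probDStar_nonneg G H) (Nat.cast_nonneg _)]
  simp only [ENNReal.ofReal_mul (probDStar_nonneg G _), ENNReal.ofReal_natCast,
    tsum_probDStar_mul_numSur]
  rw [ENNReal.tsum_toReal_eq fun _ => ENNReal.natCast_ne_top _, mul_assoc, ← tsum_mul_left]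
  congr 1
  refine tsum_congr fun x => ?_
  rw [surToFun, ENNReal.toReal_natCast, div_eq_mul_inv, mul_comm]

/-! ### The total mass of the Cohen–Lenstra weights -/

theorem ofReal_one_sub_inv : ENNReal.ofReal (1 - (p : ℝ)⁻¹) = 1 - (p : ENNReal)⁻¹ := by
  have hp : (0 : ℝ) < p := by exact_mod_cast (Fact.out : p.Prime).pos
  rw [ENNReal.ofReal_sub _ (by positivity), ENNReal.ofReal_one, ENNReal.ofReal_inv_of_pos hp,
    ENNReal.ofReal_natCast]

theorem one_sub_inv_mul_inv_pow (k : ℕ) :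
    ((p : ENNReal) ^ k)⁻¹ - ((p : ENNReal) ^ (k + 1))⁻¹ =
      (1 - (p : ENNReal)⁻¹) * ((p : ENNReal)⁻¹) ^ k := by
  rw [ENNReal.sub_mul fun _ _ => ENNReal.pow_ne_top
    (ENNReal.inv_ne_top.2 (by exact_mod_cast (Fact.out : p.Prime).ne_zero)),
    one_mul, ENNReal.inv_pow, ENNReal.inv_pow, pow_succ']

/-- The law of the order of the quotient of `ℤ_p × T` by a random element. -/
theorem tsum_mul_probD (H : X₁ p) (ψ : ℕ → ENNReal) :
    ∑' G, ψ (cardGrp G) * ENNReal.ofReal (probD H G) =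
      ∑' k : ℕ, (1 - (p : ENNReal)⁻¹) * ((p : ENNReal)⁻¹) ^ k *
        ψ (p ^ k * cardGrp (torsionClass H)) := by
  classical
  have := Fintype.ofFinite (torsionClass H).grp
  have hT0 : (cardGrp (torsionClass H) : ENNReal) ≠ 0 := by
    exact_mod_cast (cardGrp_pos (torsionClass H)).ne'
  have hT : (cardGrp (torsionClass H) : ENNReal)⁻¹ * cardGrp (torsionClass H) = 1 :=
    ENNReal.inv_mul_cancel hT0 (ENNReal.natCast_ne_top _)
  let Q : ℕ → (torsionClass H).grp → X₀ p := fun k t =>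
    toX₀ p ((ℤ_[p] × (torsionClass H).grp) ⧸ Submodule.span ℤ_[p] {((p : ℤ_[p]) ^ k, t)})
  have hQ : ∀ k t, cardGrp (Q k t) = p ^ k * cardGrp (torsionClass H) := fun k t => by
    rw [cardGrp_toX₀, card_prod_quotient_pow]
    rfl
  have h1 : ∀ G, ENNReal.ofReal (probD H G) = ∑' k : ℕ, ∑ t : (torsionClass H).grp,
      if G = Q k t then (1 - (p : ENNReal)⁻¹) * ((p : ENNReal)⁻¹) ^ k *
        (cardGrp (torsionClass H) : ENNReal)⁻¹ else 0 := fun G => by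
    rw [ofReal_probD]
    by_cases hk : ∃ k, cardGrp G = p ^ k * cardGrp (torsionClass H)
    · obtain ⟨k, hk⟩ := hk
      rw [tsum_eq_single k]
      · have h2 := cardGrp_mul_haar_quotientEvent hk
        rw [one_sub_inv_mul_inv_pow] at h2
        have h3 : Nat.card {t : (torsionClass H).grp // Q k t = G} =
            ∑ t : (torsionClass H).grp, if G = Q k t then 1 else 0 := by
          rw [← Finset.card_filter, ← Fintype.card_subtype, Nat.card_eq_fintype_card]
          exact Fintype.card_congr (Equiv.subtypeEquivRight fun t => eq_comm)
        have h4 := congrArg (fun y => (cardGrp (torsionClass H) : ENNReal)⁻¹ * y) h2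
        simp only [← mul_assoc, hT, one_mul] at h4
        change _ = _ * (Nat.card {t : (torsionClass H).grp // Q k t = G} : ENNReal) * _ * _ at h4
        rw [h4, h3, Nat.cast_sum, Finset.mul_sum, Finset.sum_mul, Finset.sum_mul]
        refine Finset.sum_congr rfl fun t _ => ?_
        split_ifs
        · rw [Nat.cast_one]
          ring
        · rw [Nat.cast_zero, mul_zero, zero_mul, zero_mul]
      · intro j hj
        refine Finset.sum_eq_zero fun t _ => if_neg fun h => hj ?_
        have h2 := hQ j t
        rw [← h, hk] at h2
        exact (Nat.pow_right_injective (Fact.out : p.Prime).two_le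
          (Nat.eq_of_mul_eq_mul_right (cardGrp_pos (torsionClass H)) h2)).symm
    · push Not at hk
      rw [quotientEvent_eq_empty hk, measure_empty, eq_comm, ENNReal.tsum_eq_zero]
      intro k
      refine Finset.sum_eq_zero fun t _ => if_neg fun h => hk k ?_
      rw [h, hQ]
  simp only [h1, ← ENNReal.tsum_mul_left]
  rw [ENNReal.tsum_comm]
  refine tsum_congr fun k => ?_
  simp only [Finset.mul_sum]
  rw [Summable.tsum_finsetSum fun _ _ => ENNReal.summable]
  have h2 : ∀ t, ∑' G, ψ (cardGrp G) * (if G = Q k t then (1 - (p : ENNReal)⁻¹) *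
      ((p : ENNReal)⁻¹) ^ k * (cardGrp (torsionClass H) : ENNReal)⁻¹ else 0) =
      ψ (p ^ k * cardGrp (torsionClass H)) * ((1 - (p : ENNReal)⁻¹) *
      ((p : ENNReal)⁻¹) ^ k * (cardGrp (torsionClass H) : ENNReal)⁻¹) := fun t => by
    rw [tsum_eq_single (Q k t) fun G hG => by rw [if_neg hG, mul_zero], if_pos rfl, hQ]
  rw [Finset.sum_congr rfl fun t _ => h2 t, Finset.sum_const, Finset.card_univ, nsmul_eq_mul,
    ← Nat.card_eq_fintype_card]
  change (cardGrp (torsionClass H) : ENNReal) * _ = _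
  calc _ = ((cardGrp (torsionClass H) : ENNReal)⁻¹ * cardGrp (torsionClass H)) *
        ((1 - (p : ENNReal)⁻¹) * ((p : ENNReal)⁻¹) ^ k *
        ψ (p ^ k * cardGrp (torsionClass H))) := by ring
    _ = _ := by rw [hT, one_mul]

/-- The sum of `φ(#G) #G⁻ˢ / #Aut G`. The weight `φ` is either `1` or the indicator of an initial
segment. -/
def autZeta (p : ℕ) [Fact p.Prime] (φ : ℕ → ENNReal) (s : ℕ) : ENNReal :=
  ∑' G : X₀ p, φ (cardGrp G) * ((cardGrp G : ENNReal)⁻¹) ^ s * autWeight G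

theorem rankOneWeight_mul (H : X₁ p) :
    ENNReal.ofReal (rankOneWeight H) * (1 - (p : ENNReal)⁻¹) =
      (cardGrp (torsionClass H) : ENNReal)⁻¹ * autWeight (torsionClass H) := by
  have hT : (0 : ℝ) < cardGrp (torsionClass H) := by exact_mod_cast cardGrp_pos _
  have h1 := one_sub_inv_pos (p := p)
  rw [← ofReal_one_sub_inv, ← ENNReal.ofReal_mul (rankOneWeight_pos H).le, autWeight,
    ← ENNReal.ofReal_natCast, ← ENNReal.ofReal_inv_of_pos hT, ← ENNReal.ofReal_mul (by positivity),
    rankOneWeight]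
  congr 1
  have hA : (0 : ℝ) < cardAut (torsionClass H) := by exact_mod_cast cardAut_pos _
  set q : ℝ := 1 - (p : ℝ)⁻¹
  field_simp

/-- The functional equation of the zeta function, obtained by summing detailed balance. -/
theorem autZeta_eq (φ : ℕ → ENNReal) (s : ℕ) :
    autZeta p φ s = ∑' T : X₀ p, ∑' k : ℕ, φ (p ^ k * cardGrp T) *
      (((p : ENNReal)⁻¹) ^ (s + 1)) ^ k * (((cardGrp T : ENNReal)⁻¹) ^ (s + 1) * autWeight T) := by
  calc autZeta p φ s
      = ∑' G : X₀ p, ∑' H : X₁ p, ENNReal.ofReal (rankOneWeight H) *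
          (φ (cardGrp G) * ((cardGrp G : ENNReal)⁻¹) ^ s * ENNReal.ofReal (probD H G)) := by
        refine tsum_congr fun G => ?_
        conv_lhs => rw [← mul_one (autWeight G), ← tsum_probDStar G, ← ENNReal.tsum_mul_left,
          ← ENNReal.tsum_mul_left]
        refine tsum_congr fun H => ?_
        rw [autWeight_mul_probDStar]
        ring
    _ = ∑' H : X₁ p, ENNReal.ofReal (rankOneWeight H) * ∑' k : ℕ, (1 - (p : ENNReal)⁻¹) *
          ((p : ENNReal)⁻¹) ^ k * (φ (p ^ k * cardGrp (torsionClass H)) *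
            (((p ^ k * cardGrp (torsionClass H) : ℕ) : ENNReal)⁻¹) ^ s) := by
        rw [ENNReal.tsum_comm]
        refine tsum_congr fun H => ?_
        rw [ENNReal.tsum_mul_left, tsum_mul_probD H fun n => φ n * ((n : ENNReal)⁻¹) ^ s]
    _ = ∑' H : X₁ p, ∑' k : ℕ, φ (p ^ k * cardGrp (torsionClass H)) *
          (((p : ENNReal)⁻¹) ^ (s + 1)) ^ k *
          (((cardGrp (torsionClass H) : ENNReal)⁻¹) ^ (s + 1) * autWeight (torsionClass H)) := by
        refine tsum_congr fun H => ?_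
        rw [← ENNReal.tsum_mul_left]
        refine tsum_congr fun k => ?_
        have h1 : (((p ^ k * cardGrp (torsionClass H) : ℕ) : ENNReal)⁻¹) =
            ((p : ENNReal)⁻¹) ^ k * (cardGrp (torsionClass H) : ENNReal)⁻¹ := by
          rw [Nat.cast_mul, Nat.cast_pow, ENNReal.mul_inv (Or.inr (ENNReal.natCast_ne_top _))
            (Or.inl (ENNReal.pow_ne_top (ENNReal.natCast_ne_top _))), ENNReal.inv_pow]
        rw [h1, ← mul_assoc, ← mul_assoc, ← mul_assoc, rankOneWeight_mul]
        ring
    _ = _ := Equiv.tsum_eq (torsionEquiv p) fun T : X₀ p => ∑' k : ℕ, φ (p ^ k * cardGrp T) *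
      (((p : ENNReal)⁻¹) ^ (s + 1)) ^ k * (((cardGrp T : ENNReal)⁻¹) ^ (s + 1) * autWeight T)

/-- For `φ` decreasing, replacing `φ (p^k #T)` by `φ (#T)` makes the sum over `k` geometric. -/
theorem autZeta_le {φ : ℕ → ENNReal} (hφ : Antitone φ) (s : ℕ) :
    autZeta p φ s ≤ (1 - ((p : ENNReal)⁻¹) ^ (s + 1))⁻¹ * autZeta p φ (s + 1) := by
  rw [autZeta_eq, ← ENNReal.tsum_geometric, autZeta, ← ENNReal.tsum_mul_left]
  refine ENNReal.tsum_le_tsum fun T => ?_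
  rw [← ENNReal.tsum_mul_right]
  refine ENNReal.tsum_le_tsum fun k => ?_
  calc _ ≤ φ (cardGrp T) * (((p : ENNReal)⁻¹) ^ (s + 1)) ^ k *
        (((cardGrp T : ENNReal)⁻¹) ^ (s + 1) * autWeight T) := by
        gcongr
        exact hφ (Nat.le_mul_of_pos_left _ (pow_pos (Fact.out : p.Prime).pos _))
    _ = _ := by ring

theorem autZeta_one (s : ℕ) :
    autZeta p 1 s = (1 - ((p : ENNReal)⁻¹) ^ (s + 1))⁻¹ * autZeta p 1 (s + 1) := by
  rw [autZeta_eq, ← ENNReal.tsum_geometric]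
  simp only [Pi.one_apply, one_mul, ENNReal.tsum_mul_right, autZeta]
  rw [ENNReal.tsum_mul_left]

/-- Partial products of the Cohen–Lenstra constant. -/
def partialConst (p n : ℕ) : ℝ := ∏ i ∈ Finset.range n, (1 - ((p : ℝ)⁻¹) ^ (i + 1))

theorem one_sub_inv_pow_pos (i : ℕ) : (0 : ℝ) < 1 - ((p : ℝ)⁻¹) ^ (i + 1) := by
  have h1 : (1 : ℝ) < p := by exact_mod_cast (Fact.out : p.Prime).one_lt
  have : ((p : ℝ)⁻¹) ^ (i + 1) < 1 :=
    pow_lt_one₀ (by positivity) (inv_lt_one_of_one_lt₀ h1) (Nat.succ_ne_zero i)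
  linarith

theorem partialConst_pos (n : ℕ) : 0 < partialConst p n :=
  Finset.prod_pos fun i _ => one_sub_inv_pow_pos i

theorem tendsto_partialConst :
    Filter.Tendsto (partialConst p) Filter.atTop (nhds (cohenLenstraConst p)) := by
  have h1 : (1 : ℝ) < p := by exact_mod_cast (Fact.out : p.Prime).one_lt
  have h0 : (0 : ℝ) < (p : ℝ)⁻¹ := by positivity
  have hs : Summable fun i : ℕ => ‖-((p : ℝ)⁻¹) ^ (i + 1)‖ := by
    simpa using
      ((summable_nat_add_iff 1).2 (summable_geometric_of_lt_one h0.le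
        (inv_lt_one_of_one_lt₀ h1))).norm
  have hm : Multipliable fun i : ℕ => (1 - ((p : ℝ)⁻¹) ^ (i + 1)) := by
    simpa [sub_eq_add_neg] using multipliable_one_add_of_summable hs
  exact hm.hasProd.tendsto_prod_nat

theorem ofReal_one_sub_inv_pow (i : ℕ) :
    ENNReal.ofReal (1 - ((p : ℝ)⁻¹) ^ (i + 1)) = 1 - ((p : ENNReal)⁻¹) ^ (i + 1) := by
  have hp : (0 : ℝ) < p := by exact_mod_cast (Fact.out : p.Prime).pos
  rw [ENNReal.ofReal_sub _ (by positivity), ENNReal.ofReal_one, ENNReal.ofReal_pow (by positivity),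
    ENNReal.ofReal_inv_of_pos hp, ENNReal.ofReal_natCast]

theorem ofReal_mul_inv_mul (i : ℕ) (z : ENNReal) :
    ENNReal.ofReal (1 - ((p : ℝ)⁻¹) ^ (i + 1)) *
      ((1 - ((p : ENNReal)⁻¹) ^ (i + 1))⁻¹ * z) = z := by
  rw [← ofReal_one_sub_inv_pow, ← mul_assoc, ENNReal.mul_inv_cancel, one_mul]
  · exact (ENNReal.ofReal_pos.2 (one_sub_inv_pow_pos i)).ne'
  · exact ENNReal.ofReal_ne_top

/-- The iterated functional equation, as an inequality for decreasing `φ`. -/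
theorem partialConst_mul_autZeta_le {φ : ℕ → ENNReal} (hφ : Antitone φ) (n : ℕ) :
    ENNReal.ofReal (partialConst p n) * autZeta p φ 0 ≤ autZeta p φ n := by
  induction n with
  | zero => simp [partialConst]
  | succ n ih =>
    rw [partialConst, Finset.prod_range_succ, ← partialConst,
      ENNReal.ofReal_mul (partialConst_pos n).le, mul_right_comm, mul_comm]
    calc _ ≤ ENNReal.ofReal (1 - ((p : ℝ)⁻¹) ^ (n + 1)) * autZeta p φ n := by gcongr
      _ ≤ ENNReal.ofReal (1 - ((p : ℝ)⁻¹) ^ (n + 1)) *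
          ((1 - ((p : ENNReal)⁻¹) ^ (n + 1))⁻¹ * autZeta p φ (n + 1)) := by
        gcongr
        exact autZeta_le hφ n
      _ = _ := ofReal_mul_inv_mul _ _

theorem partialConst_mul_autZeta_one (n : ℕ) :
    ENNReal.ofReal (partialConst p n) * autZeta p 1 0 = autZeta p 1 n := by
  induction n with
  | zero => simp [partialConst]
  | succ n ih =>
    rw [partialConst, Finset.prod_range_succ, ← partialConst,
      ENNReal.ofReal_mul (partialConst_pos n).le, mul_right_comm, ih, mul_comm, autZeta_one n,
      ofReal_mul_inv_mul]

theorem toX₀_eq_of_card_eq_one {G : X₀ p} (h : cardGrp G = 1) : toX₀ p PUnit = G := by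
  rw [toX₀_eq_iff]
  have : Subsingleton G.grp := (Nat.card_eq_one_iff_unique.1 h).1
  exact ⟨LinearEquiv.ofSubsingleton _ _⟩

theorem cardGrp_punit : cardGrp (toX₀ p PUnit) = 1 := by
  rw [cardGrp_toX₀, Nat.card_unique]

theorem autWeight_punit : autWeight (toX₀ p PUnit) = 1 := by
  have h : Subsingleton (toX₀ p PUnit).grp := (Nat.card_eq_one_iff_unique.1 cardGrp_punit).1
  have h1 : cardAut (toX₀ p PUnit) = 1 := by
    refine Nat.card_eq_one_iff_unique.2 ⟨⟨fun a b => ?_⟩, ⟨LinearEquiv.refl _ _⟩⟩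
    ext x
    exact Subsingleton.elim _ _
  rw [autWeight, h1]
  simp

/-- For large `s` only the trivial group contributes. -/
theorem autZeta_le_add {φ : ℕ → ENNReal} (h1 : ∀ n, φ n ≤ 1) (s : ℕ) :
    autZeta p φ s ≤ 1 + ((2 : ENNReal)⁻¹) ^ s * autZeta p φ 0 := by
  classical
  have h2 : ∀ G : X₀ p, φ (cardGrp G) * ((cardGrp G : ENNReal)⁻¹) ^ s * autWeight G ≤
      (if G = toX₀ p PUnit then 1 else 0) +
        ((2 : ENNReal)⁻¹) ^ s * (φ (cardGrp G) * ((cardGrp G : ENNReal)⁻¹) ^ 0 * autWeight G) := by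
    intro G
    split_ifs with h
    · refine le_add_of_le_left ?_
      subst h
      rw [cardGrp_punit, autWeight_punit]
      simpa using h1 1
    · rw [zero_add, pow_zero, mul_one, mul_right_comm, mul_comm]
      gcongr
      have : 2 ≤ cardGrp G := by
        have := cardGrp_pos G
        have h3 : cardGrp G ≠ 1 := fun h3 => h (toX₀_eq_of_card_eq_one h3).symm
        omega
      exact_mod_cast this
  refine (ENNReal.tsum_le_tsum h2).trans ?_
  rw [ENNReal.tsum_add, tsum_ite_eq, ENNReal.tsum_mul_left]
  rfl

/-- The trivial group contributes `1`. -/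
theorem one_le_autZeta_one (s : ℕ) : 1 ≤ autZeta p 1 s := by
  refine le_trans ?_ (ENNReal.le_tsum (toX₀ p PUnit))
  rw [cardGrp_punit, autWeight_punit]
  simp

/-- The limit `n → ∞` of the iterated functional equation. -/
theorem const_mul_toReal_le {z : ENNReal} (hz : z ≠ ⊤)
    (h : ∀ n, ENNReal.ofReal (partialConst p n) * z ≤ 1 + ((2 : ENNReal)⁻¹) ^ n * z) :
    cohenLenstraConst p * z.toReal ≤ 1 := by
  have h1 : ∀ n, partialConst p n * z.toReal ≤ 1 + ((2 : ℝ)⁻¹) ^ n * z.toReal := fun n => by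
    have h2 : ((2 : ENNReal)⁻¹) ^ n * z ≠ ⊤ :=
      ENNReal.mul_ne_top (ENNReal.pow_ne_top (by simp)) hz
    have h3 := ENNReal.toReal_mono (ENNReal.add_ne_top.2 ⟨ENNReal.one_ne_top, h2⟩) (h n)
    rw [ENNReal.toReal_add ENNReal.one_ne_top h2] at h3
    simpa [(partialConst_pos (p := p) n).le] using h3
  have h4 : Filter.Tendsto (fun n : ℕ => 1 + ((2 : ℝ)⁻¹) ^ n * z.toReal) Filter.atTop
      (nhds (1 + 0 * z.toReal)) :=
    ((tendsto_pow_atTop_nhds_zero_of_lt_one (by norm_num) (by norm_num)).mul_const _).const_add _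
  rw [zero_mul, add_zero] at h4
  exact le_of_tendsto_of_tendsto' (tendsto_partialConst.mul_const _) h4 h1

/-- Truncating to groups of order at most `B` makes the sum finite, so that the functional equation
can be iterated; the bound does not depend on `B`. -/
theorem autZeta_one_zero_ne_top : autZeta p 1 0 ≠ ⊤ := by
  classical
  have hc := cohenLenstraConst_pos p
  have hle : autZeta p 1 0 ≤ ENNReal.ofReal (cohenLenstraConst p)⁻¹ := by
    rw [autZeta, ENNReal.tsum_eq_iSup_sum]
    refine iSup_le fun s => ?_
    obtain ⟨B, hB⟩ : ∃ B, ∀ G ∈ s, cardGrp G ≤ B := ⟨s.sup cardGrp, fun G hG => Finset.le_sup hG⟩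
    let φ : ℕ → ENNReal := fun n => if n ≤ B then 1 else 0
    have hφ : Antitone φ := fun m n hmn => by
      by_cases hn : n ≤ B
      · simp [φ, hn, hmn.trans hn]
      · simp [φ, hn]
    have hφ1 : ∀ n, φ n ≤ 1 := fun n => by
      by_cases hn : n ≤ B <;> simp [φ, hn]
    have hs : ∑ G ∈ s, (1 : ℕ → ENNReal) (cardGrp G) * ((cardGrp G : ENNReal)⁻¹) ^ 0 * autWeight G ≤
        autZeta p φ 0 := by
      refine le_trans (le_of_eq (Finset.sum_congr rfl fun G hG => ?_)) (ENNReal.sum_le_tsum s)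
      simp [φ, hB G hG]
    have hfin : autZeta p φ 0 ≠ ⊤ := by
      have : autZeta p φ 0 = ∑ G ∈ (finite_setOf_cardGrp_le (p := p) B).toFinset,
          φ (cardGrp G) * ((cardGrp G : ENNReal)⁻¹) ^ 0 * autWeight G := by
        refine tsum_eq_sum fun G hG => ?_
        have hG' : ¬ cardGrp G ≤ B := by simpa using hG
        simp [φ, hG']
      rw [this]
      refine ENNReal.sum_ne_top.2 fun G _ => ?_
      rw [pow_zero, mul_one]
      exact ENNReal.mul_ne_top (ne_top_of_le_ne_top ENNReal.one_ne_top (hφ1 _))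
        (ne_top_of_le_ne_top ENNReal.one_ne_top (autWeight_le_one G))
    have h := const_mul_toReal_le hfin fun n =>
      (partialConst_mul_autZeta_le hφ n).trans (autZeta_le_add hφ1 n)
    refine hs.trans ((ENNReal.le_ofReal_iff_toReal_le hfin (by positivity)).2 ?_)
    rw [inv_eq_one_div, le_div_iff₀ hc, mul_comm]
    exact h
  exact ne_top_of_le_ne_top ENNReal.ofReal_ne_top hle

/-- The sum of `1 / #Aut G` over all finite abelian `p`-groups is `1 / c₀`. -/
theorem tsum_autWeight : ∑' G : X₀ p, autWeight G = ENNReal.ofReal (cohenLenstraConst p)⁻¹ := by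
  have hz := autZeta_one_zero_ne_top (p := p)
  have h1 := const_mul_toReal_le hz fun n =>
    (partialConst_mul_autZeta_one n).le.trans (autZeta_le_add (fun _ => le_rfl) n)
  have h2 : ∀ n, 1 ≤ partialConst p n * (autZeta p 1 0).toReal := fun n => by
    have h3 : 1 ≤ ENNReal.ofReal (partialConst p n) * autZeta p 1 0 :=
      (one_le_autZeta_one n).trans (partialConst_mul_autZeta_one n).ge
    have h4 := ENNReal.toReal_mono (ENNReal.mul_ne_top ENNReal.ofReal_ne_top hz) h3
    simpa [(partialConst_pos (p := p) n).le] using h4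
  have h5 := ge_of_tendsto' (tendsto_partialConst.mul_const (autZeta p 1 0).toReal) h2
  have h6 : (autZeta p 1 0).toReal = (cohenLenstraConst p)⁻¹ :=
    eq_inv_of_mul_eq_one_right (le_antisymm h1 h5)
  rw [← h6, ENNReal.ofReal_toReal hz, autZeta]
  simp

/-! ### Moments -/

theorem tsum_autWeight_ne_top : ∑' G : X₀ p, autWeight G ≠ ⊤ := by
  rw [tsum_autWeight]
  exact ENNReal.ofReal_ne_top

theorem numSur_of_subsingleton {M N : Type} [AddCommGroup M] [Module ℤ_[p] M] [AddCommGroup N]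
    [Module ℤ_[p] N] [Subsingleton N] : numSur p M N = 1 := by
  refine Nat.card_eq_one_iff_unique.2 ⟨⟨fun a b => Subtype.ext ?_⟩,
    ⟨⟨0, fun y => ⟨0, Subsingleton.elim _ _⟩⟩⟩⟩
  ext x
  exact Subsingleton.elim _ _

theorem cardGrp_quotient_span_lt {F : X₀ p} {x : F.grp} (hx : x ≠ 0) :
    cardGrp (toX₀ p (F.grp ⧸ Submodule.span ℤ_[p] {x})) < cardGrp F := by
  rw [cardGrp_toX₀]
  have h1 := Submodule.card_eq_card_quotient_mul_card' (Submodule.span ℤ_[p] {x})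
  have h2 : 1 < Nat.card (Submodule.span ℤ_[p] {x}) := by
    rw [Finite.one_lt_card_iff_nontrivial]
    exact ⟨⟨⟨x, Submodule.mem_span_singleton_self x⟩, 0, fun h => hx (congrArg Subtype.val h)⟩⟩
  have h3 : 0 < Nat.card (F.grp ⧸ Submodule.span ℤ_[p] {x}) := Nat.card_pos
  change _ < Nat.card F.grp
  rw [h1]
  nlinarith

/-- All surjection moments of the Cohen–Lenstra weights agree: `#Sur(·, F)` is an eigenfunction of
the transition operator up to surjection counts onto smaller groups, and the weights are
stationary. Finiteness comes from truncating `#Sur(·, F)` at height `c`. -/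
theorem tsum_autWeight_mul_cardSur (F : X₀ p) :
    ∑' G, autWeight G * (cardSur G F : ENNReal) = ENNReal.ofReal (cohenLenstraConst p)⁻¹ := by
  induction hn : cardGrp F using Nat.strong_induction_on generalizing F with
  | _ n ih =>
    subst hn
    classical
    rcases Nat.lt_or_ge 1 (cardGrp F) with hF | hF
    swap
    · have h1 : cardGrp F = 1 := le_antisymm hF (cardGrp_pos F)
      have : Subsingleton F.grp := (Nat.card_eq_one_iff_unique.1 h1).1
      have h2 : ∀ G : X₀ p, cardSur G F = 1 := fun G => numSur_of_subsingleton
      simp only [h2, Nat.cast_one, mul_one, tsum_autWeight]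
    have := Fintype.ofFinite F.grp
    rw [← tsum_autWeight]
    set m₀ : ENNReal := ∑' G : X₀ p, autWeight G with hm₀
    have hm₀t : m₀ ≠ ⊤ := tsum_autWeight_ne_top
    let S : X₀ p → ENNReal := fun G => cardSur G F
    let α : ENNReal := (cardGrp F : ENNReal)⁻¹
    let g : X₀ p → ENNReal := fun G => α * ∑ x ∈ Finset.univ.erase (0 : F.grp),
      (cardSur G (toX₀ p (F.grp ⧸ Submodule.span ℤ_[p] {x})) : ENNReal)
    have hα1 : α < 1 := by
      rw [ENNReal.inv_lt_one]
      exact_mod_cast hF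
    have hα0 : α ≠ ⊤ := hα1.ne_top
    have hzero : toX₀ p (F.grp ⧸ Submodule.span ℤ_[p] {(0 : F.grp)}) = F := by
      rw [toX₀_eq_iff]
      exact ⟨Submodule.quotEquivOfEqBot _ (by simp)⟩
    have hKS : ∀ G, transition S G = α * S G + g G := fun G => by
      rw [transition_cardSur, tsum_fintype, ← Finset.add_sum_erase _ _ (Finset.mem_univ 0), hzero,
        mul_add]
    -- the quotients of `F` by nonzero elements are smaller than `F`
    have hg : ∑' G, autWeight G * g G = α * ((cardGrp F - 1 : ℕ) * m₀) := by
      have h1 : ∀ G, autWeight G * g G = α * ∑ x ∈ Finset.univ.erase (0 : F.grp), autWeight G *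
          (cardSur G (toX₀ p (F.grp ⧸ Submodule.span ℤ_[p] {x})) : ENNReal) := fun G => by
        rw [← Finset.mul_sum]
        ring
      rw [tsum_congr h1, ENNReal.tsum_mul_left,
        Summable.tsum_finsetSum fun _ _ => ENNReal.summable]
      have h2 : ∀ x ∈ Finset.univ.erase (0 : F.grp), ∑' G, autWeight G *
          (cardSur G (toX₀ p (F.grp ⧸ Submodule.span ℤ_[p] {x})) : ENNReal) = m₀ := fun x hx => by
        rw [ih _ (cardGrp_quotient_span_lt (Finset.ne_of_mem_erase hx)) _ rfl, hm₀, tsum_autWeight]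
      rw [Finset.sum_congr rfl h2, Finset.sum_const, Finset.card_erase_of_mem (Finset.mem_univ _),
        Finset.card_univ, nsmul_eq_mul, ← Nat.card_eq_fintype_card]
      rfl
    have hgt : ∑' G, autWeight G * g G ≠ ⊤ := by
      rw [hg]
      exact ENNReal.mul_ne_top hα0 (ENNReal.mul_ne_top (ENNReal.natCast_ne_top _) hm₀t)
    -- stationarity applied to the bounded function `min S c`, where all sums are finite
    have htrunc : ∀ c : ℕ, ∑' G, autWeight G * (if S G ≤ c then (1 - α) * S G else 0) ≤
        ∑' G, autWeight G * g G := fun c => by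
      have h1 : ∑' G, autWeight G * min (S G) c ≤
          ∑' G, autWeight G * min (α * S G) c + ∑' G, autWeight G * g G := by
        rw [← tsum_autWeight_mul_transition, ← ENNReal.tsum_add]
        refine ENNReal.tsum_le_tsum fun G => ?_
        rw [← mul_add]
        refine mul_le_mul_right ?_ _
        have h2 : transition (fun G => min (S G) c) G ≤ min (α * S G + g G) c := by
          refine le_min ?_ ?_
          · rw [← hKS]
            exact transition_mono (fun G => min_le_left _ _) G
          · refine (transition_mono (fun G => min_le_right _ _) G).trans ?_
            rw [transition_const]
        refine h2.trans ?_
        rcases le_total (α * S G) c with h | h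
        · rw [min_eq_left h]
          exact min_le_left _ _
        · rw [min_eq_right h]
          exact (min_le_right _ _).trans le_self_add
      have hfin : ∑' G, autWeight G * min (α * S G) c ≠ ⊤ := by
        refine ne_top_of_le_ne_top (ENNReal.mul_ne_top hm₀t (ENNReal.natCast_ne_top c)) ?_
        rw [hm₀, ← ENNReal.tsum_mul_right]
        exact ENNReal.tsum_le_tsum fun G => mul_le_mul_right (min_le_right _ _) _
      have h3 : ∑' G, autWeight G * min (α * S G) c +
          ∑' G, autWeight G * (if S G ≤ c then (1 - α) * S G else 0) ≤
          ∑' G, autWeight G * min (S G) c := by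
        rw [← ENNReal.tsum_add]
        refine ENNReal.tsum_le_tsum fun G => ?_
        rw [← mul_add]
        refine mul_le_mul_right ?_ _
        have hαS : α * S G ≤ S G := mul_le_of_le_one_left' hα1.le
        split_ifs with h
        · rw [min_eq_left h, min_eq_left (hαS.trans h), ← add_mul, add_tsub_cancel_of_le hα1.le,
            one_mul]
        · rw [add_zero]
          exact min_le_min_right _ hαS
      exact (ENNReal.add_le_add_iff_left hfin).1 (h3.trans h1)
    have hMt : ∑' G, autWeight G * S G ≠ ⊤ := by
      have h1 : (1 - α) * ∑' G, autWeight G * S G ≤ ∑' G, autWeight G * g G := by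
        rw [← ENNReal.tsum_mul_left, ENNReal.tsum_eq_iSup_sum]
        refine iSup_le fun s => ?_
        refine le_trans ?_ (htrunc (s.sup fun G => cardSur G F))
        refine le_trans (le_of_eq (Finset.sum_congr rfl fun G hG => ?_)) (ENNReal.sum_le_tsum s)
        rw [if_pos (Nat.cast_le.2 (Finset.le_sup (f := fun G => cardSur G F) hG))]
        ring
      intro htop
      rw [htop, ENNReal.mul_top (tsub_pos_of_lt hα1).ne'] at h1
      exact hgt (top_le_iff.1 h1)
    -- stationarity applied to `S` itself: a linear equation for the moment
    have hmain : ∑' G, autWeight G * S G =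
        α * ∑' G, autWeight G * S G + α * ((cardGrp F - 1 : ℕ) * m₀) := by
      conv_lhs => rw [← tsum_autWeight_mul_transition]
      rw [← hg, ← ENNReal.tsum_mul_left, ← ENNReal.tsum_add]
      refine tsum_congr fun G => ?_
      rw [hKS]
      ring
    change ∑' G, autWeight G * S G = m₀
    rw [← ENNReal.toReal_eq_toReal_iff' hMt hm₀t]
    have h1 := congrArg ENNReal.toReal hmain
    rw [ENNReal.toReal_add (ENNReal.mul_ne_top hα0 hMt) (hg ▸ hgt), ENNReal.toReal_mul,
      ENNReal.toReal_mul, ENNReal.toReal_mul, ENNReal.toReal_natCast, ENNReal.toReal_inv,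
      ENNReal.toReal_natCast, Nat.cast_sub hF.le, Nat.cast_one] at h1
    have hF' : (1 : ℝ) < cardGrp F := by exact_mod_cast hF
    have hF0 : (0 : ℝ) < cardGrp F := by linarith
    field_simp at h1
    have h2 : ((cardGrp F : ℝ) - 1) * ((∑' G, autWeight G * S G).toReal - m₀.toReal) = 0 := by
      linarith
    exact sub_eq_zero.1 ((mul_eq_zero.1 h2).resolve_left (by linarith))

/-! ### Goursat's lemma and the two Gram matrices -/

section
variable {M A B : Type} [AddCommGroup M] [Module ℤ_[p] M] [AddCommGroup A] [Module ℤ_[p] A]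
  [AddCommGroup B] [Module ℤ_[p] B]

/-- The subdirect products of `A` and `B`: the submodules of `A × B` that project onto both
factors. -/
def Subdirect (p : ℕ) [Fact p.Prime] (A B : Type) [AddCommGroup A] [Module ℤ_[p] A]
    [AddCommGroup B] [Module ℤ_[p] B] : Type :=
  {R : Submodule ℤ_[p] (A × B) // (∀ a, ∃ b, (a, b) ∈ R) ∧ ∀ b, ∃ a, (a, b) ∈ R}

instance [Finite A] [Finite B] : Finite (Subdirect p A B) :=
  have : Finite (Submodule ℤ_[p] (A × B)) := Finite.of_injective _ SetLike.coe_injective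
  Subtype.finite

/-- Pairs of surjections are classified by the image of their product. -/
theorem numSur_mul_numSur [Finite M] [Finite A] [Finite B] [Fintype (Subdirect p A B)] :
    numSur p M A * numSur p M B = ∑ R : Subdirect p A B, numSur p M R.1 := by
  have hA : Finite (M →ₗ[ℤ_[p]] A) := DFunLike.finite _
  have hB : Finite (M →ₗ[ℤ_[p]] B) := DFunLike.finite _
  have hR : ∀ R : Subdirect p A B, Finite (M →ₗ[ℤ_[p]] R.1) := fun R => DFunLike.finite _
  unfold numSur
  rw [← Nat.card_prod, ← Nat.card_sigma]
  let φ : (Σ R : Subdirect p A B, {h : M →ₗ[ℤ_[p]] R.1 // Function.Surjective h}) →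
      {f : M →ₗ[ℤ_[p]] A // Function.Surjective f} × {f : M →ₗ[ℤ_[p]] B // Function.Surjective f} :=
    fun x => ⟨⟨LinearMap.fst ℤ_[p] A B ∘ₗ x.1.1.subtype ∘ₗ x.2.1, fun a => by
        obtain ⟨b, hb⟩ := x.1.2.1 a
        obtain ⟨m, hm⟩ := x.2.2 ⟨_, hb⟩
        exact ⟨m, congrArg (fun y => y.1.1) hm⟩⟩,
      ⟨LinearMap.snd ℤ_[p] A B ∘ₗ x.1.1.subtype ∘ₗ x.2.1, fun b => by
        obtain ⟨a, ha⟩ := x.1.2.2 b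
        obtain ⟨m, hm⟩ := x.2.2 ⟨_, ha⟩
        exact ⟨m, congrArg (fun y => y.1.2) hm⟩⟩⟩
  refine (Nat.card_congr (Equiv.ofBijective φ ⟨?_, ?_⟩)).symm
  · rintro ⟨⟨R, hR1⟩, ⟨h, hh⟩⟩ ⟨⟨R', hR2⟩, ⟨h', hh'⟩⟩ heq
    have h1 : ∀ m, ((h m).1 : A × B) = (h' m).1 := fun m => Prod.ext
      (congrArg (fun y => y.1.1 m) heq) (congrArg (fun y => y.2.1 m) heq)
    obtain rfl : R = R' := by
      ext x
      constructor
      · intro hx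
        obtain ⟨m, hm⟩ := hh ⟨x, hx⟩
        have : x = (h' m).1 := by rw [← h1, hm]
        rw [this]
        exact (h' m).2
      · intro hx
        obtain ⟨m, hm⟩ := hh' ⟨x, hx⟩
        have : x = (h m).1 := by rw [h1, hm]
        rw [this]
        exact (h m).2
    obtain rfl : h = h' := LinearMap.ext fun m => Subtype.ext (h1 m)
    rfl
  · rintro ⟨⟨f, hf⟩, ⟨g, hg⟩⟩
    refine ⟨⟨⟨LinearMap.range (f.prod g), fun a => ?_, fun b => ?_⟩,
      ⟨(f.prod g).rangeRestrict, (f.prod g).surjective_rangeRestrict⟩⟩, rfl⟩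
    · obtain ⟨m, rfl⟩ := hf a
      exact ⟨g m, m, rfl⟩
    · obtain ⟨m, rfl⟩ := hg b
      exact ⟨f m, m, rfl⟩

/-- The elements `a` of `A` with `(a, 0) ∈ R`. -/
abbrev Subdirect.leftKer (R : Subdirect p A B) : Submodule ℤ_[p] A :=
  R.1.comap (LinearMap.inl ℤ_[p] A B)

/-- The fibre product of two surjections. -/
def fibreProduct {G : Type} [AddCommGroup G] [Module ℤ_[p] G]
    (x : {f : A →ₗ[ℤ_[p]] G // Function.Surjective f} ×
      {f : B →ₗ[ℤ_[p]] G // Function.Surjective f}) : Subdirect p A B :=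
  ⟨LinearMap.ker (x.1.1 ∘ₗ LinearMap.fst ℤ_[p] A B - x.2.1 ∘ₗ LinearMap.snd ℤ_[p] A B),
    fun a => (x.2.2 (x.1.1 a)).imp fun b hb => by
      rw [LinearMap.mem_ker, LinearMap.sub_apply, sub_eq_zero]
      exact hb.symm,
    fun b => (x.1.2 (x.2.1 b)).imp fun a ha => by
      rw [LinearMap.mem_ker, LinearMap.sub_apply, sub_eq_zero]
      exact ha⟩

theorem mem_fibreProduct {G : Type} [AddCommGroup G] [Module ℤ_[p] G]
    (x : {f : A →ₗ[ℤ_[p]] G // Function.Surjective f} ×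
      {f : B →ₗ[ℤ_[p]] G // Function.Surjective f}) (y : A × B) :
    y ∈ (fibreProduct x).1 ↔ x.1.1 y.1 = x.2.1 y.2 := by
  change y ∈ LinearMap.ker _ ↔ _
  rw [LinearMap.mem_ker, LinearMap.sub_apply, sub_eq_zero]
  rfl

/-- Goursat's lemma: the ways to write a subdirect product `R` as a fibre product over `G`
correspond to the isomorphisms from the common quotient of the factors to `G`. -/
theorem card_fibreProduct_eq {G : Type} [AddCommGroup G] [Module ℤ_[p] G] (R : Subdirect p A B) :
    Nat.card {x : {f : A →ₗ[ℤ_[p]] G // Function.Surjective f} ×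
      {f : B →ₗ[ℤ_[p]] G // Function.Surjective f} // fibreProduct x = R} =
      Nat.card ((A ⧸ R.leftKer) ≃ₗ[ℤ_[p]] G) := by
  have hker : ∀ x : {f : A →ₗ[ℤ_[p]] G // Function.Surjective f} ×
      {f : B →ₗ[ℤ_[p]] G // Function.Surjective f}, fibreProduct x = R →
      R.leftKer = LinearMap.ker x.1.1 := by
    rintro x rfl
    ext a
    change (a, (0 : B)) ∈ (fibreProduct x).1 ↔ _
    rw [mem_fibreProduct, map_zero]
    rfl
  refine Nat.card_congr (Equiv.ofBijective (fun x =>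
    (Submodule.quotEquivOfEq _ _ (hker x.1 x.2)).trans
      (x.1.1.1.quotKerEquivOfSurjective x.1.1.2)) ⟨?_, fun e => ?_⟩)
  · rintro ⟨x, hx⟩ ⟨y, hy⟩ hxy
    have h1 : ∀ a, x.1.1 a = y.1.1 a := fun a => DFunLike.congr_fun hxy (Submodule.Quotient.mk a)
    refine Subtype.ext (Prod.ext (Subtype.ext (LinearMap.ext h1))
      (Subtype.ext (LinearMap.ext fun b => ?_)))
    obtain ⟨a, ha⟩ := R.2.2 b
    have h2 := (mem_fibreProduct x (a, b)).1 (hx ▸ ha)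
    have h3 := (mem_fibreProduct y (a, b)).1 (hy ▸ ha)
    exact h2.symm.trans ((h1 a).trans h3)
  · let f : A →ₗ[ℤ_[p]] G := e.toLinearMap ∘ₗ R.leftKer.mkQ
    have hf : Function.Surjective f := e.surjective.comp R.leftKer.mkQ_surjective
    have hf0 : ∀ a, f a = 0 ↔ (a, (0 : B)) ∈ R.1 := fun a => by
      change e (Submodule.Quotient.mk a) = 0 ↔ _
      rw [LinearEquiv.map_eq_zero_iff, Submodule.Quotient.mk_eq_zero]
      rfl
    let s : R.1 →ₗ[ℤ_[p]] B := LinearMap.snd ℤ_[p] A B ∘ₗ R.1.subtype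
    have hs : Function.Surjective s := fun b =>
      let ⟨a, ha⟩ := R.2.2 b
      ⟨⟨_, ha⟩, rfl⟩
    -- `g b` is the common value of `f a` for the `a` with `(a, b) ∈ R`
    obtain ⟨g, hg⟩ := LinearMap.exists_comp_eq_of_ker_le hs
      (f := f ∘ₗ LinearMap.fst ℤ_[p] A B ∘ₗ R.1.subtype) (by
        rintro ⟨⟨a, b⟩, hab⟩ h
        obtain rfl : b = 0 := h
        exact (hf0 a).2 hab)
    have hg' : ∀ a b, (a, b) ∈ R.1 → g b = f a := fun a b h => hg ⟨_, h⟩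
    have hgs : Function.Surjective g := fun y => by
      obtain ⟨a, rfl⟩ := hf y
      obtain ⟨b, hb⟩ := R.2.1 a
      exact ⟨b, hg' a b hb⟩
    refine ⟨⟨⟨⟨f, hf⟩, ⟨g, hgs⟩⟩, Subtype.ext ?_⟩, ?_⟩
    · ext ⟨a, b⟩
      rw [mem_fibreProduct]
      constructor
      · intro h
        obtain ⟨b', hb'⟩ := R.2.1 a
        obtain ⟨a', ha'⟩ := R.2.2 b
        have h1 : f (a - a') = 0 := by
          rw [map_sub, sub_eq_zero, ← hg' _ _ ha']
          exact h
        have h2 := R.1.add_mem ((hf0 _).1 h1) ha'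
        simpa using h2
      · exact fun h => (hg' a b h).symm
    · ext y
      obtain ⟨a, rfl⟩ := Submodule.Quotient.mk_surjective _ y
      rfl

end

theorem autWeight_mul_cardAut (G : X₀ p) : autWeight G * (cardAut G : ENNReal) = 1 := by
  have h : (0 : ℝ) < cardAut G := by exact_mod_cast cardAut_pos G
  rw [autWeight, ENNReal.ofReal_inv_of_pos h, ENNReal.ofReal_natCast]
  exact ENNReal.inv_mul_cancel (by exact_mod_cast (cardAut_pos G).ne') (ENNReal.natCast_ne_top _)

/-- The Gram matrix of the measures `#Sur(F, ·) / #Aut(·)`. -/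
theorem tsum_autWeight_mul_cardSur_from (F F' : X₀ p) :
    ∑' G, autWeight G * ((cardSur F G : ENNReal) * cardSur F' G) =
      Nat.card (Subdirect p F.grp F'.grp) := by
  classical
  have := Fintype.ofFinite (Subdirect p F.grp F'.grp)
  have h1 : ∀ G : X₀ p, cardSur F G * cardSur F' G = ∑ R : Subdirect p F.grp F'.grp,
      if toX₀ p (F.grp ⧸ R.leftKer) = G then cardAut G else 0 := fun G => by
    rw [cardSur, cardSur, ← Nat.card_prod, Nat.card_congr (Equiv.sigmaFiberEquiv
      (fibreProduct (A := F.grp) (B := F'.grp) (G := G.grp))).symm, Nat.card_sigma]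
    refine Finset.sum_congr rfl fun R _ => ?_
    rw [card_fibreProduct_eq, card_linearEquiv]
  have h2 : ∀ G : X₀ p, autWeight G * ((cardSur F G : ENNReal) * cardSur F' G) =
      ∑ R : Subdirect p F.grp F'.grp, if G = toX₀ p (F.grp ⧸ R.leftKer) then 1 else 0 := fun G => by
    rw [← Nat.cast_mul, h1, Nat.cast_sum, Finset.mul_sum]
    refine Finset.sum_congr rfl fun R _ => ?_
    by_cases h : toX₀ p (F.grp ⧸ R.leftKer) = G
    · rw [if_pos h, if_pos h.symm, autWeight_mul_cardAut]
    · rw [if_neg h, if_neg (Ne.symm h), Nat.cast_zero, mul_zero]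
  rw [tsum_congr h2, Summable.tsum_finsetSum fun _ _ => ENNReal.summable]
  simp only [tsum_ite_eq, Finset.sum_const, Finset.card_univ, nsmul_eq_mul, mul_one,
    Nat.card_eq_fintype_card]

/-- The Gram matrix of the measures `#Sur(·, F) / #Aut(·)`: it is governed by surjection moments,
one for each subdirect product. -/
theorem tsum_autWeight_mul_cardSur_to (F F' : X₀ p) :
    ∑' G, autWeight G * ((cardSur G F : ENNReal) * cardSur G F') =
      Nat.card (Subdirect p F.grp F'.grp) * ENNReal.ofReal (cohenLenstraConst p)⁻¹ := by
  have := Fintype.ofFinite (Subdirect p F.grp F'.grp)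
  have h1 : ∀ G : X₀ p, autWeight G * ((cardSur G F : ENNReal) * cardSur G F') =
      ∑ R : Subdirect p F.grp F'.grp, autWeight G * (cardSur G (toX₀ p R.1) : ENNReal) := fun G => by
    rw [← Nat.cast_mul]
    change autWeight G * ((numSur p G.grp F.grp * numSur p G.grp F'.grp : ℕ) : ENNReal) = _
    rw [numSur_mul_numSur, Nat.cast_sum, Finset.mul_sum]
    exact Finset.sum_congr rfl fun R _ => by rw [cardSur_toX₀_right]
  rw [tsum_congr h1, Summable.tsum_finsetSum fun _ _ => ENNReal.summable,
    Finset.sum_congr rfl fun R _ => tsum_autWeight_mul_cardSur _, Finset.sum_const,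
    Finset.card_univ, nsmul_eq_mul, Nat.card_eq_fintype_card]

/-! ### Averaging surjections over cyclic quotients of the source -/

/-- Double counting of the pairs of a surjection `F → G` and an element of its kernel. -/
theorem sum_numSur_quotient_span (F G : X₀ p) [Fintype F.grp] :
    (∑ x : F.grp, cardSur (toX₀ p (F.grp ⧸ Submodule.span ℤ_[p] {x})) G) * cardGrp G =
      cardSur F G * cardGrp F := by
  classical
  have := Fintype.ofFinite {f : F.grp →ₗ[ℤ_[p]] G.grp // Function.Surjective f}
  have h1 : ∀ x : F.grp, cardSur (toX₀ p (F.grp ⧸ Submodule.span ℤ_[p] {x})) G =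
      ∑ f : {f : F.grp →ₗ[ℤ_[p]] G.grp // Function.Surjective f}, if f.1 x = 0 then 1 else 0 := by
    intro x
    rw [cardSur_toX₀_left, Finset.sum_boole, Nat.cast_id, ← Fintype.card_subtype,
      ← Nat.card_eq_fintype_card]
    refine Nat.card_congr (Equiv.ofBijective (fun g => ⟨⟨g.1 ∘ₗ Submodule.mkQ _,
      g.2.comp (Submodule.mkQ_surjective _)⟩, ?_⟩) ⟨?_, ?_⟩)
    · change g.1 (Submodule.Quotient.mk x) = 0
      rw [(Submodule.Quotient.mk_eq_zero _).2 (Submodule.mem_span_singleton_self x), map_zero]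
    · intro g g' h
      refine Subtype.ext (Submodule.linearMap_qext _ ?_)
      exact congrArg (fun y => y.1.1) h
    · rintro ⟨⟨f, hf⟩, hx⟩
      have hle : Submodule.span ℤ_[p] {x} ≤ LinearMap.ker f := by
        rw [Submodule.span_le, Set.singleton_subset_iff]
        exact hx
      refine ⟨⟨Submodule.liftQ _ f hle, fun y => ?_⟩, ?_⟩
      · obtain ⟨a, rfl⟩ := hf y
        exact ⟨Submodule.Quotient.mk a, rfl⟩
      · refine Subtype.ext (Subtype.ext ?_)
        exact Submodule.liftQ_mkQ _ _ _
  rw [Finset.sum_congr rfl fun x _ => h1 x, Finset.sum_comm, Finset.sum_mul]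
  have h2 : ∀ f : {f : F.grp →ₗ[ℤ_[p]] G.grp // Function.Surjective f},
      (∑ x : F.grp, if f.1 x = 0 then 1 else 0) * cardGrp G = cardGrp F := fun f => by
    have h3 := LinearMap.card_eq_card_range_mul_card_ker f.1
    rw [LinearMap.range_eq_top.2 f.2, Nat.card_congr (Submodule.topEquiv (R := ℤ_[p])).toEquiv] at h3
    rw [Finset.sum_boole, Nat.cast_id, ← Fintype.card_subtype, ← Nat.card_eq_fintype_card, mul_comm]
    exact h3.symm
  rw [Finset.sum_congr rfl fun f _ => h2 f, Finset.sum_const, Finset.card_univ, smul_eq_mul,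
    ← Nat.card_eq_fintype_card]
  rfl
/-! ### The Hilbert space -/

theorem L2Star.inner_def (a b : L2Star p) : inner ℝ a b = ∑' G, a.1 G * b.1 G / mu₀ G := rfl

/-- The mass at a point, as a linear functional. -/
def L2Star.mass (G : X₀ p) : L2Star p →ₗ[ℝ] ℝ where
  toFun ν := ν.1 G
  map_add' _ _ := rfl
  map_smul' _ _ := rfl

theorem L2Star.ext_mass {a b : L2Star p} (h : ∀ G, L2Star.mass G a = L2Star.mass G b) : a = b :=
  Subtype.ext (funext h)

theorem L2Star.norm_sq (a : L2Star p) : ‖a‖ ^ 2 = ∑' G, a.1 G ^ 2 / mu₀ G := by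
  rw [← real_inner_self_eq_norm_sq, L2Star.inner_def]
  exact tsum_congr fun G => by rw [sq]

theorem memLp_div_sqrt_mu₀ (ν : L2Star p) : Memℓp (fun G => ν.1 G / √(mu₀ G)) 2 := by
  refine memℓp_gen ?_
  have h : ∀ G, ‖ν.1 G / √(mu₀ G)‖ ^ (2 : ENNReal).toReal = ν.1 G ^ 2 / mu₀ G := fun G => by
    rw [ENNReal.toReal_ofNat, Real.rpow_two, Real.norm_eq_abs, sq_abs, div_pow,
      Real.sq_sqrt (mu₀_pos G).le]
  simp only [h]
  exact ν.2

theorem mul_sqrt_mu₀_mem (f : lp (fun _ : X₀ p => ℝ) 2) :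
    (fun G => f G * √(mu₀ G)) ∈ squareSummable p := by
  have h := (memℓp_gen_iff (by norm_num)).1 (lp.memℓp f)
  refine h.congr fun G => ?_
  have hG := mu₀_pos G
  rw [ENNReal.toReal_ofNat, Real.rpow_two, Real.norm_eq_abs, sq_abs, mul_pow, Real.sq_sqrt hG.le,
    mul_div_cancel_right₀ _ hG.ne']

/-- Rescaling by `√μ₀` identifies `L²(X₀, μ₀)*` with `ℓ²(X₀)`. -/
def L2Star.equivLp (p : ℕ) [Fact p.Prime] : L2Star p ≃ₗᵢ[ℝ] lp (fun _ : X₀ p => ℝ) 2 :=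
  LinearEquiv.isometryOfInner
    { toFun := fun ν => ⟨fun G => ν.1 G / √(mu₀ G), memLp_div_sqrt_mu₀ ν⟩
      invFun := fun f => ⟨fun G => f G * √(mu₀ G), mul_sqrt_mu₀_mem f⟩
      map_add' := fun a b => lp.ext (funext fun G => add_div (a.1 G) (b.1 G) _)
      map_smul' := fun c a => lp.ext (funext fun G => mul_div_assoc c (a.1 G) _)
      left_inv := fun ν => Subtype.ext (funext fun G =>
        div_mul_cancel₀ _ (Real.sqrt_pos.2 (mu₀_pos G)).ne')
      right_inv := fun f => lp.ext (funext fun G =>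
        mul_div_cancel_right₀ _ (Real.sqrt_pos.2 (mu₀_pos G)).ne') }
    fun a b => by
      rw [lp.inner_eq_tsum, L2Star.inner_def]
      refine tsum_congr fun G => ?_
      change b.1 G / √(mu₀ G) * (a.1 G / √(mu₀ G)) = _
      rw [div_mul_div_comm, Real.mul_self_sqrt (mu₀_pos G).le, mul_comm]

instance L2Star.completeSpace : CompleteSpace (L2Star p) :=
  (completeSpace_congr (e := (L2Star.equivLp p).toEquiv)
    (L2Star.equivLp p).isometry.isUniformEmbedding).2 inferInstance

theorem dense_span_unitAt :
    (Submodule.span ℝ (Set.range (unitAt (p := p)))).topologicalClosure = ⊤ := by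
  classical
  let b : HilbertBasis (X₀ p) ℝ (L2Star p) := HilbertBasis.ofRepr (L2Star.equivLp p)
  have h : ⇑b = unitAt (p := p) := by
    funext G
    rw [← b.repr_symm_single]
    refine (L2Star.equivLp p).injective ?_
    rw [LinearIsometryEquiv.apply_symm_apply]
    refine lp.ext (funext fun G' => ?_)
    change _ = (Pi.single G (√(mu₀ G)) : X₀ p → ℝ) G' / √(mu₀ G')
    rcases eq_or_ne G' G with rfl | h
    · rw [lp.single_apply_self, Pi.single_eq_same, div_self (Real.sqrt_pos.2 (mu₀_pos G')).ne']
    · rw [lp.single_apply_ne _ _ _ h, Pi.single_eq_of_ne h, zero_div]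
  rw [← h]
  exact b.dense_span

theorem cardSur_self (F : X₀ p) : cardSur F F = cardAut F :=
  Nat.card_congr ⟨fun f => LinearEquiv.ofBijective f.1 ⟨Finite.injective_iff_surjective.2 f.2, f.2⟩,
    fun e => ⟨e.toLinearMap, e.surjective⟩, fun _ => rfl, fun _ => LinearEquiv.ext fun _ => rfl⟩

theorem cardGrp_lt_of_cardSur_ne_zero {F G : X₀ p} (h : cardSur F G ≠ 0) (hne : G ≠ F) :
    cardGrp G < cardGrp F := by
  obtain ⟨⟨f, hf⟩⟩ := (Nat.card_ne_zero.1 h).1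
  refine lt_of_le_of_ne (Nat.card_le_card_of_surjective f hf) fun heq => hne ?_
  have hb := (Nat.bijective_iff_surjective_and_card f).2 ⟨hf, heq.symm⟩
  rw [← toX₀_grp F, eq_comm, toX₀_eq_iff]
  exact ⟨LinearEquiv.ofBijective f hb⟩

/-- The measures `#Sur(F, ·) / #Aut(·)` are unitriangular with respect to the point masses. -/
theorem unitAt_mem_span_surFrom (F : X₀ p) :
    unitAt F ∈ Submodule.span ℝ (Set.range (surFrom (p := p))) := by
  classical
  induction hn : cardGrp F using Nat.strong_induction_on generalizing F with
  | _ n ih =>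
    subst hn
    have hs := surFromFun_finite_support F
    have hF0 : √(mu₀ F) ≠ 0 := (Real.sqrt_pos.2 (mu₀_pos F)).ne'
    have hFF : surFromFun F F = 1 := by
      rw [surFromFun, cardSur_self]
      exact div_self (by exact_mod_cast (cardAut_pos F).ne')
    have key : unitAt F = √(mu₀ F) • (surFrom F - ∑ G ∈ hs.toFinset.erase F,
        (surFromFun F G / √(mu₀ G)) • unitAt G) := by
      refine L2Star.ext_mass fun K => ?_
      rw [map_smul, map_sub, map_sum]
      have h1 : ∀ G, L2Star.mass K ((surFromFun F G / √(mu₀ G)) • unitAt G) =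
          if K = G then surFromFun F G else 0 := fun G => by
        rw [map_smul]
        change surFromFun F G / √(mu₀ G) * (Pi.single G (√(mu₀ G)) : X₀ p → ℝ) K = _
        rw [Pi.single_apply]
        split_ifs with h
        · exact div_mul_cancel₀ _ (Real.sqrt_pos.2 (mu₀_pos G)).ne'
        · rw [mul_zero]
      rw [Finset.sum_congr rfl fun G _ => h1 G, Finset.sum_ite_eq]
      change (Pi.single F (√(mu₀ F)) : X₀ p → ℝ) K = √(mu₀ F) * (surFromFun F K - _)
      by_cases hK : K = F
      · subst hK
        rw [Pi.single_eq_same, if_neg (Finset.notMem_erase _ _), hFF, sub_zero, mul_one]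
      · rw [Pi.single_eq_of_ne hK]
        split_ifs with h
        · rw [sub_self, mul_zero]
        · have : surFromFun F K = 0 := by simpa [hK] using h
          rw [this, sub_zero, mul_zero]
    rw [key]
    refine Submodule.smul_mem _ _ (Submodule.sub_mem _ (Submodule.subset_span ⟨F, rfl⟩)
      (Submodule.sum_mem _ fun G hG => Submodule.smul_mem _ _ (ih _ ?_ G rfl)))
    have hG' : surFromFun F G ≠ 0 := by simpa using (Finset.mem_of_mem_erase hG)
    refine cardGrp_lt_of_cardSur_ne_zero (fun h0 => hG' ?_) (Finset.ne_of_mem_erase hG)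
    rw [surFromFun, h0, Nat.cast_zero, zero_div]

theorem dense_span_surFrom :
    (Submodule.span ℝ (Set.range (surFrom (p := p)))).topologicalClosure = ⊤ := by
  rw [← top_le_iff, ← dense_span_unitAt]
  refine Submodule.topologicalClosure_mono (Submodule.span_le.2 ?_)
  rintro _ ⟨F, rfl⟩
  exact unitAt_mem_span_surFrom F

theorem ext_of_eq_on_surFrom {E : Type*} [NormedAddCommGroup E] [NormedSpace ℝ E]
    {S T : L2Star p →L[ℝ] E} (h : ∀ F, S (surFrom F) = T (surFrom F)) : S = T := by
  refine ContinuousLinearMap.ext_on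
    (Submodule.dense_iff_topologicalClosure_eq_top.2 dense_span_surFrom) ?_
  rintro _ ⟨F, rfl⟩
  exact h F

/-- Two families with the same Gram matrix, the first with dense span, are related by a linear
isometry. -/
theorem exists_linearIsometry_of_inner_eq {ι E E' : Type*} [NormedAddCommGroup E]
    [InnerProductSpace ℝ E] [NormedAddCommGroup E'] [InnerProductSpace ℝ E'] [CompleteSpace E']
    {u : ι → E} {v : ι → E'} (hu : (Submodule.span ℝ (Set.range u)).topologicalClosure = ⊤)
    (h : ∀ i j, inner ℝ (u i) (u j) = inner ℝ (v i) (v j)) :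
    ∃ T : E →ₗᵢ[ℝ] E', ∀ i, T (u i) = v i := by
  let U := Finsupp.linearCombination ℝ u
  let V := Finsupp.linearCombination ℝ v
  have hU : DenseRange U := by
    rw [DenseRange, ← LinearMap.coe_range, Finsupp.range_linearCombination,
      Submodule.dense_iff_topologicalClosure_eq_top]
    exact hu
  have hn : ∀ x, ‖V x‖ = ‖U x‖ := fun x => by
    rw [← sq_eq_sq₀ (norm_nonneg _) (norm_nonneg _), ← real_inner_self_eq_norm_sq,
      ← real_inner_self_eq_norm_sq]
    simp only [U, V, Finsupp.linearCombination_apply, Finsupp.sum_inner, Finsupp.inner_sum,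
      real_inner_smul_left, real_inner_smul_right, h]
  have hn' : ∃ C, ∀ x, ‖V x‖ ≤ C * ‖U x‖ := ⟨1, fun x => by rw [hn, one_mul]⟩
  refine ⟨⟨(V.extendOfNorm U).toLinearMap, fun x => ?_⟩, fun i => ?_⟩
  · refine hU.induction_on (p := fun x => ‖V.extendOfNorm U x‖ = ‖x‖) x
      (isClosed_eq (by fun_prop) (by fun_prop)) fun y => ?_
    rw [LinearMap.extendOfNorm_eq hU hn', hn]
  · have h1 := LinearMap.extendOfNorm_eq hU hn' (Finsupp.single i 1)
    simpa [U, V] using h1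

/-! ### The isometry -/

theorem hasSum_of_tsum_autWeight_mul {f : X₀ p → ℕ} {c : ENNReal} (hc : c ≠ ⊤)
    (h : ∑' G, autWeight G * (f G : ENNReal) = c) :
    HasSum (fun G => (f G : ℝ) / cardAut G) c.toReal := by
  have h1 : ∀ G, (autWeight G * (f G : ENNReal)).toReal = (f G : ℝ) / cardAut G := fun G => by
    rw [ENNReal.toReal_mul, autWeight, ENNReal.toReal_ofReal (by positivity),
      ENNReal.toReal_natCast, div_eq_inv_mul]
  have h2 := ENNReal.hasSum_toReal (h.trans_ne hc)
  rw [← ENNReal.tsum_toReal_eq fun G => ne_top_of_le_ne_top (h.trans_ne hc) (ENNReal.le_tsum G),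
    h] at h2
  simpa only [h1] using h2

theorem hasSum_cardSur_from (F F' : X₀ p) :
    HasSum (fun G => ((cardSur F G * cardSur F' G : ℕ) : ℝ) / cardAut G)
      (Nat.card (Subdirect p F.grp F'.grp)) := by
  have h := hasSum_of_tsum_autWeight_mul (f := fun G => cardSur F G * cardSur F' G)
    (ENNReal.natCast_ne_top _) (by
      simpa only [Nat.cast_mul] using tsum_autWeight_mul_cardSur_from F F')
  rwa [ENNReal.toReal_natCast] at h

theorem hasSum_cardSur_to (F F' : X₀ p) :
    HasSum (fun G => ((cardSur G F * cardSur G F' : ℕ) : ℝ) / cardAut G)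
      (Nat.card (Subdirect p F.grp F'.grp) * (cohenLenstraConst p)⁻¹) := by
  have h := hasSum_of_tsum_autWeight_mul (f := fun G => cardSur G F * cardSur G F')
    (ENNReal.mul_ne_top (ENNReal.natCast_ne_top _) ENNReal.ofReal_ne_top) (by
      simpa only [Nat.cast_mul] using tsum_autWeight_mul_cardSur_to F F')
  rwa [ENNReal.toReal_mul, ENNReal.toReal_natCast,
    ENNReal.toReal_ofReal (inv_pos.2 (cohenLenstraConst_pos p)).le] at h

/-- The measure `√c₀ #Sur(·, F) / #Aut(·)`, as an element of `L²(X₀, μ₀)*`. -/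
def surTo (F : X₀ p) : L2Star p :=
  ⟨√(cohenLenstraConst p) • surToFun F, by
    refine (hasSum_cardSur_to F F).summable.congr fun G => ?_
    have hc := cohenLenstraConst_pos p
    have hA : (0 : ℝ) < cardAut G := by exact_mod_cast cardAut_pos G
    change _ = (√(cohenLenstraConst p) * ((cardSur G F : ℝ) / cardAut G)) ^ 2 /
      (cohenLenstraConst p / cardAut G)
    rw [mul_pow, Real.sq_sqrt hc.le, Nat.cast_mul]
    field_simp⟩

theorem inner_surFrom_eq_inner_surTo (F F' : X₀ p) :
    inner ℝ (surFrom F) (surFrom F') = inner ℝ (surTo F) (surTo F') := by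
  have hc := cohenLenstraConst_pos p
  have h1 : inner ℝ (surFrom F) (surFrom F') =
      Nat.card (Subdirect p F.grp F'.grp) * (cohenLenstraConst p)⁻¹ := by
    rw [L2Star.inner_def, ← (hasSum_cardSur_from F F').tsum_eq, ← tsum_mul_right]
    refine tsum_congr fun G => ?_
    have hA : (0 : ℝ) < cardAut G := by exact_mod_cast cardAut_pos G
    change (cardSur F G : ℝ) / cardAut G * ((cardSur F' G : ℝ) / cardAut G) /
      (cohenLenstraConst p / cardAut G) = _
    rw [Nat.cast_mul]
    field_simp
  rw [h1, L2Star.inner_def, ← (hasSum_cardSur_to F F').tsum_eq]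
  refine tsum_congr fun G => ?_
  have hA : (0 : ℝ) < cardAut G := by exact_mod_cast cardAut_pos G
  change _ = √(cohenLenstraConst p) * ((cardSur G F : ℝ) / cardAut G) *
    (√(cohenLenstraConst p) * ((cardSur G F' : ℝ) / cardAut G)) / (cohenLenstraConst p / cardAut G)
  rw [mul_mul_mul_comm, Real.mul_self_sqrt hc.le, Nat.cast_mul]
  field_simp

/-- The two Gram matrices agree, so that `#Sur(F, ·) / #Aut(·) ↦ √c₀ #Sur(·, F) / #Aut(·)` extends
to an isometry. -/
theorem exists_linearIsometry_surFrom_eq_surTo (p : ℕ) [Fact p.Prime] :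
    ∃ T : L2Star p →ₗᵢ[ℝ] L2Star p, ∀ F, T (surFrom F) = surTo F :=
  exists_linearIsometry_of_inner_eq dense_span_surFrom inner_surFrom_eq_inner_surTo

theorem mulInvCard_unitAt (G : X₀ p) : mulInvCard (unitAt G) = (1 / (cardGrp G : ℝ)) • unitAt G := by
  classical
  refine Subtype.ext (funext fun K => ?_)
  change (cardGrp K : ℝ)⁻¹ * (Pi.single G (√(mu₀ G)) : X₀ p → ℝ) K =
    1 / (cardGrp G : ℝ) * (Pi.single G (√(mu₀ G)) : X₀ p → ℝ) K
  rcases eq_or_ne K G with rfl | h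
  · rw [one_div]
  · rw [Pi.single_eq_of_ne h, mul_zero, mul_zero]

theorem unitAt_ne_zero (G : X₀ p) : unitAt G ≠ 0 := fun h => by
  classical
  have h1 : (Pi.single G (√(mu₀ G)) : X₀ p → ℝ) G = 0 := congrFun (congrArg Subtype.val h) G
  rw [Pi.single_eq_same] at h1
  exact (Real.sqrt_pos.2 (mu₀_pos G)).ne' h1

/-- The diagonal operator `f ↦ |G|⁻¹ f` as a bounded operator. -/
def mulInvCardL (p : ℕ) [Fact p.Prime] : L2Star p →L[ℝ] L2Star p :=
  LinearMap.mkContinuous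
    { toFun := mulInvCard
      map_add' := fun a b => Subtype.ext (funext fun G => mul_add (cardGrp G : ℝ)⁻¹ (a.1 G) (b.1 G))
      map_smul' := fun c a => Subtype.ext (funext fun G =>
        mul_left_comm (cardGrp G : ℝ)⁻¹ c (a.1 G)) } 1 fun a => by
    rw [one_mul]
    refine (sq_le_sq₀ (norm_nonneg _) (norm_nonneg _)).1 ?_
    rw [L2Star.norm_sq, L2Star.norm_sq]
    refine Summable.tsum_le_tsum (fun G => ?_) (mulInvCard a).2 a.2
    refine div_le_div_of_nonneg_right ?_ (mu₀_pos G).le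
    change ((cardGrp G : ℝ)⁻¹ * a.1 G) ^ 2 ≤ _
    have h1 : (1 : ℝ) ≤ cardGrp G := by exact_mod_cast cardGrp_pos G
    rw [mul_pow]
    exact mul_le_of_le_one_left (sq_nonneg _)
      (pow_le_one₀ (by positivity) (inv_le_one_of_one_le₀ h1))

theorem mulInvCard_surFrom (F : X₀ p) [Fintype F.grp] :
    mulInvCard (surFrom F) = (cardGrp F : ℝ)⁻¹ •
      ∑ x : F.grp, surFrom (toX₀ p (F.grp ⧸ Submodule.span ℤ_[p] {x})) := by
  refine L2Star.ext_mass fun G => ?_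
  rw [map_smul, map_sum]
  change (cardGrp G : ℝ)⁻¹ * ((cardSur F G : ℝ) / cardAut G) = (cardGrp F : ℝ)⁻¹ * ∑ x : F.grp,
    ((cardSur (toX₀ p (F.grp ⧸ Submodule.span ℤ_[p] {x})) G : ℝ) / cardAut G)
  have h := congrArg (Nat.cast (R := ℝ)) (sum_numSur_quotient_span F G)
  rw [Nat.cast_mul, Nat.cast_mul, Nat.cast_sum] at h
  have hF : (0 : ℝ) < cardGrp F := by exact_mod_cast cardGrp_pos F
  have hG : (0 : ℝ) < cardGrp G := by exact_mod_cast cardGrp_pos G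
  have hA : (0 : ℝ) < cardAut G := by exact_mod_cast cardAut_pos G
  rw [← Finset.sum_div]
  field_simp
  linarith
/-! ### Boundedness of the Laplacian -/

/-- Jensen's inequality for a Markov kernel `P` carrying the weights `a` to the weights `m`:
`ν ↦ ν P` is a contraction for the norms `∑ ν² / a` and `∑ ν² / m`. -/
theorem summable_and_tsum_sq_div_le {X Y : Type*} {a : X → ℝ} {m : Y → ℝ} {P : X → Y → ℝ}
    (ha : ∀ x, 0 < a x) (hm : ∀ y, 0 < m y) (hP : ∀ x y, 0 ≤ P x y) (hP1 : ∀ x, HasSum (P x) 1)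
    (hst : ∀ y, HasSum (fun x => a x * P x y) (m y)) {ν : X → ℝ}
    (hν : Summable fun x => ν x ^ 2 / a x) :
    (∀ y, Summable fun x => ν x * P x y) ∧
      (Summable fun y => (∑' x, ν x * P x y) ^ 2 / m y) ∧
      ∑' y, (∑' x, ν x * P x y) ^ 2 / m y ≤ ∑' x, ν x ^ 2 / a x := by
  have hνn : ∀ x, 0 ≤ ν x ^ 2 / a x := fun x => div_nonneg (sq_nonneg _) (ha x).le
  have hprod : Summable fun z : X × Y => ν z.1 ^ 2 / a z.1 * P z.1 z.2 := by
    refine (summable_prod_of_nonneg fun z => mul_nonneg (hνn _) (hP _ _)).2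
      ⟨fun x => (hP1 x).summable.mul_left (ν x ^ 2 / a x), hν.congr fun x => ?_⟩
    exact ((tsum_mul_left (a := ν x ^ 2 / a x)).trans (by rw [(hP1 x).tsum_eq, mul_one])).symm
  have hS : ∀ y, Summable fun x => ν x ^ 2 / a x * P x y := fun y =>
    hprod.comp_injective (i := fun x => (x, y)) fun _ _ h => congrArg Prod.fst h
  have h1 : ∀ y, Summable fun x => ν x * P x y := fun y => by
    refine Summable.of_norm_bounded ((hS y).add (hst y).summable) fun x => ?_
    rw [Real.norm_eq_abs, abs_mul, abs_of_nonneg (hP x y), ← add_mul]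
    refine mul_le_mul_of_nonneg_right ?_ (hP x y)
    have hax := ha x
    rw [div_add' _ _ _ hax.ne', le_div_iff₀ hax]
    nlinarith [sq_nonneg (|ν x| - a x), sq_abs (ν x), sq_nonneg (ν x), sq_nonneg (a x)]
  -- the variance of `ν / a` under the probability weights `a x * P x y / m y` is nonnegative
  have h2 : ∀ y, (∑' x, ν x * P x y) ^ 2 / m y ≤ ∑' x, ν x ^ 2 / a x * P x y := fun y => by
    set w := ∑' x, ν x * P x y with hw
    have hmy := hm y
    have h3 := (((hS y).hasSum.sub ((h1 y).hasSum.mul_left (2 * (w / m y)))).add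
      ((hst y).mul_left ((w / m y) ^ 2))).nonneg fun x => by
        have hax := ha x
        have : ν x ^ 2 / a x * P x y - 2 * (w / m y) * (ν x * P x y) +
            (w / m y) ^ 2 * (a x * P x y) = (ν x - w / m y * a x) ^ 2 / a x * P x y := by
          field_simp
          ring
        rw [this]
        exact mul_nonneg (div_nonneg (sq_nonneg _) hax.le) (hP x y)
    rw [← hw] at h3
    have h4 : 2 * (w / m y) * w - (w / m y) ^ 2 * m y = w ^ 2 / m y := by
      field_simp
      ring
    linarith
  have hSy : Summable fun y => ∑' x, ν x ^ 2 / a x * P x y := hprod.prod_symm.prod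
  have h5 := Summable.of_nonneg_of_le (fun y => div_nonneg (sq_nonneg _) (hm y).le) h2 hSy
  refine ⟨h1, h5, (Summable.tsum_le_tsum h2 h5 hSy).trans (le_of_eq ?_)⟩
  rw [Summable.tsum_comm (f := fun x y => ν x ^ 2 / a x * P x y) hprod]
  exact tsum_congr fun x => by rw [tsum_mul_left, (hP1 x).tsum_eq, mul_one]

theorem hasSum_one_of_tsum_ofReal {X : Type*} {f : X → ℝ} (hf : ∀ x, 0 ≤ f x)
    (h : ∑' x, ENNReal.ofReal (f x) = 1) : HasSum f 1 := by
  have hne : ∑' x, ENNReal.ofReal (f x) ≠ ⊤ := h.trans_ne ENNReal.one_ne_top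
  have h1 := ENNReal.hasSum_toReal hne
  rw [← ENNReal.tsum_toReal_eq fun x => ENNReal.ofReal_ne_top, h, ENNReal.toReal_one] at h1
  simpa only [ENNReal.toReal_ofReal (hf _)] using h1

theorem hasSum_probDStar (G : X₀ p) : HasSum (probDStar G) 1 :=
  hasSum_one_of_tsum_ofReal (probDStar_nonneg G) (tsum_probDStar G)

theorem hasSum_probD (H : X₁ p) : HasSum (probD H) 1 :=
  hasSum_one_of_tsum_ofReal (probD_nonneg H) (tsum_probD H)

theorem mu₀_mul_probDStar (G : X₀ p) (H : X₁ p) :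
    mu₀ G * probDStar G H = cohenLenstraConst p * rankOneWeight H * probD H G := by
  rw [mu₀, div_eq_mul_inv, mul_assoc, detailed_balance, mul_assoc]

theorem rankOneMeasure_pos (H : X₁ p) : 0 < cohenLenstraConst p * rankOneWeight H :=
  mul_pos (cohenLenstraConst_pos p) (rankOneWeight_pos H)

theorem dStar_bounded (ν : L2Star p) :
    (∀ H, Summable fun G => ν.1 G * probDStar G H) ∧
      (Summable fun H => dStar ν.1 H ^ 2 / (cohenLenstraConst p * rankOneWeight H)) ∧
      ∑' H, dStar ν.1 H ^ 2 / (cohenLenstraConst p * rankOneWeight H) ≤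
        ∑' G, ν.1 G ^ 2 / mu₀ G :=
  summable_and_tsum_sq_div_le mu₀_pos rankOneMeasure_pos probDStar_nonneg hasSum_probDStar
    (fun H => by
      simp only [mu₀_mul_probDStar]
      simpa only [mul_one] using (hasSum_probD H).mul_left (cohenLenstraConst p * rankOneWeight H))
    ν.2

theorem dOp_dStar_bounded (ν : L2Star p) :
    (∀ G, Summable fun H => dStar ν.1 H * probD H G) ∧
      (Summable fun G => dOp (dStar ν.1) G ^ 2 / mu₀ G) ∧
      ∑' G, dOp (dStar ν.1) G ^ 2 / mu₀ G ≤ ∑' G, ν.1 G ^ 2 / mu₀ G := by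
  have h := summable_and_tsum_sq_div_le rankOneMeasure_pos mu₀_pos probD_nonneg hasSum_probD
    (fun G => by
      simp only [← mu₀_mul_probDStar]
      simpa only [mul_one] using (hasSum_probDStar G).mul_left (mu₀ G)) (dStar_bounded ν).2.1
  exact ⟨h.1, h.2.1, h.2.2.trans (dStar_bounded ν).2.2⟩

/-- The operator `Δ₀ = d d*` on `L²(X₀, μ₀)*`. -/
def laplacian (p : ℕ) [Fact p.Prime] : L2Star p →L[ℝ] L2Star p :=
  LinearMap.mkContinuous
    { toFun := fun ν => ⟨dOp (dStar ν.1), (dOp_dStar_bounded ν).2.1⟩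
      map_add' := fun a b => by
        have h1 : ∀ H, dStar (a + b).1 H = dStar a.1 H + dStar b.1 H := fun H => by
          rw [dStar, dStar, dStar, ← ((dStar_bounded a).1 H).tsum_add ((dStar_bounded b).1 H)]
          exact tsum_congr fun G => add_mul (a.1 G) (b.1 G) _
        refine Subtype.ext (funext fun G => ?_)
        change dOp (dStar (a + b).1) G = dOp (dStar a.1) G + dOp (dStar b.1) G
        rw [dOp, dOp, dOp, ← ((dOp_dStar_bounded a).1 G).tsum_add ((dOp_dStar_bounded b).1 G)]
        exact tsum_congr fun H => by rw [h1, add_mul]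
      map_smul' := fun c a => by
        have h1 : ∀ H, dStar (c • a).1 H = c * dStar a.1 H := fun H => by
          rw [dStar, dStar, ← tsum_mul_left]
          exact tsum_congr fun G => mul_assoc c (a.1 G) _
        refine Subtype.ext (funext fun G => ?_)
        change dOp (dStar (c • a).1) G = c * dOp (dStar a.1) G
        rw [dOp, dOp, ← tsum_mul_left]
        exact tsum_congr fun H => by rw [h1, mul_assoc] } 1 fun a => by
    rw [one_mul]
    refine (sq_le_sq₀ (norm_nonneg _) (norm_nonneg _)).1 ?_
    rw [L2Star.norm_sq, L2Star.norm_sq]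
    exact (dOp_dStar_bounded a).2.2

theorem dOp_dStar_smul (c : ℝ) (ν : X₀ p → ℝ) : dOp (dStar (c • ν)) = c • dOp (dStar ν) := by
  funext G
  simp only [dOp, dStar, Pi.smul_apply, smul_eq_mul, mul_assoc, tsum_mul_left]

theorem laplacian_surTo (F : X₀ p) [Fintype F.grp] :
    laplacian p (surTo F) = (cardGrp F : ℝ)⁻¹ •
      ∑ x : F.grp, surTo (toX₀ p (F.grp ⧸ Submodule.span ℤ_[p] {x})) := by
  refine L2Star.ext_mass fun G => ?_
  rw [map_smul, map_sum]
  change dOp (dStar (√(cohenLenstraConst p) • surToFun F)) G = (cardGrp F : ℝ)⁻¹ * ∑ x : F.grp,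
    √(cohenLenstraConst p) * surToFun (toX₀ p (F.grp ⧸ Submodule.span ℤ_[p] {x})) G
  rw [dOp_dStar_smul, Pi.smul_apply, smul_eq_mul, dOp_dStar_surToFun, tsum_fintype,
    ← Finset.mul_sum, mul_left_comm]

end

theorem mainTheorem1 (p : ℕ) [Fact p.Prime] :
    ∃ (Δ₀ : L2Star p →L[ℝ] L2Star p) (𝔉 : L2Star p →ₗᵢ[ℝ] L2Star p),
      -- `Δ₀` is the operator `d d*`, all of whose defining series converge on `L²(X₀, μ₀)*`
      (∀ ν : L2Star p,
        (∀ H : X₁ p, Summable fun G : X₀ p => ν G * probDStar G H) ∧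
        (∀ G : X₀ p, Summable fun H : X₁ p => dStar ν H * probD H G) ∧
        ⇑(Δ₀ ν) = dOp (dStar ν)) ∧
      -- `𝔉` is the unique continuous linear operator with the prescribed values
      (∀ F : X₀ p, ⇑(𝔉 (surFrom F)) = Real.sqrt (cohenLenstraConst p) • surToFun F) ∧
      (∀ T : L2Star p →L[ℝ] L2Star p,
        (∀ F : X₀ p, ⇑(T (surFrom F)) = Real.sqrt (cohenLenstraConst p) • surToFun F) →
          T = 𝔉.toContinuousLinearMap) ∧
      -- the intertwining relation
      (∀ f : L2Star p, Δ₀ (𝔉 f) = 𝔉 (mulInvCard f)) ∧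
      -- the eigenfunctions
      (∀ G : X₀ p, 𝔉 (unitAt G) ≠ 0 ∧
        Δ₀ (𝔉 (unitAt G)) = (1 / (cardGrp G : ℝ)) • 𝔉 (unitAt G)) := by
  obtain ⟨𝔉, h𝔉⟩ := exists_linearIsometry_surFrom_eq_surTo p
  have hint : ∀ f : L2Star p, laplacian p (𝔉 f) = 𝔉 (mulInvCard f) := by
    have h : (laplacian p).comp 𝔉.toContinuousLinearMap =
        𝔉.toContinuousLinearMap.comp (mulInvCardL p) := ext_of_eq_on_surFrom fun F => by
      have := Fintype.ofFinite F.grp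
      change laplacian p (𝔉 (surFrom F)) = 𝔉 (mulInvCard (surFrom F))
      rw [h𝔉, laplacian_surTo, mulInvCard_surFrom, map_smul, map_sum]
      simp only [h𝔉]
    exact fun f => DFunLike.congr_fun h f
  refine ⟨laplacian p, 𝔉, fun ν => ⟨(dStar_bounded ν).1, (dOp_dStar_bounded ν).1, rfl⟩,
    fun F => ?_, fun T hT => ext_of_eq_on_surFrom fun F => Subtype.ext ?_, hint, fun G => ⟨?_, ?_⟩⟩
  · rw [h𝔉]
    rfl
  · change (T (surFrom F)).1 = (𝔉 (surFrom F)).1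
    rw [hT, h𝔉]
    rfl
  · rw [Ne, map_eq_zero_iff 𝔉 𝔉.injective]
    exact unitAt_ne_zero G
  · rw [hint, mulInvCard_unitAt, map_smul]
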